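/- Let $n\ge 2$. Write $J=\begin{pmatrix}0&I_n\\-I_n&0\end{pmatrix}$ and let $\mathfrak{su}(2n)=\mathfrak h\oplus\mathfrak m$ be the eigenspace decomposition of $\sigma(g)=J\bar gJ^{-1}$ (eigenvalues $1$ and $-1$), so that $\mathfrak h=\mathfrak{sp}(n)$ consists of the matrices $\begin{pmatrix}C&D\\-\bar D&\bar C\end{pmatrix}$ with $C$ skew-Hermitian, $D$ symmetric, and $\mathfrak m$ of the matrices $\begin{pmatrix}A&B\\\bar B&-\bar A\end{pmatrix}$ with $A$ skew-Hermitian and trace-free, $B$ skew-symmetric. Put $\chi=8(n-1)n^2$, $\rho=8(n-1)$ and let $e_x\in\mathfrak m$ be the constant element with $A=\chi^{-1/2}\operatorname{diag}((n-1)\mathrm i,-\mathrm i,\dots,-\mathrm i)$, $B=0$. Let $\mathfrak m_\parallel,\mathfrak h_\parallel$ be its centralizers in $\mathfrak m,\mathfrak h$ (block-diagonal $A,B,C,D$ with respect to $1+(n-1)$) and $\mathfrak m_\perp,\mathfrak h_\perp\simeq\mathbb C^{n-1}\oplus\mathbb C^{n-1}$ their orthogonal complements, a pair of row vectors $(v_1,v_2)$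 corresponding to $\begin{pmatrix}0&v_1\\-\bar v_1^t&0\end{pmatrix}$ as $A$ (resp. $C$) and $\begin{pmatrix}0&v_2\\-v_2^t&0\end{pmatrix}$ as $B$ (resp. $\begin{pmatrix}0&v_2\\v_2^t&0\end{pmatrix}$ as $D$). Consider a smooth non-stretching curve flow $\gamma(t,x)$ in $SU(2n)/Sp(n)$, with $x$ the arclength, with an $Sp(n)$-parallel frame in which the coframe and connection have $x$-components $e_x$ and $\omega_x=(u_1,u_2)\in\mathfrak h_\perp$ and $t$-components $e_t=h_\parallel+h_\perp\in\mathfrak m_\parallel\oplus\mathfrak m_\perp$ and $\omega_t=\varpi^\parallel+\varpi^\perp\in\mathfrak h_\parallel\oplus\mathfrak h_\perp$. Put $h^\perp=\operatorname{ad}(e_x)h_\perp=\frac{\mathrm i}{\sqrt\rho}h_\perp$. For row vectors $x,y$ let $C_xy=x\bar y^t-y\bar x^t$, $A_xy=x\bar y^t+y\bar x^t$, $S_xy=xy^t+yx^t$, and $\mathbf C_xy=\bar x^ty-\bar y^tx$, $\mathbf A_xy=x^t\bar y-\bar y^tx$, $\mathbf S_xy=x^t\bar y+\bar y^tx$; let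 $R_yz=zy$ for scalars $z$, $L_yX=yX$ for matrices $X$, and let $\mathsf c$ be complex conjugation. Here $D_x^{-1}$ is an antiderivative that respects the type of its argument (real, imaginary, skew-Hermitian, symmetric, skew-symmetric); in the application of an operator to a pair, the same antiderivative is used in both components of the result. Let $$\mathcal H=\begin{pmatrix} \begin{aligned}&D_x-R_{u_1}D_x^{-1}C_{u_1}+R_{\bar u_2}D_x^{-1}S_{u_2}\\&\ +L_{u_1}D_x^{-1}\mathbf C_{u_1}+L_{u_2}D_x^{-1}\mathsf c\,\mathbf S_{u_2}\end{aligned}& \begin{aligned}&-R_{u_1}D_x^{-1}C_{u_2}-R_{\bar u_2}D_x^{-1}S_{u_1}\\&\ +L_{u_1}D_x^{-1}\mathsf c\,\mathbf C_{u_2}-L_{u_2}D_x^{-1}\mathbf S_{u_1}\end{aligned}\\[2ex] \begin{aligned}&-R_{u_2}D_x^{-1}C_{u_1}-R_{\bar u_1}D_x^{-1}S_{u_2}\\&\ +L_{u_2}D_x^{-1}\mathsf c\,\mathbf C_{u_1}-L_{u_1}D_x^{-1}\mathbf S_{u_2}\end{aligned}& \begin{aligned}&D_x-R_{u_2}D_x^{-1}C_{u_2}+R_{\bar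 u_1}D_x^{-1}S_{u_1}\\&\ +L_{u_2}D_x^{-1}\mathbf C_{u_2}+L_{u_1}D_x^{-1}\mathsf c\,\mathbf S_{u_1}\end{aligned} \end{pmatrix},$$ $$\mathcal J=\begin{pmatrix} \begin{aligned}&D_x+R_{u_1}D_x^{-1}A_{u_1}+L_{\mathrm iu_2}D_x^{-1}\mathsf c\,\mathbf A_{\mathrm iu_2}\\&\ +L_{\mathrm iu_1}D_x^{-1}\mathbf C_{\mathrm iu_1}\end{aligned}& \begin{aligned}&R_{u_1}D_x^{-1}A_{u_2}+L_{\mathrm iu_2}D_x^{-1}\mathbf A_{\mathrm iu_1}\\&\ -L_{\mathrm iu_1}D_x^{-1}\mathsf c\,\mathbf C_{\mathrm iu_2}\end{aligned}\\[2ex] \begin{aligned}&R_{u_2}D_x^{-1}A_{u_1}+L_{\mathrm iu_1}D_x^{-1}\mathbf A_{\mathrm iu_2}\\&\ -L_{\mathrm iu_2}D_x^{-1}\mathsf c\,\mathbf C_{\mathrm iu_1}\end{aligned}& \begin{aligned}&D_x+R_{u_2}D_x^{-1}A_{u_2}+L_{\mathrm iu_1}D_x^{-1}\mathsf c\,\mathbf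 A_{\mathrm iu_1}\\&\ +L_{\mathrm iu_2}D_x^{-1}\mathbf C_{\mathrm iu_2}\end{aligned} \end{pmatrix}.$$ (1) In every such frame the Cartan structure equations $$D_xe_t-D_te_x+[\omega_x,e_t]-[\omega_t,e_x]=0,\qquad D_x\omega_t-D_t\omega_x+[\omega_x,\omega_t]=-[e_x,e_t]$$ hold. For smooth $u=(u_1,u_2)$, $h_\perp$, $\varpi^\perp$ on an open set of the $(t,x)$-plane, these equations hold for some smooth $h_\parallel$, $\varpi^\parallel$ if and only if $$\begin{pmatrix}u_1\\u_2\end{pmatrix}_t=\mathcal H\begin{pmatrix}\varpi^{1\perp}\\\varpi^{2\perp}\end{pmatrix}+\begin{pmatrix}h^{1\perp}\\h^{2\perp}\end{pmatrix},\qquad \begin{pmatrix}\varpi^{1\perp}\\\varpi^{2\perp}\end{pmatrix}=8(n-1)\,\mathcal J\begin{pmatrix}h^{1\perp}\\h^{2\perp}\end{pmatrix}$$ for some choice of the antiderivatives $D_x^{-1}$. (2) On the $x$-jet space of $(u_1,u_2)$, in the formal calculus where functionals $\int f\,dx$ are taken modulo total $x$-derivatives (in any differential extension of the jet functions that contains the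 antiderivatives and solutions involved): $\mathcal H$ is a Hamiltonian cosymplectic operator, i.e. the bracket $\{F,G\}=\int\sum_{l}A(\delta F/\delta u_l,(\mathcal H\,\delta G/\delta u)_l)\,dx$ of real functionals is skew-symmetric and satisfies the Jacobi identity; $\mathcal J$ is a symplectic operator, i.e. $\boldsymbol\omega(X_1,X_2)=\int\sum_{l}A(X_1u_l,(\mathcal J X_2u)_l)\,dx$ is skew-symmetric and closed; and $\mathcal H$, $\mathcal J$ are compatible, i.e. for all real $c_1,c_2$ the operator $c_1\mathcal H+c_2\mathcal J^{-1}$, with $\mathcal J^{-1}$ the formal inverse, is a Hamiltonian cosymplectic operator. (3) $\mathcal H$ and $\mathcal J$ are invariant under the adjoint action of $Sp(1)\times Sp(n-1)\subset Sp(n)$ on $\mathfrak h_\perp\simeq\mathbb C^{n-1}\oplus\mathbb C^{n-1}$. -/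

import Mathlib

open Matrix
open scoped ContDiff

noncomputable section

namespace SymplecticFlow

/-! ## Inner and outer products, and the matrix form of `su(2n)` -/

/-- A pair `(v₁, v₂)` of row vectors with `m` entries in `A`. -/
abbrev Vec (m : ℕ) (A : Type) : Type := Fin 2 → Fin m → A

section Algebra

variable {A : Type} [CommRing A] [StarRing A] [Algebra ℂ A] {m : ℕ}

/-- The constant function with value `z`. -/
def cst (A : Type) [CommRing A] [Algebra ℂ A] (z : ℂ) : A := algebraMap ℂ A z

/-- `C(x, y) = x ȳᵗ - y x̄ᵗ`. -/
def innerC (x y : Fin m → A) : A := ∑ j, (x j * star (y j) - y j * star (x j))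

/-- `A(x, y) = x ȳᵗ + y x̄ᵗ`. -/
def innerA (x y : Fin m → A) : A := ∑ j, (x j * star (y j) + y j * star (x j))

/-- `S(x, y) = x yᵗ + y xᵗ`. -/
def innerS (x y : Fin m → A) : A := ∑ j, (x j * y j + y j * x j)

/-- The outer product `x̄ᵗ y - ȳᵗ x`, a skew-Hermitian matrix. -/
def outerC (x y : Fin m → A) : Matrix (Fin m) (Fin m) A :=
  Matrix.of fun i j => star (x i) * y j - star (y i) * x j

/-- The outer product `xᵗ ȳ - ȳᵗ x`, a skew-symmetric matrix. -/
def outerA (x y : Fin m → A) : Matrix (Fin m) (Fin m) A :=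
  Matrix.of fun i j => x i * star (y j) - star (y i) * x j

/-- The outer product `xᵗ ȳ + ȳᵗ x`, a symmetric matrix. -/
def outerS (x y : Fin m → A) : Matrix (Fin m) (Fin m) A :=
  Matrix.of fun i j => x i * star (y j) + star (y i) * x j

/-- Entrywise complex conjugation. -/
def conjM {k l : Type} (X : Matrix k l A) : Matrix k l A := X.map star

/-- Multiplication by the imaginary unit. -/
def iV (x : Fin m → A) : Fin m → A := fun j => cst A Complex.I * x j

/-- The real pairing `A(x₁, y₁) + A(x₂, y₂)`. -/
def pair (x y : Vec m A) : A := ∑ l, innerA (x l) (y l)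

/-- Row and column index set of `n × n` matrices, `n = m + 1`, split as `1 + (n - 1)`. -/
abbrev Idx (m : ℕ) : Type := Unit ⊕ Fin m

/-- `2n × 2n` matrices over `A`, `n = m + 1`. -/
abbrev BigMat (m : ℕ) (A : Type) : Type := Matrix (Idx m ⊕ Idx m) (Idx m ⊕ Idx m) A

/-- The matrix `(X, Y)` of `𝔪 = su(2n)/sp(n)`. -/
def mMat (X Y : Matrix (Idx m) (Idx m) A) : BigMat m A :=
  Matrix.fromBlocks X Y (conjM Y) (-conjM X)

/-- The matrix `(X, Y)` of `𝔥 = sp(n)`; also of the group `Sp(n)`. -/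
def hMat (X Y : Matrix (Idx m) (Idx m) A) : BigMat m A :=
  Matrix.fromBlocks X Y (-conjM Y) (conjM X)

/-- `𝔪_∥`, for `X` skew-Hermitian and `Y` skew-symmetric. -/
def mPar (X Y : Matrix (Fin m) (Fin m) A) : BigMat m A :=
  mMat (Matrix.fromBlocks (Matrix.of fun _ _ => -X.trace) 0 0 X) (Matrix.fromBlocks 0 0 0 Y)

/-- `𝔪_⊥ ≃ ℂ^{n-1} ⊕ ℂ^{n-1}`. -/
def mPerp (v : Vec m A) : BigMat m A :=
  mMat
    (Matrix.fromBlocks 0 (Matrix.replicateRow Unit (v 0))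
      (-Matrix.replicateCol Unit (star (v 0))) 0)
    (Matrix.fromBlocks 0 (Matrix.replicateRow Unit (v 1)) (-Matrix.replicateCol Unit (v 1)) 0)

/-- `𝔥_∥ = sp(1) ⊕ sp(n-1)`, for `c` imaginary, `X` skew-Hermitian and `Y` symmetric; with
unitary blocks, the group `Sp(1) × Sp(n-1)`. -/
def hPar (c d : A) (X Y : Matrix (Fin m) (Fin m) A) : BigMat m A :=
  hMat (Matrix.fromBlocks (Matrix.of fun _ _ => c) 0 0 X)
    (Matrix.fromBlocks (Matrix.of fun _ _ => d) 0 0 Y)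

/-- `𝔥_⊥ ≃ ℂ^{n-1} ⊕ ℂ^{n-1}`. -/
def hPerp (v : Vec m A) : BigMat m A :=
  hMat
    (Matrix.fromBlocks 0 (Matrix.replicateRow Unit (v 0))
      (-Matrix.replicateCol Unit (star (v 0))) 0)
    (Matrix.fromBlocks 0 (Matrix.replicateRow Unit (v 1)) (Matrix.replicateCol Unit (v 1)) 0)

/-- The constant unit-norm element `e_x = χ^{-1/2} (-i I_{n-1}, 0)` of `𝔪_∥`, where
`χ = 8 (n - 1) n²` and `n = m + 1`. -/
def eX (m : ℕ) (A : Type) [CommRing A] [StarRing A] [Algebra ℂ A] : BigMat m A :=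
  mPar (cst A (-Complex.I / (Real.sqrt (8 * m * ((m : ℝ) + 1) ^ 2) : ℂ)) •
    (1 : Matrix (Fin m) (Fin m) A)) 0

end Algebra

/-! ## Differential algebras with complex conjugation -/

/-- A derivation that commutes with complex conjugation. -/
structure RealDer (A : Type) [CommRing A] [StarRing A] [Algebra ℂ A] where
  der : Derivation ℂ A A
  map_star : ∀ a, der (star a) = star (der a)

section Dual

variable {A : Type} [CommRing A] [StarRing A] [Algebra ℂ A] [StarModule ℂ A] {m : ℕ}

/-- Complex conjugation on `A[ε]`, `ε² = 0`, with `ε` real. -/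
instance dualStarRing : StarRing (DualNumber A) where
  star a := (star a.1, star a.2)
  star_involutive a := by
    apply TrivSqZeroExt.ext <;> exact star_star _
  star_mul a b := by
    apply TrivSqZeroExt.ext
    · change star ((a * b).fst) = star b.fst * star a.fst
      rw [TrivSqZeroExt.fst_mul, star_mul]
    · change star ((a * b).snd) = star b.fst • star a.snd + MulOpposite.op (star a.fst) • star b.snd
      rw [TrivSqZeroExt.snd_mul]
      simp only [smul_eq_mul, MulOpposite.smul_eq_mul_unop, MulOpposite.unop_op, star_add, star_mul]
      ring
  star_add a b := by
    apply TrivSqZeroExt.ext <;> exact star_add _ _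

instance dualStarModule : StarModule ℂ (DualNumber A) where
  star_smul z a := by
    apply TrivSqZeroExt.ext <;> exact star_smul z _

/-- The derivation `D (a + ε b) = D a + ε D b` of `A[ε]`. -/
def RealDer.dual (D : RealDer A) : RealDer (DualNumber A) where
  der := Derivation.mk'
    { toFun := fun a => (D.der a.1, D.der a.2)
      map_add' := fun a b => by
        apply TrivSqZeroExt.ext <;> exact map_add D.der _ _
      map_smul' := fun z a => by
        apply TrivSqZeroExt.ext <;> exact D.der.map_smul z _ }
    (fun a b => by
      apply TrivSqZeroExt.ext
      · change D.der (a.1 * b.1) = a.1 * D.der b.1 + b.1 * D.der a.1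
        simp only [Derivation.leibniz, smul_eq_mul]
      · change D.der (a.1 * b.2 + a.2 * b.1)
          = a.1 * D.der b.2 + a.2 * D.der b.1 + (b.1 * D.der a.2 + b.2 * D.der a.1)
        simp only [map_add, Derivation.leibniz, smul_eq_mul]
        ring)
  map_star a := by
    apply TrivSqZeroExt.ext
    · exact D.map_star _
    · exact D.map_star _

/-- The pair `v + ε w`. -/
def dualVec (v w : Vec m A) : Vec m (DualNumber A) := fun l j => (v l j, w l j)

end Dual

/-! ## The jet space of `(u₁, u₂)` -/

/-- The `x`-jet space: a point consists of `x` and of the values of `(u₁, u₂)` and of all its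
`x`-derivatives. -/
abbrev JetSpace (m : ℕ) : Type := ℝ × (ℕ → Vec m ℂ)

section Jets

variable {m : ℕ}

/-- The coordinates of order less than `N`. -/
def trunc (N : ℕ) (p : JetSpace m) : ℝ × (Fin N → Vec m ℂ) := (p.1, fun i => p.2 i)

/-- Smooth maps on the jet space that depend on finitely many of its coordinates. -/
def IsLocal {F : Type} [NormedAddCommGroup F] [NormedSpace ℝ F] (f : JetSpace m → F) : Prop :=
  ∃ (N : ℕ) (g : ℝ × (Fin N → Vec m ℂ) → F), ContDiff ℝ ∞ g ∧ ∀ p, f p = g (trunc N p)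

theorem IsLocal.comp {F G : Type} [NormedAddCommGroup F] [NormedSpace ℝ F]
    [NormedAddCommGroup G] [NormedSpace ℝ G] {f : JetSpace m → F} (hf : IsLocal f)
    {k : F → G} (hk : ContDiff ℝ ∞ k) : IsLocal fun p => k (f p) := by
  obtain ⟨N, g, hg, h⟩ := hf
  exact ⟨N, fun q => k (g q), hk.comp hg, fun p => congrArg k (h p)⟩

theorem IsLocal.raise {F : Type} [NormedAddCommGroup F] [NormedSpace ℝ F]
    {f : JetSpace m → F} {N : ℕ} {g : ℝ × (Fin N → Vec m ℂ) → F} (hg : ContDiff ℝ ∞ g)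
    (h : ∀ p, f p = g (trunc N p)) {M : ℕ} (hNM : N ≤ M) :
    ∃ g' : ℝ × (Fin M → Vec m ℂ) → F, ContDiff ℝ ∞ g' ∧ ∀ p, f p = g' (trunc M p) := by
  refine ⟨fun q => g (q.1, fun i => q.2 (Fin.castLE hNM i)), hg.comp ?_, fun p => by rw [h]; rfl⟩
  fun_prop

theorem IsLocal.prodMk {F G : Type} [NormedAddCommGroup F] [NormedSpace ℝ F]
    [NormedAddCommGroup G] [NormedSpace ℝ G] {f : JetSpace m → F} (hf : IsLocal f)
    {k : JetSpace m → G} (hk : IsLocal k) : IsLocal fun p => (f p, k p) := by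
  obtain ⟨N, g, hg, h⟩ := hf
  obtain ⟨N', g', hg', h'⟩ := hk
  obtain ⟨g1, hg1, h1⟩ := IsLocal.raise hg h (le_max_left N N')
  obtain ⟨g2, hg2, h2⟩ := IsLocal.raise hg' h' (le_max_right N N')
  exact ⟨_, fun q => (g1 q, g2 q), hg1.prodMk hg2, fun p => Prod.ext (h1 p) (h2 p)⟩

theorem IsLocal.trunc (N : ℕ) : IsLocal (trunc N : JetSpace m → _) :=
  ⟨N, id, contDiff_id, fun _ => rfl⟩

/-- The algebra of smooth complex-valued functions on the jet space (each of finite order). -/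
def jetAlg (m : ℕ) : StarSubalgebra ℂ (JetSpace m → ℂ) where
  carrier := {f | IsLocal f}
  mul_mem' hf hg := (IsLocal.prodMk hf hg).comp (contDiff_fst.mul contDiff_snd)
  add_mem' hf hg := (IsLocal.prodMk hf hg).comp (contDiff_fst.add contDiff_snd)
  algebraMap_mem' z := ⟨0, fun _ => z, contDiff_const, fun _ => rfl⟩
  star_mem' hf := hf.comp (k := fun z : ℂ => star z) (starL' ℝ : ℂ ≃L[ℝ] ℂ).contDiff

theorem IsLocal.hasDerivAt {f : JetSpace m → ℂ} {N : ℕ} {g : ℝ × (Fin N → Vec m ℂ) → ℂ}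
    (hg : ContDiff ℝ ∞ g) (h : ∀ p, f p = g (SymplecticFlow.trunc N p)) (p v : JetSpace m) :
    HasDerivAt (fun s : ℝ => f (p + s • v))
      (fderiv ℝ g (SymplecticFlow.trunc N p) (SymplecticFlow.trunc N v)) 0 := by
  have hl : HasDerivAt (fun s : ℝ => SymplecticFlow.trunc N p + s • SymplecticFlow.trunc N v)
      (SymplecticFlow.trunc N v) 0 := by
    simpa using ((hasDerivAt_id (0 : ℝ)).smul_const (SymplecticFlow.trunc N v)).const_add
      (SymplecticFlow.trunc N p)
  have hd : HasFDerivAt g (fderiv ℝ g (SymplecticFlow.trunc N p))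
      (SymplecticFlow.trunc N p + (0 : ℝ) • SymplecticFlow.trunc N v) := by
    simpa using (hg.differentiable (by simp) (SymplecticFlow.trunc N p)).hasFDerivAt
  have := hd.comp_hasDerivAt (0 : ℝ) hl
  refine this.congr_of_eventuallyEq (Filter.Eventually.of_forall fun s => ?_)
  change f (p + s • v) = g _
  rw [h]
  rfl

theorem jet_hasDerivAt (f : jetAlg m) (p v : JetSpace m) :
    HasDerivAt (fun s : ℝ => f.1 (p + s • v)) (deriv (fun s : ℝ => f.1 (p + s • v)) 0) 0 := by
  obtain ⟨N, g, hg, h⟩ := f.2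
  exact (IsLocal.hasDerivAt hg h p v).differentiableAt.hasDerivAt

/-- The derivation of the jet algebra given by a vector field `ξ` on the jet space:
`(ξ f)(p) = d/ds f(p + s ξ(p))` at `s = 0`. -/
def alongField (ξ : JetSpace m → JetSpace m) (hξ : ∀ N, IsLocal fun p => trunc N (ξ p)) :
    RealDer (jetAlg m) where
  der := Derivation.mk'
    { toFun := fun f => ⟨fun p => deriv (fun s : ℝ => f.1 (p + s • ξ p)) 0, by
        obtain ⟨N, g, hg, h⟩ := f.2
        have h1 : IsLocal fun p => fderiv ℝ g (trunc N p) (trunc N (ξ p)) :=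
          ((IsLocal.trunc N).prodMk (hξ N)).comp (k := fun q => fderiv ℝ g q.1 q.2)
            (((hg.fderiv_right (m := ∞) (by simp)).comp contDiff_fst).clm_apply contDiff_snd)
        have h2 : (fun p => deriv (fun s : ℝ => f.1 (p + s • ξ p)) 0)
            = fun p => fderiv ℝ g (trunc N p) (trunc N (ξ p)) :=
          funext fun p => (IsLocal.hasDerivAt hg h p (ξ p)).deriv
        change IsLocal _
        rw [h2]
        exact h1⟩
      map_add' := fun f g => Subtype.ext <| funext fun p =>
        ((jet_hasDerivAt f p (ξ p)).add (jet_hasDerivAt g p (ξ p))).deriv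
      map_smul' := fun z f => Subtype.ext <| funext fun p =>
        ((jet_hasDerivAt f p (ξ p)).const_smul z).deriv }
    (fun f g => Subtype.ext <| funext fun p => by
      refine ((jet_hasDerivAt f p (ξ p)).mul (jet_hasDerivAt g p (ξ p))).deriv.trans ?_
      simp only [zero_smul, add_zero]
      change _ = f.1 p * deriv (fun s : ℝ => g.1 (p + s • ξ p)) 0
        + g.1 p * deriv (fun s : ℝ => f.1 (p + s • ξ p)) 0
      ring)
  map_star f := Subtype.ext <| funext fun p => (jet_hasDerivAt f p (ξ p)).star.deriv

/-- The total derivative `D_x = ∂/∂x + ∑ u^{(k+1)} ∂/∂u^{(k)}` on the jet space. -/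
def totalD (m : ℕ) : RealDer (jetAlg m) :=
  alongField (fun p => (1, fun k => p.2 (k + 1))) fun N =>
    ⟨N + 1, fun q => (1, fun i => q.2 i.succ), by fun_prop, fun _ => rfl⟩

/-- The real partial derivative in direction `e` of the variable `u^{(k)}`. -/
def partialD (k : ℕ) (e : Vec m ℂ) : RealDer (jetAlg m) :=
  alongField (fun _ => (0, Pi.single k e)) fun N =>
    ⟨0, fun _ => trunc N (0, Pi.single k e), contDiff_const, fun _ => rfl⟩

/-- The pair of vectors with the entry `z` in place `(l, j)` and zeros elsewhere. -/
def unitVec (l : Fin 2) (j : Fin m) (z : ℂ) : Vec m ℂ := Pi.single l (Pi.single j z)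

/-- The Wirtinger derivative `∂f/∂u_{l,j}^{(k)}`. -/
def dU (l : Fin 2) (j : Fin m) (k : ℕ) (f : jetAlg m) : jetAlg m :=
  (1 / 2 : ℂ) • ((partialD k (unitVec l j 1)).der f
    - Complex.I • (partialD k (unitVec l j Complex.I)).der f)

/-- The Wirtinger derivative `∂f/∂ū_{l,j}^{(k)}`. -/
def dUbar (l : Fin 2) (j : Fin m) (k : ℕ) (f : jetAlg m) : jetAlg m :=
  (1 / 2 : ℂ) • ((partialD k (unitVec l j 1)).der f
    + Complex.I • (partialD k (unitVec l j Complex.I)).der f)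

/-- The variational derivative `δF/δu` of `F = ∫ f dx` for real `f`, normalised by
`δF(h) = ∫ A(δF/δu, h) dx`; thus `(δF/δu)_{l,j} = ∑ₖ (-D_x)ᵏ ∂f/∂ū_{l,j}^{(k)}`
(a finite sum). -/
def varDeriv (f : jetAlg m) : Vec m (jetAlg m) := fun l j =>
  ∑ᶠ k : ℕ, (-1 : jetAlg m) ^ k * (totalD m).der^[k] (dUbar l j k f)

/-- The coordinate functions `u_{l,j}`. -/
def coordU : Vec m (jetAlg m) := fun l j =>
  ⟨fun p => p.2 0 l j, 1, fun q => q.2 0 l j, by fun_prop, fun _ => rfl⟩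

/-- An extension of the differential algebra of functions on the jet space by further (nonlocal)
variables. -/
structure JetExtension (m : ℕ) (A : Type) [CommRing A] [StarRing A] [Algebra ℂ A] where
  /-- The total `x`-derivative. -/
  D : RealDer A
  incl : jetAlg m →⋆ₐ[ℂ] A
  incl_D : ∀ f, incl ((totalD m).der f) = D.der (incl f)

variable {A : Type} [CommRing A] [StarRing A] [Algebra ℂ A]

/-- A pair of vector functions on the jet space, read in an extension. -/
def JetExtension.vec (E : JetExtension m A) (v : Vec m (jetAlg m)) : Vec m A :=
  fun l j => E.incl (v l j)

/-- The variable `(u₁, u₂)` in an extension. -/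
def JetExtension.u (E : JetExtension m A) : Vec m A := E.vec coordU

/-- `pr(X) f` for the (possibly nonlocal) evolutionary vector field `X = h · ∂/∂u` and a function
`f` on the jet space (a finite sum). -/
def JetExtension.pr (E : JetExtension m A) (h : Vec m A) (f : jetAlg m) : A :=
  ∑ᶠ k : ℕ, ∑ l, ∑ j, (E.incl (dU l j k f) * E.D.der^[k] (h l j)
    + E.incl (dUbar l j k f) * E.D.der^[k] (star (h l j)))

end Jets

/-! ## Hamiltonian and symplectic operators -/

/-- A nonlocal operator depending on `(u₁, u₂)`. `K D u w v` says that `v` is a value of `K` at `w`,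
where `u, w, v` have entries in a differential algebra with `x`-derivative `D`. Each `D_x⁻¹`
is an antiderivative in that algebra. -/
def NonlocalOp (m : ℕ) : Type 1 :=
  ∀ (A : Type) [CommRing A] [StarRing A] [Algebra ℂ A] [StarModule ℂ A],
    RealDer A → Vec m A → Vec m A → Vec m A → Prop

section Operators

variable {m : ℕ}

/-- The formal inverse operator. -/
def NonlocalOp.inv (K : NonlocalOp m) : NonlocalOp m :=
  fun A _ _ _ _ D u w v => K A D u v w

/-- The linear combination `c₁ K₁ + c₂ K₂` of operators. -/
def NonlocalOp.comb (c₁ c₂ : ℝ) (K₁ K₂ : NonlocalOp m) : NonlocalOp m :=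
  fun A _ _ _ _ D u w v => ∃ v₁ v₂ : Vec m A, K₁ A D u w v₁ ∧ K₂ A D u w v₂ ∧
    v = (c₁ : ℂ) • v₁ + (c₂ : ℂ) • v₂

/-- `∫ a dx = 0`: the density `a` is a total `x`-derivative. -/
def IntegralZero {A : Type} [CommRing A] [StarRing A] [Algebra ℂ A] (D : RealDer A) (a : A) :
    Prop :=
  ∃ b, a = D.der b

/-- `K` is a Hamiltonian (cosymplectic) operator: the bracket
`{F, G} = ∫ A(δF/δu, K(δG/δu)) dx` of real functionals on the jet space is skew-symmetric
and satisfies the Jacobi identity.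

The functionals are `F i = ∫ f i dx`, with Hamiltonian vector fields `X i = v i · ∂/∂u`, where
`v i = K (δF i/δu)`. The action of `pr (X j)` is read off from `u ↦ u + ε (v j)`, `ε² = 0`: it sends
`δF i/δu` to its prolongation and `v i` to `dv j i`. Thus
`{{F i, F j}, F k} = pr (X k) {F i, F j}
  = ∫ A(pr (X k) (δF i/δu), v j) + A(δF i/δu, dv k j) dx`. -/
def IsHamiltonian (K : NonlocalOp m) : Prop :=
  ∀ (A : Type) [CommRing A] [StarRing A] [Algebra ℂ A] [StarModule ℂ A] (E : JetExtension m A)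
    (f : Fin 3 → jetAlg m), (∀ i, star (f i) = f i) →
  ∀ v : Fin 3 → Vec m A, (∀ i, K A E.D E.u (E.vec (varDeriv (f i))) (v i)) →
    (∀ i j, IntegralZero E.D
      (pair (E.vec (varDeriv (f i))) (v j) + pair (E.vec (varDeriv (f j))) (v i))) ∧
    ∀ dv : Fin 3 → Fin 3 → Vec m A,
      (∀ j i, K (DualNumber A) E.D.dual (dualVec E.u (v j))
        (dualVec (E.vec (varDeriv (f i))) (fun l a => E.pr (v j) (varDeriv (f i) l a)))
        (dualVec (v i) (dv j i))) →
      let bracket : Fin 3 → Fin 3 → Fin 3 → A := fun i j k =>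
        pair (fun l a => E.pr (v k) (varDeriv (f i) l a)) (v j)
          + pair (E.vec (varDeriv (f i))) (dv k j)
      IntegralZero E.D (bracket 0 1 2 + bracket 1 2 0 + bracket 2 0 1)

/-- `K` is a symplectic operator: the form `ω(X₁, X₂) = ∫ A(h₁, K h₂) dx` on vector fields
`X = h · ∂/∂u` is skew-symmetric and closed, the latter meaning
`∫ A(h₂, (pr (X₁) K) h₃) dx + cyclic = 0`. Here `dv i j = (pr (X i) K) h j` is read off from
`u ↦ u + ε (h i)`, `ε² = 0`, with `h j` kept fixed. -/
def IsSymplectic (K : NonlocalOp m) : Prop :=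
  ∀ (A : Type) [CommRing A] [StarRing A] [Algebra ℂ A] [StarModule ℂ A] (E : JetExtension m A)
    (h v : Fin 3 → Vec m A), (∀ i, K A E.D E.u (h i) (v i)) →
    (∀ i j, IntegralZero E.D (pair (h i) (v j) + pair (h j) (v i))) ∧
    ∀ dv : Fin 3 → Fin 3 → Vec m A,
      (∀ i j, K (DualNumber A) E.D.dual (dualVec E.u (h i)) (dualVec (h j) 0)
        (dualVec (v j) (dv i j))) →
      IntegralZero E.D (pair (h 1) (dv 0 2) + pair (h 2) (dv 1 0) + pair (h 0) (dv 2 1))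

/-- A cosymplectic operator `H` and a symplectic operator `J` are compatible: every linear
combination `c₁ H + c₂ J⁻¹` is a Hamiltonian (cosymplectic) operator. -/
def IsCompatible (H J : NonlocalOp m) : Prop :=
  ∀ c₁ c₂ : ℝ, IsHamiltonian (NonlocalOp.comb c₁ c₂ H J.inv)

end Operators

/-! ## The operators `H` and `J` -/

section HJ

variable {m : ℕ} {A : Type} [CommRing A] [StarRing A] [Algebra ℂ A]

/-- Apply `D_x` (or another operation) to all entries of a vector. -/
def mapV (D : A → A) (v : Fin m → A) : Fin m → A := fun j => D (v j)

/-- The `2 × 2` array of operators `𝓗`, for a given operation `I` in the role of `D_x⁻¹`;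
`R_y x = x • y` and `L_y X = y ᵥ* X`. -/
def blockH (D I : A → A) (u : Vec m A) : Fin 2 → Fin 2 → (Fin m → A) → (Fin m → A) :=
  ![![fun w => mapV D w - I (innerC (u 0) w) • u 0 + I (innerS (u 1) w) • star (u 1)
        + u 0 ᵥ* (outerC (u 0) w).map I + u 1 ᵥ* (conjM (outerS (u 1) w)).map I,
      fun w => - I (innerC (u 1) w) • u 0 - I (innerS (u 0) w) • star (u 1)
        + u 0 ᵥ* (conjM (outerC (u 1) w)).map I - u 1 ᵥ* (outerS (u 0) w).map I],
    ![fun w => - I (innerC (u 0) w) • u 1 - I (innerS (u 1) w) • star (u 0)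
        + u 1 ᵥ* (conjM (outerC (u 0) w)).map I - u 0 ᵥ* (outerS (u 1) w).map I,
      fun w => mapV D w - I (innerC (u 1) w) • u 1 + I (innerS (u 0) w) • star (u 0)
        + u 1 ᵥ* (outerC (u 1) w).map I + u 0 ᵥ* (conjM (outerS (u 0) w)).map I]]

/-- The `2 × 2` array of operators `𝓙`, for a given operation `I` in the role of `D_x⁻¹`. -/
def blockJ (D I : A → A) (u : Vec m A) : Fin 2 → Fin 2 → (Fin m → A) → (Fin m → A) :=
  ![![fun h => mapV D h + I (innerA (u 0) h) • u 0
        + iV (u 1) ᵥ* (conjM (outerA (iV (u 1)) h)).map I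
        + iV (u 0) ᵥ* (outerC (iV (u 0)) h).map I,
      fun h => I (innerA (u 1) h) • u 0
        + iV (u 1) ᵥ* (outerA (iV (u 0)) h).map I
        - iV (u 0) ᵥ* (conjM (outerC (iV (u 1)) h)).map I],
    ![fun h => I (innerA (u 0) h) • u 1
        + iV (u 0) ᵥ* (outerA (iV (u 1)) h).map I
        - iV (u 1) ᵥ* (conjM (outerC (iV (u 0)) h)).map I,
      fun h => mapV D h + I (innerA (u 1) h) • u 1
        + iV (u 0) ᵥ* (conjM (outerA (iV (u 0)) h)).map I
        + iV (u 1) ᵥ* (outerC (iV (u 1)) h).map I]]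

/-- Apply a `2 × 2` array of operators to a pair of vectors. -/
def applyBlock (T : Fin 2 → Fin 2 → (Fin m → A) → (Fin m → A)) (w : Vec m A) : Vec m A :=
  fun l => ∑ l', T l l' (w l')

end HJ

/-- The operator `𝓗`: in `blockH` applied to `w`, the terms with a common left factor are collected
under one `D_x⁻¹`, which is realised by an antiderivative of the same type, namely
`p = D_x⁻¹ (C_{u₁} w₁ + C_{u₂} w₂)` imaginary,
`q = D_x⁻¹ (S_{u₂} w₁ - S_{u₁} w₂)`,
`P = D_x⁻¹ (𝐂_{u₁} w₁ + conj 𝐂_{u₂} w₂)` skew-Hermitian, and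
`Q = D_x⁻¹ (conj 𝐒_{u₁} w₂ - 𝐒_{u₂} w₁)` symmetric. -/
def opH (m : ℕ) : NonlocalOp m := fun A _ _ _ _ D u w v =>
  ∃ (p q : A) (P Q : Matrix (Fin m) (Fin m) A),
    (star p = -p ∧ Pᴴ = -P ∧ Qᵀ = Q) ∧
    D.der p = innerC (u 0) (w 0) + innerC (u 1) (w 1) ∧
    D.der q = innerS (u 1) (w 0) - innerS (u 0) (w 1) ∧
    P.map D.der = outerC (u 0) (w 0) + conjM (outerC (u 1) (w 1)) ∧
    Q.map D.der = conjM (outerS (u 0) (w 1)) - outerS (u 1) (w 0) ∧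
    v 0 = mapV D.der (w 0) - p • u 0 + q • star (u 1) + u 0 ᵥ* P - u 1 ᵥ* conjM Q ∧
    v 1 = mapV D.der (w 1) - p • u 1 - q • star (u 0) + u 1 ᵥ* conjM P + u 0 ᵥ* Q

/-- The operator `𝓙`, with `blockJ` read in the same way:
`a = D_x⁻¹ (A_{u₁} h₁ + A_{u₂} h₂)` real,
`P = D_x⁻¹ (𝐂_{iu₁} h₁ - conj 𝐂_{iu₂} h₂)` skew-Hermitian, and
`Q = D_x⁻¹ (𝐀_{iu₂} h₁ + conj 𝐀_{iu₁} h₂)` skew-symmetric. -/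
def opJ (m : ℕ) : NonlocalOp m := fun A _ _ _ _ D u h v =>
  ∃ (a : A) (P Q : Matrix (Fin m) (Fin m) A),
    (star a = a ∧ Pᴴ = -P ∧ Qᵀ = -Q) ∧
    D.der a = innerA (u 0) (h 0) + innerA (u 1) (h 1) ∧
    P.map D.der = outerC (iV (u 0)) (h 0) - conjM (outerC (iV (u 1)) (h 1)) ∧
    Q.map D.der = outerA (iV (u 1)) (h 0) + conjM (outerA (iV (u 0)) (h 1)) ∧
    v 0 = mapV D.der (h 0) + a • u 0 + iV (u 0) ᵥ* P + iV (u 1) ᵥ* conjM Q ∧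
    v 1 = mapV D.der (h 1) + a • u 1 - iV (u 1) ᵥ* conjM P + iV (u 0) ᵥ* Q

/-! ## The group `Sp(1) × Sp(n-1)` -/

section Group

variable {m : ℕ}

/-- `(c, d, X, Y)` stands for the matrix of `Sp(1) × Sp(n-1) ⊂ Sp(n)` with these blocks. -/
def IsSpPair (c d : ℂ) (X Y : Matrix (Fin m) (Fin m) ℂ) : Prop :=
  hPar c d X Y ∈ Matrix.unitaryGroup (Idx m ⊕ Idx m) ℂ

/-- The adjoint action of `Sp(1) × Sp(n-1)` on `𝔥_⊥ ≃ ℂ^{n-1} ⊕ ℂ^{n-1}`: first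
`(v₁, v₂) ↦ (v₁ X̄ᵗ + v₂ Ȳᵗ, -v₁ Yᵗ + v₂ Xᵗ)`, then `(v₁, v₂) ↦ (c v₁ - d v̄₂, c v₂ + d v̄₁)`. -/
def spAct {A : Type} [CommRing A] [StarRing A] [Algebra ℂ A]
    (c d : ℂ) (X Y : Matrix (Fin m) (Fin m) ℂ) (v : Vec m A) : Vec m A :=
  let X' : Matrix (Fin m) (Fin m) A := X.map (cst A)
  let Y' : Matrix (Fin m) (Fin m) A := Y.map (cst A)
  let r₁ : Fin m → A := v 0 ᵥ* X'ᴴ + v 1 ᵥ* Y'ᴴ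
  let r₂ : Fin m → A := - (v 0 ᵥ* Y'ᵀ) + v 1 ᵥ* X'ᵀ
  ![cst A c • r₁ - cst A d • star r₂, cst A c • r₂ + cst A d • star r₁]

/-- The operator `K` is invariant under `Sp(1) × Sp(n-1)`. -/
def IsSpInvariant (K : NonlocalOp m) : Prop :=
  ∀ (c d : ℂ) (X Y : Matrix (Fin m) (Fin m) ℂ), IsSpPair c d X Y →
  ∀ (A : Type) [CommRing A] [StarRing A] [Algebra ℂ A] [StarModule ℂ A] (D : RealDer A)
    (u w v : Vec m A), K A D u w v →
    K A D (spAct c d X Y u) (spAct c d X Y w) (spAct c d X Y v)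

end Group

/-! ## Smooth functions of `(t, x)` and the structure equations -/

section Smooth

variable (U : TopologicalSpace.Opens (ℝ × ℝ))

/-- Extension by zero to the whole plane. -/
def ext0 (f : U → ℂ) : ℝ × ℝ → ℂ := Function.extend Subtype.val f 0

theorem ext0_coe (f : U → ℂ) (p : U) : ext0 U f p = f p :=
  Subtype.val_injective.extend_apply f 0 p

/-- The algebra of smooth complex-valued functions of `(t, x)` on an open set `U`. -/
def smoothFn : StarSubalgebra ℂ (U → ℂ) where
  carrier := {f | ContDiffOn ℝ ∞ (ext0 U f) U}
  mul_mem' {f g} hf hg := (ContDiffOn.mul hf hg).congr fun p hp => by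
    simp only [ext0_coe U _ ⟨p, hp⟩, Pi.mul_apply]
  add_mem' {f g} hf hg := (ContDiffOn.add hf hg).congr fun p hp => by
    simp only [ext0_coe U _ ⟨p, hp⟩, Pi.add_apply]
  algebraMap_mem' z := (contDiffOn_const (c := z)).congr fun p hp => by
    simp only [ext0_coe U _ ⟨p, hp⟩]; rfl
  star_mem' {f} hf := ((starL' ℝ : ℂ ≃L[ℝ] ℂ).contDiff.comp_contDiffOn hf).congr fun p hp => by
    simp only [ext0_coe U _ ⟨p, hp⟩, Function.comp]; rfl

variable {U}

theorem smoothFn_differentiableAt (f : smoothFn U) (p : U) :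
    DifferentiableAt ℝ (ext0 U f.1) p :=
  (f.2.contDiffAt (U.isOpen.mem_nhds p.2)).differentiableAt (by simp)

/-- Differentiation of smooth functions on `U` in a fixed direction `e` of the `(t, x)`-plane. -/
def dirD (e : ℝ × ℝ) : RealDer (smoothFn U) where
  der := Derivation.mk'
    { toFun := fun f => ⟨fun p => fderiv ℝ (ext0 U f.1) p e, by
        have h : ContDiffOn ℝ ∞ (fun q => fderiv ℝ (ext0 U f.1) q e) U :=
          (f.2.fderiv_of_isOpen U.isOpen (m := ∞) (by simp)).clm_apply contDiffOn_const
        exact h.congr fun p hp => by simp only [ext0_coe U _ ⟨p, hp⟩]⟩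
      map_add' := fun f g => Subtype.ext <| funext fun p => by
        have h : ext0 U (f + g).1 =ᶠ[nhds (p : ℝ × ℝ)] ext0 U f.1 + ext0 U g.1 := by
          filter_upwards [U.isOpen.mem_nhds p.2] with q hq
          simp only [Pi.add_apply, ext0_coe U _ ⟨q, hq⟩]; rfl
        change fderiv ℝ (ext0 U (f + g).1) p e = _
        rw [h.fderiv_eq, fderiv_add (smoothFn_differentiableAt f p) (smoothFn_differentiableAt g p)]
        rfl
      map_smul' := fun z f => Subtype.ext <| funext fun p => by
        have h : ext0 U (z • f).1 =ᶠ[nhds (p : ℝ × ℝ)] z • ext0 U f.1 := by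
          filter_upwards [U.isOpen.mem_nhds p.2] with q hq
          simp only [Pi.smul_apply, ext0_coe U _ ⟨q, hq⟩]; rfl
        change fderiv ℝ (ext0 U (z • f).1) p e = _
        rw [h.fderiv_eq, fderiv_const_smul (smoothFn_differentiableAt f p)]
        rfl }
    (fun f g => Subtype.ext <| funext fun p => by
      have h : ext0 U (f * g).1 =ᶠ[nhds (p : ℝ × ℝ)] ext0 U f.1 * ext0 U g.1 := by
        filter_upwards [U.isOpen.mem_nhds p.2] with q hq
        simp only [Pi.mul_apply, ext0_coe U _ ⟨q, hq⟩]; rfl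
      change fderiv ℝ (ext0 U (f * g).1) p e = f.1 p * fderiv ℝ (ext0 U g.1) p e
        + g.1 p * fderiv ℝ (ext0 U f.1) p e
      rw [h.fderiv_eq, fderiv_mul (smoothFn_differentiableAt f p) (smoothFn_differentiableAt g p)]
      simp [ext0_coe])
  map_star f := Subtype.ext <| funext fun p => by
    have h : ext0 U (star f).1 =ᶠ[nhds (p : ℝ × ℝ)] fun q => star (ext0 U f.1 q) := by
      filter_upwards [U.isOpen.mem_nhds p.2] with q hq
      simp only [ext0_coe U _ ⟨q, hq⟩]; rfl
    change fderiv ℝ (ext0 U (star f).1) p e = star (fderiv ℝ (ext0 U f.1) p e)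
    rw [h.fderiv_eq]
    exact congrArg (fun L => L e) ((starL' ℝ : ℂ ≃L[ℝ] ℂ).comp_fderiv (f := ext0 U f.1) (x := (p : ℝ × ℝ)))

/-- `D_t`, for points written as `(t, x)`. -/
def Dt (U : TopologicalSpace.Opens (ℝ × ℝ)) : RealDer (smoothFn U) := dirD (1, 0)

/-- `D_x`, for points written as `(t, x)`. -/
def Dx (U : TopologicalSpace.Opens (ℝ × ℝ)) : RealDer (smoothFn U) := dirD (0, 1)

variable {m : ℕ}

/-- The components of the evolution in an `Sp(n)`-parallel frame, `n = m + 1`: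
`e_t = h_∥ + h_⊥` and `ω_t = ϖ^∥ + ϖ^⊥`, with `h_∥ = (H₁, H₂) ∈ u(n-1) ⊕ so(n-1, ℂ)` and
`ϖ^∥ = ((w₁, w₂), (W₁, W₂)) ∈ sp(1) ⊕ sp(n-1)`. -/
structure FrameData (m : ℕ) (U : TopologicalSpace.Opens (ℝ × ℝ)) where
  H₁ : Matrix (Fin m) (Fin m) (smoothFn U)
  H₂ : Matrix (Fin m) (Fin m) (smoothFn U)
  hPe : Vec m (smoothFn U)
  w₁ : smoothFn U
  w₂ : smoothFn U
  W₁ : Matrix (Fin m) (Fin m) (smoothFn U)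
  W₂ : Matrix (Fin m) (Fin m) (smoothFn U)
  wPe : Vec m (smoothFn U)
  H₁_skew : H₁ᴴ = -H₁
  H₂_skew : H₂ᵀ = -H₂
  w₁_imag : star w₁ = -w₁
  W₁_skew : W₁ᴴ = -W₁
  W₂_symm : W₂ᵀ = W₂

/-- `e_t`. -/
def FrameData.eT (F : FrameData m U) : BigMat m (smoothFn U) := mPar F.H₁ F.H₂ + mPerp F.hPe

/-- `ω_t`. -/
def FrameData.ωT (F : FrameData m U) : BigMat m (smoothFn U) :=
  hPar F.w₁ F.w₂ F.W₁ F.W₂ + hPerp F.wPe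

/-- The Cartan structure equations
`D_x e_t - D_t e_x + [ω_x, e_t] - [ω_t, e_x] = 0` and
`D_x ω_t - D_t ω_x + [ω_x, ω_t] = -[e_x, e_t]`, with `e_x` constant and `ω_x = u ∈ 𝔥_⊥`. -/
def CartanEquations (u : Vec m (smoothFn U)) (F : FrameData m U) : Prop :=
  F.eT.map (Dx U).der - (eX m (smoothFn U)).map (Dt U).der
      + ⁅hPerp u, F.eT⁆ - ⁅F.ωT, eX m (smoothFn U)⁆ = 0 ∧
  F.ωT.map (Dx U).der - (hPerp u).map (Dt U).der + ⁅hPerp u, F.ωT⁆ = -⁅eX m (smoothFn U), F.eT⁆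

/-- A curve flow `γ(t, x) = g(t, x) · Sp(n)` in `SU(2n)/Sp(n)`, framed by the lift `g` to `SU(2n)`:
the coframe and the connection along `γ` are the `𝔪`- and `𝔥`-parts of `g⁻¹ dg`. The frame is
`Sp(n)`-parallel (so that `γ` is non-stretching and `|γ_x| = 1`): the `x`-component of `g⁻¹ dg` is
`e_x + ω_x` with `e_x` constant and `ω_x = u ∈ 𝔥_⊥`. The `t`-component is `e_t + ω_t`. -/
def IsParallelFraming (g : BigMat m (smoothFn U)) (u : Vec m (smoothFn U)) (F : FrameData m U) :
    Prop :=
  gᴴ * g = 1 ∧ g.det = 1 ∧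
  gᴴ * g.map (Dx U).der = eX m (smoothFn U) + hPerp u ∧
  gᴴ * g.map (Dt U).der = F.eT + F.ωT

/-- `h^⊥ = ad(e_x) h_⊥ = (i/√ρ) h_⊥` with `ρ = 8 (n - 1)`, `n = m + 1`. -/
def hUp (v : Vec m (smoothFn U)) : Vec m (smoothFn U) :=
  (Complex.I / (Real.sqrt (8 * m) : ℂ)) • v

/-- The flow equations in operator form: `u_t = 𝓗 (ϖ^⊥) + h^⊥` and
`ϖ^⊥ = 8 (n - 1) 𝓙 (h^⊥)`, where `n = m + 1`. -/
def OperatorFlow (u w h : Vec m (smoothFn U)) : Prop :=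
  (∃ v, opH m _ (Dx U) u w v ∧ (fun l => mapV (Dt U).der (u l)) = v + h) ∧
  ∃ y, opJ m _ (Dx U) u h y ∧ w = (8 * (m : ℂ)) • y

end Smooth

end SymplecticFlow

end

/-! Everything rests on the flat-type derivative ∇ = D + ad(u) (`nabla`) on block matrices and on
the symmetric-space grading: ad(𝔥_⊥) interchanges the parallel and perpendicular parts, and ad(e)
for a constant e proportional to e_x kills the parallel parts and identifies 𝔥_⊥ with 𝔪_⊥ through
multiplication by a multiple of i.

The nonlocal operators then become local statements about lifts. By `opH_iff`, v = 𝓗w means that w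
extends by an 𝔥_∥-part to some W with ∇W = v in 𝔥_⊥; the antiderivatives in 𝓗 are exactly the
components of that part. By `opJ_iff`, v = 𝓙h means that some Y with 𝔪_⊥-part -ish satisfies ∇Y =
-isv in 𝔪_⊥, for any fixed real s ≠ 0. The Cartan equations are these two statements with the
normalisations of e_x inserted, which gives the operator form of the flow; they hold for framed
flows because g⁻¹dg is flat and its curvature splits into 𝔪- and 𝔥-parts. Invariance under Sp(1) ×
Sp(n-1) is invariance of ∇ under constant gauge transformations that commute with e.

For the Hamiltonian statements the trace form is used: D tr(XY) = tr(∇X Y) + tr(X ∇Y), and tr is -2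
times the pairing on 𝔥_⊥. Applied to two lifts this gives skew-symmetry. Applied to a lift and the
ε-part of a lift over the dual numbers it expresses a variation of an operator through the trilinear
form tr(X[Y,Z]) (`pair_variation_H`, `pair_variation_J`). Since second variations are symmetric
(`helmholtz`), the Jacobi identity reduces to the vanishing modulo D of a cyclic sum of such terms
(`jacobi_of_variation`). With W_k and Y_k the lifts, that sum is D tr(W₀[W₂,W₁]) for 𝓗
(`cyclic_sum_H`), is zero by the Jacobi identity of commutators for 𝓙 (`cyclic_sum_J`), and for the
cross terms of c₁𝓗 + c₂𝓙⁻¹ is the derivative of a sum of terms tr(Y[W,Y]), because there ∇Y = [W,e]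
(`cyclic_sum_mixed`). -/

set_option linter.unusedSectionVars false
set_option linter.unusedSimpArgs false

namespace SymplecticFlow

/-! ### Block matrices for 𝔥 and 𝔪 and their commutators. -/

section MatrixForm

variable {A : Type} [CommRing A] [StarRing A] [Algebra ℂ A] {m : ℕ}

section Conj

variable {k l r : Type}

@[simp] theorem conjM_apply (X : Matrix k l A) (i : k) (j : l) : conjM X i j = star (X i j) := rfl

@[simp] theorem conjM_conjM (X : Matrix k l A) : conjM (conjM X) = X := by
  ext; simp

theorem conjM_add (X Y : Matrix k l A) : conjM (X + Y) = conjM X + conjM Y := by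
  ext; simp

theorem conjM_sub (X Y : Matrix k l A) : conjM (X - Y) = conjM X - conjM Y := by
  ext; simp

theorem conjM_neg (X : Matrix k l A) : conjM (-X) = -conjM X := by
  ext; simp

@[simp] theorem conjM_zero : conjM (0 : Matrix k l A) = 0 := by
  ext; simp

theorem conjM_mul [Fintype l] (X : Matrix k l A) (Y : Matrix l r A) :
    conjM (X * Y) = conjM X * conjM Y := by
  ext; simp [Matrix.mul_apply]

theorem conjM_conjTranspose (X : Matrix k l A) : conjM Xᴴ = Xᵀ := by
  ext; simp

theorem conjM_transpose (X : Matrix k l A) : conjM Xᵀ = Xᴴ := by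
  ext; simp

theorem conjTranspose_conjM (X : Matrix k l A) : (conjM X)ᴴ = Xᵀ := by
  ext; simp

theorem transpose_conjM (X : Matrix k l A) : (conjM X)ᵀ = Xᴴ := by
  ext; simp

end Conj

theorem hMat_mul (X Y X' Y' : Matrix (Idx m) (Idx m) A) :
    hMat X Y * hMat X' Y' = hMat (X * X' - Y * conjM Y') (X * Y' + Y * conjM X') := by
  simp only [hMat, fromBlocks_multiply, conjM_add, conjM_sub, conjM_mul, conjM_conjM]
  congr 1 <;> noncomm_ring

theorem hMat_mul_mMat (X Y X' Y' : Matrix (Idx m) (Idx m) A) :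
    hMat X Y * mMat X' Y' = mMat (X * X' + Y * conjM Y') (X * Y' - Y * conjM X') := by
  simp only [hMat, mMat, fromBlocks_multiply, conjM_add, conjM_sub, conjM_mul, conjM_conjM]
  congr 1 <;> noncomm_ring

theorem mMat_mul_hMat (X Y X' Y' : Matrix (Idx m) (Idx m) A) :
    mMat X Y * hMat X' Y' = mMat (X * X' - Y * conjM Y') (X * Y' + Y * conjM X') := by
  simp only [hMat, mMat, fromBlocks_multiply, conjM_add, conjM_sub, conjM_mul, conjM_conjM]
  congr 1 <;> noncomm_ring

theorem mMat_mul (X Y X' Y' : Matrix (Idx m) (Idx m) A) :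
    mMat X Y * mMat X' Y' = hMat (X * X' + Y * conjM Y') (X * Y' - Y * conjM X') := by
  simp only [hMat, mMat, fromBlocks_multiply, conjM_add, conjM_sub, conjM_mul, conjM_conjM]
  congr 1 <;> noncomm_ring

theorem hMat_add (X Y X' Y' : Matrix (Idx m) (Idx m) A) :
    hMat X Y + hMat X' Y' = hMat (X + X') (Y + Y') := by
  simp only [hMat, fromBlocks_add, conjM_add]
  congr 1; abel

theorem hMat_sub (X Y X' Y' : Matrix (Idx m) (Idx m) A) :
    hMat X Y - hMat X' Y' = hMat (X - X') (Y - Y') := by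
  simp only [hMat, sub_eq_add_neg, fromBlocks_neg, fromBlocks_add, conjM_add, conjM_neg]
  congr 1; abel

theorem mMat_add (X Y X' Y' : Matrix (Idx m) (Idx m) A) :
    mMat X Y + mMat X' Y' = mMat (X + X') (Y + Y') := by
  simp only [mMat, fromBlocks_add, conjM_add]
  congr 1; abel

theorem mMat_sub (X Y X' Y' : Matrix (Idx m) (Idx m) A) :
    mMat X Y - mMat X' Y' = mMat (X - X') (Y - Y') := by
  simp only [mMat, sub_eq_add_neg, fromBlocks_neg, fromBlocks_add, conjM_add, conjM_neg, neg_add]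

theorem hMat_injective {X Y X' Y' : Matrix (Idx m) (Idx m) A} (h : hMat X Y = hMat X' Y') :
    X = X' ∧ Y = Y' := by
  rw [hMat, hMat, fromBlocks_inj] at h
  exact ⟨h.1, h.2.1⟩

theorem mMat_injective {X Y X' Y' : Matrix (Idx m) (Idx m) A} (h : mMat X Y = mMat X' Y') :
    X = X' ∧ Y = Y' := by
  rw [mMat, mMat, fromBlocks_inj] at h
  exact ⟨h.1, h.2.1⟩

/-- A matrix in blocks of sizes `1 + m`, given by a scalar, a row, a column and a matrix. -/
def blk (c : A) (v w : Fin m → A) (X : Matrix (Fin m) (Fin m) A) : Matrix (Idx m) (Idx m) A :=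
  fromBlocks (Matrix.of fun _ _ => c) (replicateRow Unit v) (replicateCol Unit w) X

theorem blk_inj {c c' : A} {v v' w w' : Fin m → A} {X X' : Matrix (Fin m) (Fin m) A} :
    blk c v w X = blk c' v' w' X' ↔ c = c' ∧ v = v' ∧ w = w' ∧ X = X' := by
  constructor
  · intro h
    rw [blk, blk, fromBlocks_inj] at h
    exact ⟨congrFun (congrFun h.1 ()) (), funext fun j => congrFun (congrFun h.2.1 ()) j,
      funext fun j => congrFun (congrFun h.2.2.1 j) (), h.2.2.2⟩
  · rintro ⟨rfl, rfl, rfl, rfl⟩; rfl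

theorem blk_mul (c c' : A) (v v' w w' : Fin m → A) (X X' : Matrix (Fin m) (Fin m) A) :
    blk c v w X * blk c' v' w' X' = blk (c * c' + v ⬝ᵥ w') (c • v' + v ᵥ* X') (c' • w + X *ᵥ w')
      (vecMulVec w v' + X * X') := by
  rw [blk, blk, fromBlocks_multiply, blk, fromBlocks_inj]
  refine ⟨?_, ?_, ?_, ?_⟩ <;> ext i j <;>
    simp [Matrix.mul_apply, dotProduct, vecMul, mulVec, vecMulVec, mul_comm]

theorem blk_add (c c' : A) (v v' w w' : Fin m → A) (X X' : Matrix (Fin m) (Fin m) A) :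
    blk c v w X + blk c' v' w' X' = blk (c + c') (v + v') (w + w') (X + X') := by
  rw [blk, blk, fromBlocks_add]; rfl

theorem blk_sub (c c' : A) (v v' w w' : Fin m → A) (X X' : Matrix (Fin m) (Fin m) A) :
    blk c v w X - blk c' v' w' X' = blk (c - c') (v - v') (w - w') (X - X') := by
  ext (i | i) (j | j) <;> rfl

theorem conjM_blk (c : A) (v w : Fin m → A) (X : Matrix (Fin m) (Fin m) A) :
    conjM (blk c v w X) = blk (star c) (star v) (star w) (conjM X) := by
  ext (i | i) (j | j) <;> rfl

theorem hPar_eq (c d : A) (X Y : Matrix (Fin m) (Fin m) A) :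
    hPar c d X Y = hMat (blk c 0 0 X) (blk d 0 0 Y) := by
  rfl

theorem hPerp_eq (v : Vec m A) :
    hPerp v = hMat (blk 0 (v 0) (-star (v 0)) 0) (blk 0 (v 1) (v 1) 0) := by
  rfl

theorem mPar_eq (X Y : Matrix (Fin m) (Fin m) A) :
    mPar X Y = mMat (blk (-X.trace) 0 0 X) (blk 0 0 0 Y) := by
  rfl

theorem mPerp_eq (v : Vec m A) :
    mPerp v = mMat (blk 0 (v 0) (-star (v 0)) 0) (blk 0 (v 1) (-v 1) 0) := by
  rfl

theorem hPar_add_hPerp (c d : A) (X Y : Matrix (Fin m) (Fin m) A) (v : Vec m A) :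
    hPar c d X Y + hPerp v = hMat (blk c (v 0) (-star (v 0)) X) (blk d (v 1) (v 1) Y) := by
  simp [hPar_eq, hPerp_eq, hMat_add, blk_add]

theorem mPar_add_mPerp (X Y : Matrix (Fin m) (Fin m) A) (v : Vec m A) :
    mPar X Y + mPerp v
      = mMat (blk (-X.trace) (v 0) (-star (v 0)) X) (blk 0 (v 1) (-v 1) Y) := by
  simp [mPar_eq, mPerp_eq, mMat_add, blk_add]

theorem hPar_add_hPerp_inj {c d c' d' : A} {X Y X' Y' : Matrix (Fin m) (Fin m) A} {v v' : Vec m A} :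
    hPar c d X Y + hPerp v = hPar c' d' X' Y' + hPerp v' ↔
      c = c' ∧ d = d' ∧ X = X' ∧ Y = Y' ∧ v = v' := by
  constructor
  · intro h
    rw [hPar_add_hPerp, hPar_add_hPerp] at h
    obtain ⟨h1, h2⟩ := hMat_injective h
    rw [blk_inj] at h1 h2
    exact ⟨h1.1, h2.1, h1.2.2.2, h2.2.2.2, funext (Fin.forall_fin_two.2 ⟨h1.2.1, h2.2.1⟩)⟩
  · rintro ⟨rfl, rfl, rfl, rfl, rfl⟩; rfl

theorem mPar_add_mPerp_inj {X Y X' Y' : Matrix (Fin m) (Fin m) A} {v v' : Vec m A} :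
    mPar X Y + mPerp v = mPar X' Y' + mPerp v' ↔ X = X' ∧ Y = Y' ∧ v = v' := by
  constructor
  · intro h
    rw [mPar_add_mPerp, mPar_add_mPerp] at h
    obtain ⟨h1, h2⟩ := mMat_injective h
    rw [blk_inj] at h1 h2
    exact ⟨h1.2.2.2, h2.2.2.2, funext (Fin.forall_fin_two.2 ⟨h1.2.1, h2.2.1⟩)⟩
  · rintro ⟨rfl, rfl, rfl⟩; rfl

theorem hPar_zero : hPar (0 : A) 0 (0 : Matrix (Fin m) (Fin m) A) 0 = 0 := by
  ext (_ | _) (_ | _) <;> simp [hPar, hMat] <;> rename_i a b <;> cases a <;> cases b <;> simp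

theorem mPar_zero : mPar (0 : Matrix (Fin m) (Fin m) A) 0 = 0 := by
  ext (_ | _) (_ | _) <;> simp [mPar, mMat] <;> rename_i a b <;> cases a <;> cases b <;> simp

theorem star_skew_apply {X : Matrix (Fin m) (Fin m) A} (h : Xᴴ = -X) (i j : Fin m) :
    star (X i j) = -X j i := congrFun (congrFun h j) i

theorem star_vecMul' {k : Type} [Fintype k] (v : k → A) (X : Matrix k k A) :
    star (v ᵥ* X) = star v ᵥ* conjM X := by
  ext j
  simp [vecMul, dotProduct]

theorem mulVec_of_skewHerm {X : Matrix (Fin m) (Fin m) A} (h : Xᴴ = -X) (v : Fin m → A) :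
    X *ᵥ v = -(v ᵥ* conjM X) := by
  rw [← vecMul_transpose, ← conjM_conjTranspose, h, conjM_neg, vecMul_neg]

theorem mulVec_of_symm {X : Matrix (Fin m) (Fin m) A} (h : Xᵀ = X) (v : Fin m → A) :
    X *ᵥ v = v ᵥ* X := by
  rw [← vecMul_transpose, h]

theorem mulVec_of_skewSymm {X : Matrix (Fin m) (Fin m) A} (h : Xᵀ = -X) (v : Fin m → A) :
    X *ᵥ v = -(v ᵥ* X) := by
  rw [← vecMul_transpose, h, vecMul_neg]

theorem star_smul_vec (a : A) (v : Fin m → A) : star (a • v) = star a • star v := by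
  ext j; simp

/-- The commutator of `𝔥_⊥` with `𝔥_∥` is in `𝔥_⊥`. -/
theorem lie_hPerp_hPar (u : Vec m A) {p q : A} {P Q : Matrix (Fin m) (Fin m) A}
    (hp : star p = -p) (hP : Pᴴ = -P) (hQ : Qᵀ = Q) :
    ⁅hPerp u, hPar p q P Q⁆ = hPerp
      ![-(p • u 0) + q • star (u 1) + u 0 ᵥ* P - u 1 ᵥ* conjM Q,
        -(p • u 1) - q • star (u 0) + u 1 ᵥ* conjM P + u 0 ᵥ* Q] := by
  rw [Ring.lie_def, hPerp_eq, hPar_eq, hMat_mul, hMat_mul, hMat_sub, hPerp_eq]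
  simp only [conjM_blk, blk_mul, blk_sub, blk_add]
  congr 1 <;> rw [blk_inj] <;> refine ⟨by simp, ?_, ?_, by simp⟩ <;>
    simp [mulVec_of_skewHerm hP, mulVec_of_symm hQ, star_vecMul', hp, neg_vecMul] <;> abel

theorem star_dotProduct_star' (v w : Fin m → A) : star (v ⬝ᵥ w) = star v ⬝ᵥ star w := by
  simp [dotProduct]

theorem innerC_eq (x y : Fin m → A) : innerC x y = x ⬝ᵥ star y - y ⬝ᵥ star x := by
  simp [innerC, dotProduct]

theorem innerA_eq (x y : Fin m → A) : innerA x y = x ⬝ᵥ star y + y ⬝ᵥ star x := by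
  simp [innerA, dotProduct, Finset.sum_add_distrib]

theorem innerS_eq (x y : Fin m → A) : innerS x y = x ⬝ᵥ y + y ⬝ᵥ x := by
  simp [innerS, dotProduct, Finset.sum_add_distrib]

theorem outerC_eq (x y : Fin m → A) :
    outerC x y = vecMulVec (star x) y - vecMulVec (star y) x := rfl

theorem outerS_eq (x y : Fin m → A) :
    outerS x y = vecMulVec x (star y) + vecMulVec (star y) x := rfl

theorem conjM_vecMulVec (x y : Fin m → A) :
    conjM (vecMulVec x y) = vecMulVec (star x) (star y) := by
  ext; simp [vecMulVec]

/-- The commutator of two elements of `𝔥_⊥` is in `𝔥_∥`. -/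
theorem lie_hPerp_hPerp (u w : Vec m A) :
    ⁅hPerp u, hPerp w⁆ = hPar (-(innerC (u 0) (w 0) + innerC (u 1) (w 1)))
      (-(innerS (u 1) (w 0) - innerS (u 0) (w 1)))
      (-(outerC (u 0) (w 0) + conjM (outerC (u 1) (w 1))))
      (-(conjM (outerS (u 0) (w 1)) - outerS (u 1) (w 0))) := by
  rw [Ring.lie_def, hPerp_eq, hPerp_eq, hMat_mul, hMat_mul, hMat_sub, hPar_eq]
  simp only [conjM_blk, blk_mul, blk_sub, blk_add]
  congr 1 <;> rw [blk_inj] <;> refine ⟨?_, by simp, by simp, ?_⟩ <;>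
    simp [innerC_eq, innerS_eq, outerC_eq, outerS_eq, conjM_vecMulVec, conjM_add, conjM_sub,
      dotProduct_comm, neg_vecMulVec] <;> abel

/-- The commutator of `𝔥_⊥` with `𝔪_∥` is in `𝔪_⊥`. -/
theorem lie_hPerp_mPar (u : Vec m A) {X Y : Matrix (Fin m) (Fin m) A}
    (hX : Xᴴ = -X) (hY : Yᵀ = -Y) :
    ⁅hPerp u, mPar X Y⁆ = mPerp
      ![u 0 ᵥ* X + X.trace • u 0 + u 1 ᵥ* conjM Y,
        -(u 1 ᵥ* conjM X) + X.trace • u 1 + u 0 ᵥ* Y] := by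
  have ht : star X.trace = -X.trace := by
    rw [← trace_conjTranspose, hX, trace_neg]
  rw [Ring.lie_def, hPerp_eq, mPar_eq, hMat_mul_mMat, mMat_mul_hMat, mMat_sub, mPerp_eq]
  simp only [conjM_blk, blk_mul, blk_sub, blk_add]
  congr 1 <;> rw [blk_inj] <;> refine ⟨by simp, ?_, ?_, by simp⟩ <;>
    simp [mulVec_of_skewHerm hX, mulVec_of_skewSymm hY, star_vecMul', ht, neg_vecMul] <;> abel

/-- The commutator of `𝔥_⊥` with `𝔪_⊥` is in `𝔪_∥`. -/
theorem lie_hPerp_mPerp (u h : Vec m A) :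
    ⁅hPerp u, mPerp h⁆ = mPar
      (-(outerC (u 0) (h 0) - conjM (outerC (u 1) (h 1))))
      (-(vecMulVec (star (u 0)) (h 1) - vecMulVec (h 1) (star (u 0))
        + vecMulVec (u 1) (star (h 0)) - vecMulVec (star (h 0)) (u 1))) := by
  rw [Ring.lie_def, hPerp_eq, mPerp_eq, hMat_mul_mMat, mMat_mul_hMat, mMat_sub, mPar_eq]
  simp only [conjM_blk, blk_mul, blk_sub, blk_add]
  congr 1 <;> rw [blk_inj] <;> refine ⟨?_, by simp, by simp, ?_⟩ <;>
    simp [outerC_eq, conjM_vecMulVec, conjM_sub, trace_vecMulVec,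
      dotProduct_comm, neg_vecMulVec] <;> abel

/-! ### The covariant derivative and the operator 𝓗. -/

theorem lie_add_mat (M N K : BigMat m A) : ⁅M, N + K⁆ = ⁅M, N⁆ + ⁅M, K⁆ := by
  simp only [Ring.lie_def]
  noncomm_ring

/-- The covariant derivative `D + ad u` on matrices. -/
def nabla (D : RealDer A) (u : Vec m A) (M : BigMat m A) : BigMat m A :=
  M.map D.der + ⁅hPerp u, M⁆

section Map

variable (D : RealDer A)

theorem conjM_map {k l : Type} (X : Matrix k l A) : conjM (X.map D.der) = (conjM X).map D.der := by
  ext; simp [D.map_star]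

theorem neg_map {k l : Type} (X : Matrix k l A) : (-X).map D.der = -X.map D.der := by
  ext; simp

theorem hMat_map (X Y : Matrix (Idx m) (Idx m) A) :
    (hMat X Y).map D.der = hMat (X.map D.der) (Y.map D.der) := by
  simp [hMat, fromBlocks_map, conjM_map, neg_map]

theorem mMat_map (X Y : Matrix (Idx m) (Idx m) A) :
    (mMat X Y).map D.der = mMat (X.map D.der) (Y.map D.der) := by
  simp [mMat, fromBlocks_map, conjM_map, neg_map]

theorem blk_map (c : A) (v w : Fin m → A) (X : Matrix (Fin m) (Fin m) A) :
    (blk c v w X).map D.der = blk (D.der c) (mapV D.der v) (mapV D.der w) (X.map D.der) := by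
  ext (i | i) (j | j) <;> rfl

theorem trace_map_der (X : Matrix (Fin m) (Fin m) A) :
    (X.map D.der).trace = D.der X.trace := by
  simp [Matrix.trace]

theorem hPar_add_hPerp_map (c d : A) (X Y : Matrix (Fin m) (Fin m) A) (v : Vec m A) :
    (hPar c d X Y + hPerp v).map D.der
      = hPar (D.der c) (D.der d) (X.map D.der) (Y.map D.der)
        + hPerp (fun l => mapV D.der (v l)) := by
  rw [hPar_add_hPerp, hPar_add_hPerp, hMat_map, blk_map, blk_map]
  congr 2
  ext; simp [mapV, D.map_star]

theorem mPar_add_mPerp_map (X Y : Matrix (Fin m) (Fin m) A) (v : Vec m A) :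
    (mPar X Y + mPerp v).map D.der
      = mPar (X.map D.der) (Y.map D.der) + mPerp (fun l => mapV D.der (v l)) := by
  rw [mPar_add_mPerp, mPar_add_mPerp, mMat_map, blk_map, blk_map, trace_map_der]
  congr 2
  · simp
  · ext; simp [mapV, D.map_star]
  · simp
  · ext; simp [mapV]

end Map

theorem hPar_add (c d c' d' : A) (X Y X' Y' : Matrix (Fin m) (Fin m) A) :
    hPar c d X Y + hPar c' d' X' Y' = hPar (c + c') (d + d') (X + X') (Y + Y') := by
  simp [hPar_eq, hMat_add, blk_add]

theorem hPerp_add (v w : Vec m A) : hPerp v + hPerp w = hPerp (v + w) := by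
  simp [hPerp_eq, hMat_add, blk_add, add_comm]

theorem mPar_add (X Y X' Y' : Matrix (Fin m) (Fin m) A) :
    mPar X Y + mPar X' Y' = mPar (X + X') (Y + Y') := by
  simp [mPar_eq, mMat_add, blk_add, add_comm]

theorem mPerp_add (v w : Vec m A) : mPerp v + mPerp w = mPerp (v + w) := by
  simp [mPerp_eq, mMat_add, blk_add, add_comm]

/-- The two kinds of components have different roles: vanishing of the 𝔥_∥-part says that p, q, P, Q
are the antiderivatives in 𝓗, and the 𝔥_⊥-part is then the value of 𝓗. -/
theorem nabla_h (D : RealDer A) (u w : Vec m A) {p q : A} {P Q : Matrix (Fin m) (Fin m) A}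
    (hp : star p = -p) (hP : Pᴴ = -P) (hQ : Qᵀ = Q) :
    nabla D u (hPar p q P Q + hPerp w) =
      hPar (D.der p - (innerC (u 0) (w 0) + innerC (u 1) (w 1)))
        (D.der q - (innerS (u 1) (w 0) - innerS (u 0) (w 1)))
        (P.map D.der - (outerC (u 0) (w 0) + conjM (outerC (u 1) (w 1))))
        (Q.map D.der - (conjM (outerS (u 0) (w 1)) - outerS (u 1) (w 0)))
      + hPerp ![mapV D.der (w 0) - p • u 0 + q • star (u 1) + u 0 ᵥ* P - u 1 ᵥ* conjM Q,
        mapV D.der (w 1) - p • u 1 - q • star (u 0) + u 1 ᵥ* conjM P + u 0 ᵥ* Q] := by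
  rw [nabla, hPar_add_hPerp_map, lie_add_mat, lie_hPerp_hPar u hp hP hQ, lie_hPerp_hPerp,
    add_comm (hPerp _) (hPar _ _ _ _), add_add_add_comm, hPar_add, hPerp_add]
  simp only [sub_eq_add_neg]
  congr 2
  funext l; fin_cases l <;> simp <;> abel

/-- The counterpart of `nabla_h` on 𝔪: the 𝔪_∥-part yields the antiderivatives in 𝓙. The trace terms
come from the upper left entry, which trace-freeness fixes. -/
theorem nabla_m (D : RealDer A) (u h : Vec m A) {X Y : Matrix (Fin m) (Fin m) A}
    (hX : Xᴴ = -X) (hY : Yᵀ = -Y) :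
    nabla D u (mPar X Y + mPerp h) =
      mPar (X.map D.der - (outerC (u 0) (h 0) - conjM (outerC (u 1) (h 1))))
        (Y.map D.der - (vecMulVec (star (u 0)) (h 1) - vecMulVec (h 1) (star (u 0))
        + vecMulVec (u 1) (star (h 0)) - vecMulVec (star (h 0)) (u 1)))
      + mPerp ![mapV D.der (h 0) + (u 0 ᵥ* X + X.trace • u 0 + u 1 ᵥ* conjM Y),
        mapV D.der (h 1) + (-(u 1 ᵥ* conjM X) + X.trace • u 1 + u 0 ᵥ* Y)] := by
  rw [nabla, mPar_add_mPerp_map, lie_add_mat, lie_hPerp_mPar u hX hY, lie_hPerp_mPerp,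
    add_comm (mPerp _) (mPar _ _), add_add_add_comm, mPar_add, mPerp_add]
  simp only [sub_eq_add_neg]
  congr 2
  funext l; fin_cases l <;> simp

/-- The nonlocal operator becomes a local equation for a lift of w, so that matrix identities
replace manipulations of antiderivatives. -/
theorem opH_iff [StarModule ℂ A] (D : RealDer A) (u w v : Vec m A) :
    opH m A D u w v ↔ ∃ (p q : A) (P Q : Matrix (Fin m) (Fin m) A),
      (star p = -p ∧ Pᴴ = -P ∧ Qᵀ = Q) ∧ nabla D u (hPar p q P Q + hPerp w) = hPerp v := by
  refine exists_congr fun p => exists_congr fun q => exists_congr fun P => exists_congr fun Q =>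
    and_congr_right ?_
  rintro ⟨hp, hP, hQ⟩
  rw [nabla_h D u w hp hP hQ, ← zero_add (hPerp v), ← hPar_zero, hPar_add_hPerp_inj,
    sub_eq_zero, sub_eq_zero, sub_eq_zero, sub_eq_zero, funext_iff (g := v), Fin.forall_fin_two]
  simp [eq_comm]

end MatrixForm

/-! ### The operator 𝓙 as a covariant derivative on 𝔪. -/

section MatrixForm

variable {A : Type} [CommRing A] [StarRing A] [Algebra ℂ A] {m : ℕ}

theorem iV_eq (x : Fin m → A) : iV x = Complex.I • x := by
  ext j
  simp [iV, cst, Algebra.smul_def]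

section OpJ

variable [StarModule ℂ A]

theorem conjM_smul {k l : Type} (z : ℂ) (X : Matrix k l A) : conjM (z • X) = star z • conjM X := by
  ext; simp

theorem star_algebraMap (z : ℂ) : star (algebraMap ℂ A z) = algebraMap ℂ A (star z) :=
  (algebraMap_star_comm z).symm

theorem conjM_smul_one (a : A) :
    conjM (a • (1 : Matrix (Fin m) (Fin m) A)) = star a • 1 := by
  ext i j
  rcases eq_or_ne i j with rfl | h
  · simp
  · simp [Matrix.one_apply_ne h]

theorem outerC_smul_sub (s : ℝ) (u h : Vec m A) :
    outerC (u 0) ((-(s * Complex.I)) • h 0) - conjM (outerC (u 1) ((-(s * Complex.I)) • h 1))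
      = (s : ℂ) • (outerC (iV (u 0)) (h 0) - conjM (outerC (iV (u 1)) (h 1))) := by
  ext i j
  simp [outerC, iV_eq, Algebra.smul_def, star_algebraMap]
  ring

theorem outerA_smul_add (s : ℝ) (u h : Vec m A) :
    vecMulVec (star (u 0)) ((-(s * Complex.I)) • h 1) - vecMulVec ((-(s * Complex.I)) • h 1) (star (u 0))
        + vecMulVec (u 1) (star ((-(s * Complex.I)) • h 0))
        - vecMulVec (star ((-(s * Complex.I)) • h 0)) (u 1)
      = (s : ℂ) • (outerA (iV (u 1)) (h 0) + conjM (outerA (iV (u 0)) (h 1))) := by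
  ext i j
  simp [outerA, vecMulVec, iV_eq, Algebra.smul_def, star_algebraMap]
  ring

/-- The equation for a in 𝓙 is thus a consequence of the equation for P up to a constant; this is
why one matrix X can encode both a and P. -/
theorem trace_outerC_sub (u h : Vec m A) :
    (outerC (iV (u 0)) (h 0) - conjM (outerC (iV (u 1)) (h 1))).trace
      = -(Complex.I • (innerA (u 0) (h 0) + innerA (u 1) (h 1))) := by
  simp only [Matrix.trace, outerC, innerA, iV_eq, conjM, ← Finset.sum_add_distrib, Finset.smul_sum,
    ← Finset.sum_neg_distrib]
  refine Finset.sum_congr rfl fun i _ => ?_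
  simp [Algebra.smul_def, star_algebraMap]
  ring

/-- The matrix X enters the 𝔪_⊥-part only through X + (tr X)·1, which the hypothesis `hX` matches
with the combination of P and a that occurs in 𝓙. -/
theorem mPerp_vec_eq (D : RealDer A) (s : ℝ) (u h : Vec m A) {a : A}
    {X Y P Q : Matrix (Fin m) (Fin m) A} (ha : star a = a)
    (hX : X + X.trace • 1 = (s : ℂ) • P - (s * Complex.I) • (a • 1)) (hXs : Xᴴ = -X)
    (hY : Y = (s : ℂ) • Q) :
    mapV D.der ((-(s * Complex.I)) • h 0) + (u 0 ᵥ* X + X.trace • u 0 + u 1 ᵥ* conjM Y)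
      = (-(s * Complex.I)) • (mapV D.der (h 0) + a • u 0 + iV (u 0) ᵥ* P + iV (u 1) ᵥ* conjM Q) ∧
    mapV D.der ((-(s * Complex.I)) • h 1) + (-(u 1 ᵥ* conjM X) + X.trace • u 1 + u 0 ᵥ* Y)
      = (-(s * Complex.I)) • (mapV D.der (h 1) + a • u 1 - iV (u 1) ᵥ* conjM P + iV (u 0) ᵥ* Q) := by
  have ht : star X.trace = -X.trace := by
    rw [← trace_conjTranspose, hXs, trace_neg]
  have h1 : u 0 ᵥ* X + X.trace • u 0 = u 0 ᵥ* (X + X.trace • 1) := by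
    simp [vecMul_add, vecMul_smul]
  have h2 : -(u 1 ᵥ* conjM X) + X.trace • u 1 = - (u 1 ᵥ* conjM (X + X.trace • 1)) := by
    rw [conjM_add, conjM_smul_one, ht]
    simp [vecMul_add, vecMul_smul, vecMul_neg, add_comm]
  have h3 : conjM (a • (1 : Matrix (Fin m) (Fin m) A)) = a • 1 := by rw [conjM_smul_one, ha]
  have h4 : ∀ (z : ℂ) (v : Fin m → A), mapV D.der (z • v) = z • mapV D.der v := fun z v => by
    ext j
    simp [mapV]
  rw [h1, h2, hX, hY]
  simp only [conjM_sub, conjM_smul, h3, h4, vecMul_sub, vecMul_smul, vecMul_one, iV_eq, smul_vecMul,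
    smul_add, smul_sub, smul_smul]
  constructor <;> simp [mul_assoc] <;> abel

theorem nabla_m_iff (D : RealDer A) (s : ℝ) (u h v : Vec m A) {X Y : Matrix (Fin m) (Fin m) A}
    (hX : Xᴴ = -X) (hY : Yᵀ = -Y) :
    nabla D u (mPar X Y + mPerp ((-(s * Complex.I)) • h)) = mPerp ((-(s * Complex.I)) • v) ↔
      X.map D.der = (s : ℂ) • (outerC (iV (u 0)) (h 0) - conjM (outerC (iV (u 1)) (h 1))) ∧
      Y.map D.der = (s : ℂ) • (outerA (iV (u 1)) (h 0) + conjM (outerA (iV (u 0)) (h 1))) ∧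
      mapV D.der ((-(s * Complex.I)) • h 0) + (u 0 ᵥ* X + X.trace • u 0 + u 1 ᵥ* conjM Y)
        = (-(s * Complex.I)) • v 0 ∧
      mapV D.der ((-(s * Complex.I)) • h 1) + (-(u 1 ᵥ* conjM X) + X.trace • u 1 + u 0 ᵥ* Y)
        = (-(s * Complex.I)) • v 1 := by
  rw [nabla_m D u _ hX hY]
  nth_rw 2 [← zero_add (mPerp _)]
  rw [← mPar_zero, mPar_add_mPerp_inj, sub_eq_zero, sub_eq_zero, funext_iff, Fin.forall_fin_two]
  simp only [Pi.smul_apply]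
  rw [outerC_smul_sub, outerA_smul_add]
  simp

/-- Multiplication by i is the action of e, so 𝓙 on 𝔥_⊥ is ∇ on 𝔪 transported by that action. The
free scale s lets the same lemma serve the geometric normalisation and the choice s = 1. -/
theorem opJ_iff (D : RealDer A) {s : ℝ} (hs : s ≠ 0) (u h v : Vec m A) :
    opJ m A D u h v ↔ ∃ (X Y : Matrix (Fin m) (Fin m) A), (Xᴴ = -X ∧ Yᵀ = -Y) ∧
      nabla D u (mPar X Y + mPerp ((-(s * Complex.I)) • h)) = mPerp ((-(s * Complex.I)) • v) := by
  have hm : ((m : ℂ) + 1) ≠ 0 := by exact_mod_cast m.succ_ne_zero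
  have hsC : (s : ℂ) ≠ 0 := by exact_mod_cast hs
  have hz : (-(s * Complex.I)) ≠ 0 := by simpa using hs
  have map_smul' : ∀ (z : ℂ) (X : Matrix (Fin m) (Fin m) A),
      (z • X).map D.der = z • X.map D.der := fun z X => by ext; simp
  constructor
  · rintro ⟨a, P, Q, ⟨ha, hP, hQ⟩, Da, DP, DQ, h0, h1⟩
    -- R is the required value of X + (tr X)·1. Taking traces gives (m + 1) tr X = tr R, hence t =
    -- tr X and X = R - t·1. The constants of integration in tr P and in a need not match, so X is
    -- not simply sP.
    set R : Matrix (Fin m) (Fin m) A := (s : ℂ) • P - (s * Complex.I) • (a • 1) with hR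
    set t : A := ((m : ℂ) + 1)⁻¹ • R.trace with ht
    have hRs : Rᴴ = -R := by
      rw [hR, conjTranspose_sub, conjTranspose_smul, conjTranspose_smul, conjTranspose_smul, ha, hP]
      simp
      abel
    have hts : star t = -t := by
      rw [ht, star_smul, ← trace_conjTranspose, hRs, trace_neg, smul_neg]
      simp
    have htr : R.trace = ((m : ℂ) + 1) • t := by rw [ht, smul_smul, mul_inv_cancel₀ hm, one_smul]
    have hXt : (R - t • (1 : Matrix (Fin m) (Fin m) A)).trace = t := by
      rw [trace_sub, htr, trace_smul, trace_one, Fintype.card_fin, add_smul, one_smul]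
      simp [Algebra.smul_def, mul_comm]
    have hXs : (R - t • (1 : Matrix (Fin m) (Fin m) A))ᴴ = -(R - t • 1) := by
      rw [conjTranspose_sub, hRs, conjTranspose_smul, hts]
      simp
      abel
    have hQs : ((s : ℂ) • Q)ᵀ = -((s : ℂ) • Q) := by rw [transpose_smul, hQ, smul_neg]
    refine ⟨R - t • 1, (s : ℂ) • Q, ⟨hXs, hQs⟩, (nabla_m_iff D s u h v hXs hQs).2 ?_⟩
    obtain ⟨e0, e1⟩ := mPerp_vec_eq D s u h (P := P) (Q := Q) ha (by rw [hXt, ← hR]; abel) hXs rfl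
    refine ⟨?_, by rw [map_smul', DQ], by rw [e0, h0], by rw [e1, h1]⟩
    have hDR : R.map D.der = (s : ℂ) • P.map D.der - (s * Complex.I) • (D.der a • 1) := by
      ext i j
      rcases eq_or_ne i j with rfl | hij
      · simp [hR]
      · simp [hR, Matrix.one_apply_ne hij]
    -- One multiple of D a comes from tr P and m from the identity matrix, and the factor 1/(m + 1)
    -- in t cancels the sum. Therefore D X = s D P.
    have hDt : D.der t = -((s * Complex.I) • D.der a) := by
      rw [ht, D.der.map_smul, ← trace_map_der, hDR, DP, trace_sub, trace_smul, trace_outerC_sub,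
        ← Da, trace_smul, trace_smul, trace_one, inv_smul_eq_iff₀ hm]
      simp [Algebra.smul_def]
      ring
    have : (R - t • (1 : Matrix (Fin m) (Fin m) A)).map D.der = R.map D.der - D.der t • 1 := by
      ext i j
      rcases eq_or_ne i j with rfl | hij
      · simp
      · simp [Matrix.one_apply_ne hij]
    rw [this, hDR, hDt, DP]
    simp
  · rintro ⟨X, Y, ⟨hX, hY⟩, e⟩
    rw [nabla_m_iff D s u h v hX hY] at e
    obtain ⟨eX, eY, e0, e1⟩ := e
    have ht : star X.trace = -X.trace := by rw [← trace_conjTranspose, hX, trace_neg]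
    have ha : star ((Complex.I / s) • X.trace) = (Complex.I / s) • X.trace := by
      rw [star_smul, ht]
      simp [neg_div]
    -- Here a = (i/s) tr X is forced: then -is·a = tr X, so sP - is·a·1 is X + (tr X)·1 with P =
    -- X/s.
    obtain ⟨f0, f1⟩ := mPerp_vec_eq D s u h (P := (s : ℂ)⁻¹ • X) (Q := (s : ℂ)⁻¹ • Y) (X := X)
      (Y := Y) ha (by
        rw [smul_inv_smul₀ hsC, smul_assoc, smul_smul, show s * Complex.I * (Complex.I / s) = -1 by
          field_simp; simp]
        simp) hX (smul_inv_smul₀ hsC Y).symm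
    refine ⟨(Complex.I / s) • X.trace, (s : ℂ)⁻¹ • X, (s : ℂ)⁻¹ • Y, ⟨ha, ?_, ?_⟩, ?_, ?_, ?_, ?_, ?_⟩
    · rw [conjTranspose_smul, hX]; simp
    · rw [transpose_smul, hY, smul_neg]
    · rw [D.der.map_smul, ← trace_map_der, eX, trace_smul, trace_outerC_sub, smul_smul,
        div_mul_cancel₀ _ hsC, smul_neg, smul_smul]
      simp [add_comm]
    · rw [map_smul', eX, inv_smul_smul₀ hsC]
    · rw [map_smul', eY, inv_smul_smul₀ hsC]
    · exact smul_right_injective _ hz (e0.symm.trans f0)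
    · exact smul_right_injective _ hz (e1.symm.trans f1)

end OpJ

end MatrixForm

/-! ### The adjoint action of e_x and its normalisation. -/

section ConstantElement

variable {A : Type} [CommRing A] [StarRing A] [Algebra ℂ A] {m : ℕ}

/-- The constant element `-i κ` of `𝔪_∥`, in the form `X = -i κ I`, `Y = 0`. -/
def constElt (m : ℕ) (A : Type) [CommRing A] [StarRing A] [Algebra ℂ A] (κ : ℝ) : BigMat m A :=
  mPar (cst A (-(κ * Complex.I)) • (1 : Matrix (Fin m) (Fin m) A)) 0

theorem eX_eq_constElt :
    eX m A = constElt m A (1 / Real.sqrt (8 * m * ((m : ℝ) + 1) ^ 2)) := by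
  rw [eX, constElt]
  congr 3
  push_cast
  ring

/-- The factor m + 1 = n is the gap between the eigenvalues iκm and -iκ of the constant element, so
this identifies the scale of ad(e_x) as 1/√ρ. -/
theorem sqrt_normalization (hm : 1 ≤ m) :
    1 / Real.sqrt (8 * m * ((m : ℝ) + 1) ^ 2) * (m + 1) = 1 / Real.sqrt (8 * m) := by
  have h1 : (0 : ℝ) < m + 1 := by positivity
  have h2 : (0 : ℝ) < 8 * m := by
    have : (1 : ℝ) ≤ m := by exact_mod_cast hm
    linarith
  rw [Real.sqrt_mul h2.le, Real.sqrt_sq h1.le]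
  have := (Real.sqrt_pos.2 h2).ne'
  field_simp

variable [StarModule ℂ A]

theorem star_cst (z : ℂ) : star (cst A z) = cst A (star z) := star_algebraMap z

theorem conjTranspose_cst_smul_one (κ : ℝ) :
    (cst A (-(κ * Complex.I)) • (1 : Matrix (Fin m) (Fin m) A))ᴴ
      = -(cst A (-(κ * Complex.I)) • 1) := by
  rw [conjTranspose_smul, star_cst]
  simp [cst]

theorem trace_cst_smul_one (z : ℂ) :
    (cst A z • (1 : Matrix (Fin m) (Fin m) A)).trace = cst A (m * z) := by
  rw [trace_smul, trace_one]
  simp [cst, mul_comm]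

theorem lie_hPerp_constElt (w : Vec m A) (κ : ℝ) :
    ⁅hPerp w, constElt m A κ⁆ = mPerp ((-((κ * (m + 1) : ℝ) * Complex.I)) • w) := by
  rw [constElt, lie_hPerp_mPar w (conjTranspose_cst_smul_one κ) (by simp), trace_cst_smul_one,
    conjM_smul_one, star_cst]
  congr 1
  funext l
  fin_cases l
  all_goals
    simp [vecMul_smul]
    ext j
    simp [cst, Algebra.smul_def]
    ring

theorem lie_constElt_mPerp (h : Vec m A) (κ : ℝ) :
    ⁅constElt m A κ, mPerp h⁆ = hPerp (((κ * (m + 1) : ℝ) * Complex.I) • h) := by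
  rw [constElt, Ring.lie_def, mPar_eq, mPerp_eq, mMat_mul, mMat_mul, hMat_sub, trace_cst_smul_one,
    hPerp_eq]
  simp only [conjM_blk, blk_mul, blk_sub, blk_add, conjM_smul_one, star_cst]
  congr 1 <;> rw [blk_inj] <;> refine ⟨by simp, ?_, ?_, by simp⟩ <;>
    simp [vecMul_smul, smul_mulVec, star_cst] <;>
    ext j <;> simp [cst, Algebra.smul_def] <;> ring

theorem lie_constElt_mPar (X Y : Matrix (Fin m) (Fin m) A) (κ : ℝ) :
    ⁅constElt m A κ, mPar X Y⁆ = 0 := by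
  rw [constElt, Ring.lie_def, mPar_eq, mPar_eq, mMat_mul, mMat_mul, hMat_sub, ← hPar_zero,
    hPar_eq, trace_cst_smul_one]
  simp only [conjM_blk, blk_mul, blk_sub, blk_add, conjM_smul_one, star_cst]
  congr 1 <;> rw [blk_inj] <;> refine ⟨by simp [mul_comm], by simp, by simp, ?_⟩ <;>
    simp [cst]

/-- Block-diagonal matrices commute with a constant element that is scalar on each block of the
upper left quarter. The element is purely imaginary, so the off-diagonal quarters cause no
obstruction either. -/
theorem lie_hPar_constElt (c d : A) (X Y : Matrix (Fin m) (Fin m) A) (κ : ℝ) :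
    ⁅hPar c d X Y, constElt m A κ⁆ = 0 := by
  rw [constElt, Ring.lie_def, mPar_eq, hPar_eq, hMat_mul_mMat, mMat_mul_hMat, mMat_sub, ← mPar_zero,
    mPar_eq, trace_cst_smul_one]
  simp only [conjM_blk, blk_mul, blk_sub, blk_add, conjM_smul_one, star_cst]
  congr 1 <;> rw [blk_inj] <;> refine ⟨by simp [cst, mul_comm, star_algebraMap], by simp, by simp, ?_⟩ <;>
    simp [cst]

end ConstantElement

/-! ### Flatness of g⁻¹dg and its splitting into the Cartan equations. -/

section Flow

variable {U : TopologicalSpace.Opens (ℝ × ℝ)} {m : ℕ}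

/-- Symmetry of the second derivative on the open set; the extension by zero is smooth there and
only its germ at points of `U` matters. -/
theorem dirD_comm (e e' : ℝ × ℝ) (f : smoothFn U) :
    (dirD e).der ((dirD e').der f) = (dirD e').der ((dirD e).der f) := by
  have key : ∀ (e e' : ℝ × ℝ) (p : U), ((dirD e).der ((dirD e').der f)).1 p
      = fderiv ℝ (fderiv ℝ (ext0 U f.1)) p e e' := by
    intro e e' p
    have h : ext0 U ((dirD e').der f).1 =ᶠ[nhds (p : ℝ × ℝ)]
        fun q => fderiv ℝ (ext0 U f.1) q e' := by
      filter_upwards [U.isOpen.mem_nhds p.2] with q hq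
      exact ext0_coe U _ ⟨q, hq⟩
    change fderiv ℝ (ext0 U ((dirD e').der f).1) p e = _
    have hd : DifferentiableAt ℝ (fderiv ℝ (ext0 U f.1)) p :=
      ((f.2.contDiffAt (U.isOpen.mem_nhds p.2)).fderiv_right (m := 1) (by norm_cast)).differentiableAt
        (by simp)
    rw [h.fderiv_eq, fderiv_clm_apply hd (differentiableAt_const _)]
    simp
  refine Subtype.ext <| funext fun p => ?_
  rw [key, key]
  have : ContDiffAt ℝ ∞ (ext0 U f.1) p := f.2.contDiffAt (U.isOpen.mem_nhds p.2)
  exact (this.isSymmSndFDerivAt (by simp; norm_cast)) e e'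

theorem Dt_Dx_comm (f : smoothFn U) :
    (Dt U).der ((Dx U).der f) = (Dx U).der ((Dt U).der f) := dirD_comm _ _ f

end Flow

section Leibniz

variable {A : Type} [CommRing A] [StarRing A] [Algebra ℂ A] {m : ℕ} (D : RealDer A)

theorem mul_map_der {k l r : Type} [Fintype l] (X : Matrix k l A) (Y : Matrix l r A) :
    (X * Y).map D.der = X.map D.der * Y + X * Y.map D.der := by
  ext i j
  simp only [map_apply, Matrix.mul_apply, Matrix.add_apply, map_sum, Derivation.leibniz, smul_eq_mul,
    ← Finset.sum_add_distrib]
  exact Finset.sum_congr rfl fun k _ => by ring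

theorem add_map_der {k l : Type} (X Y : Matrix k l A) :
    (X + Y).map D.der = X.map D.der + Y.map D.der := by
  ext; simp

theorem add_lie_mat (M N K : BigMat m A) : ⁅M + N, K⁆ = ⁅M, K⁆ + ⁅N, K⁆ := by
  simp only [Ring.lie_def]
  noncomm_ring

theorem hPerp_sub (v w : Vec m A) : hPerp v - hPerp w = hPerp (v - w) := by
  rw [sub_eq_iff_eq_add, hPerp_add, sub_add_cancel]

/-- The flatness of a connection of the form `g⁻¹ dg`. -/
theorem flat_of_framing (D' : RealDer A) (hD : ∀ a, D'.der (D.der a) = D.der (D'.der a))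
    {g P Q : BigMat m A} (hg : gᴴ * g = 1) (hP : gᴴ * g.map D.der = P)
    (hQ : gᴴ * g.map D'.der = Q) :
    Q.map D.der - P.map D'.der + ⁅P, Q⁆ = 0 := by
  have hg' : g * gᴴ = 1 := mul_eq_one_comm.1 hg
  have hP' : g.map D.der = g * P := by rw [← hP, ← mul_assoc, hg', one_mul]
  have hQ' : g.map D'.der = g * Q := by rw [← hQ, ← mul_assoc, hg', one_mul]
  have h1 : (g.map D.der).map D'.der = (g.map D'.der).map D.der := by
    ext; simp [hD]
  rw [hP', hQ', mul_map_der, mul_map_der, hP', hQ'] at h1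
  -- Both sides are gᴴ times a mixed second derivative of g; cancelling g leaves the zero-curvature
  -- equation.
  have h2 : gᴴ * (g * Q * P + g * P.map D'.der) = gᴴ * (g * P * Q + g * Q.map D.der) := by rw [h1]
  simp only [mul_add, ← mul_assoc, hg, one_mul] at h2
  rw [Ring.lie_def]
  calc _ = (P * Q + Q.map D.der) - (Q * P + P.map D'.der) := by abel
    _ = 0 := by rw [h2, sub_self]

end Leibniz

section Grading

variable {A : Type} [CommRing A] [StarRing A] [Algebra ℂ A] {m : ℕ}

/-- `M` has the block form of `𝔪`. -/
def IsM (M : BigMat m A) : Prop := ∃ X Y, M = mMat X Y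

/-- `M` has the block form of `𝔥`. -/
def IsH (M : BigMat m A) : Prop := ∃ X Y, M = hMat X Y

theorem IsM.add {M N : BigMat m A} : IsM M → IsM N → IsM (M + N) := by
  rintro ⟨X, Y, rfl⟩ ⟨X', Y', rfl⟩; exact ⟨_, _, mMat_add ..⟩

theorem IsM.sub {M N : BigMat m A} : IsM M → IsM N → IsM (M - N) := by
  rintro ⟨X, Y, rfl⟩ ⟨X', Y', rfl⟩; exact ⟨_, _, mMat_sub ..⟩

theorem IsM.map (D : RealDer A) {M : BigMat m A} : IsM M → IsM (M.map D.der) := by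
  rintro ⟨X, Y, rfl⟩; exact ⟨_, _, mMat_map ..⟩

theorem IsH.add {M N : BigMat m A} : IsH M → IsH N → IsH (M + N) := by
  rintro ⟨X, Y, rfl⟩ ⟨X', Y', rfl⟩; exact ⟨_, _, hMat_add ..⟩

theorem IsH.sub {M N : BigMat m A} : IsH M → IsH N → IsH (M - N) := by
  rintro ⟨X, Y, rfl⟩ ⟨X', Y', rfl⟩; exact ⟨_, _, hMat_sub ..⟩

theorem IsH.map (D : RealDer A) {M : BigMat m A} : IsH M → IsH (M.map D.der) := by
  rintro ⟨X, Y, rfl⟩; exact ⟨_, _, hMat_map ..⟩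

theorem IsH.lie {M N : BigMat m A} : IsH M → IsH N → IsH ⁅M, N⁆ := by
  rintro ⟨X, Y, rfl⟩ ⟨X', Y', rfl⟩
  exact ⟨_, _, by rw [Ring.lie_def, hMat_mul, hMat_mul, hMat_sub]⟩

theorem IsH.lie_isM {M N : BigMat m A} : IsH M → IsM N → IsM ⁅M, N⁆ := by
  rintro ⟨X, Y, rfl⟩ ⟨X', Y', rfl⟩
  exact ⟨_, _, by rw [Ring.lie_def, hMat_mul_mMat, mMat_mul_hMat, mMat_sub]⟩

theorem IsM.lie {M N : BigMat m A} : IsM M → IsM N → IsH ⁅M, N⁆ := by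
  rintro ⟨X, Y, rfl⟩ ⟨X', Y', rfl⟩
  exact ⟨_, _, by rw [Ring.lie_def, mMat_mul, mMat_mul, hMat_sub]⟩

theorem eq_zero_of_add_self {a : A} (h : a + a = 0) : a = 0 := by
  have : (2 : ℂ) • a = 0 := by rw [two_smul, h]
  simpa using congrArg ((2 : ℂ)⁻¹ • ·) this

theorem eq_zero_of_neg_eq {a : A} (h : -a = a) : a = 0 :=
  eq_zero_of_add_self (by nth_rw 1 [← h]; simp)

/-- The lower blocks of the two forms carry opposite signs, so each upper block is its own negative,
and 2 is invertible in a complex algebra. -/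
theorem IsM.eq_zero_of_add_isH {M N : BigMat m A} :
    IsM M → IsH N → M + N = 0 → M = 0 ∧ N = 0 := by
  rintro ⟨X, Y, rfl⟩ ⟨X', Y', rfl⟩ h
  have h0 := h
  rw [mMat, hMat, fromBlocks_add, ← fromBlocks_zero, fromBlocks_inj] at h
  obtain ⟨h1, h2, h3, h4⟩ := h
  have e1 : X' = -X := (neg_eq_of_add_eq_zero_right h1).symm
  have e2 : Y' = -Y := (neg_eq_of_add_eq_zero_right h2).symm
  have hX : X = 0 := by
    ext i j
    have := congrArg star (congrFun (congrFun h4 i) j)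
    simp [e1] at this
    exact eq_zero_of_neg_eq (eq_of_sub_eq_zero (by simpa [sub_eq_add_neg] using this))
  have hY : Y = 0 := by
    ext i j
    have := congrArg star (congrFun (congrFun h3 i) j)
    simp [e2] at this
    exact eq_zero_of_add_self this
  have hM : mMat X Y = 0 := by simp [mMat, hX, hY]
  exact ⟨hM, by simpa [hM] using h0⟩

theorem isM_mPar (X Y : Matrix (Fin m) (Fin m) A) : IsM (mPar X Y) := ⟨_, _, rfl⟩

theorem isM_mPerp (v : Vec m A) : IsM (mPerp v) := ⟨_, _, rfl⟩

theorem isH_hPar (c d : A) (X Y : Matrix (Fin m) (Fin m) A) : IsH (hPar c d X Y) := ⟨_, _, rfl⟩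

theorem isH_hPerp (v : Vec m A) : IsH (hPerp v) := ⟨_, _, rfl⟩

end Grading

/-! ### Structure equations and operator form of the flow. -/

section Flow

variable {U : TopologicalSpace.Opens (ℝ × ℝ)} {m : ℕ}

theorem constElt_map {A : Type} [CommRing A] [StarRing A] [Algebra ℂ A] (D : RealDer A) (κ : ℝ) :
    (constElt m A κ).map D.der = 0 := by
  have h : (cst A (-(κ * Complex.I)) • (1 : Matrix (Fin m) (Fin m) A)).map D.der = 0 := by
    ext i j
    rcases eq_or_ne i j with rfl | hij
    · simp [cst]
    · simp [Matrix.one_apply_ne hij]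
  rw [constElt, mPar_eq, mMat_map, blk_map, blk_map, h, D.der.map_neg, ← trace_map_der, h,
    ← mPar_zero, mPar_eq]
  congr 2 <;> first | (ext; simp [mapV]) | simp

/-- The zero-curvature equation of g⁻¹dg is the sum of an 𝔪-part and an 𝔥-part, and the grading
separates them into the two structure equations. -/
theorem cartan_of_framing {g : BigMat m (smoothFn U)} {u : Vec m (smoothFn U)} {F : FrameData m U}
    (h : IsParallelFraming g u F) : CartanEquations u F := by
  obtain ⟨hg, -, hP, hQ⟩ := h
  have key := flat_of_framing (Dx U) (Dt U) Dt_Dx_comm hg hP hQ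
  have hE : IsM (eX m (smoothFn U)) := isM_mPar _ _
  have hu := isH_hPerp u
  have hT : IsM F.eT := (isM_mPar _ _).add (isM_mPerp _)
  have hO : IsH F.ωT := (isH_hPar _ _ _ _).add (isH_hPerp _)
  have := IsM.eq_zero_of_add_isH
    (M := F.eT.map (Dx U).der - (eX m (smoothFn U)).map (Dt U).der
      + ⁅hPerp u, F.eT⁆ - ⁅F.ωT, eX m (smoothFn U)⁆)
    (N := F.ωT.map (Dx U).der - (hPerp u).map (Dt U).der + ⁅hPerp u, F.ωT⁆
      + ⁅eX m (smoothFn U), F.eT⁆)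
    ((((hT.map _).sub (hE.map _)).add (hu.lie_isM hT)).sub (hO.lie_isM hE))
    ((((hO.map _).sub (hu.map _)).add (hu.lie hO)).add (hE.lie hT)) (by
      rw [← key]
      simp only [Ring.lie_def, add_map_der, add_mul, mul_add]
      abel)
  exact ⟨this.1, eq_neg_of_add_eq_zero_left this.2⟩

theorem hPerp_map {A : Type} [CommRing A] [StarRing A] [Algebra ℂ A] (D : RealDer A) (v : Vec m A) :
    (hPerp v).map D.der = hPerp (fun l => mapV D.der (v l)) := by
  have := hPar_add_hPerp_map D 0 0 0 0 v
  simpa [hPar_zero, show (0 : Matrix (Fin m) (Fin m) A).map D.der = 0 by ext; simp] using this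

/-- Since e_x is constant and commutes with the parallel parts, only the perpendicular parts
contribute through ad(e_x). What remains are equations for ∇e_t and ∇ω_t of the shape in `opJ_iff`
and `opH_iff`. -/
theorem cartan_iff (hm : 1 ≤ m) (u : Vec m (smoothFn U)) (F : FrameData m U) :
    CartanEquations u F ↔
      nabla (Dx U) u (mPar F.H₁ F.H₂ + mPerp F.hPe)
        = mPerp ((-(((1 / Real.sqrt (8 * m) : ℝ) : ℂ) * Complex.I)) • F.wPe) ∧
      nabla (Dx U) u (hPar F.w₁ F.w₂ F.W₁ F.W₂ + hPerp F.wPe)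
        = hPerp ((fun l => mapV (Dt U).der (u l)) - hUp F.hPe) := by
  have h1 : ⁅F.ωT, eX m (smoothFn U)⁆
      = mPerp ((-(((1 / Real.sqrt (8 * m) : ℝ) : ℂ) * Complex.I)) • F.wPe) := by
    rw [FrameData.ωT, eX_eq_constElt, add_lie_mat, lie_hPar_constElt, zero_add, lie_hPerp_constElt,
      sqrt_normalization hm]
  have h2 : ⁅eX m (smoothFn U), F.eT⁆ = hPerp (hUp F.hPe) := by
    rw [FrameData.eT, eX_eq_constElt, lie_add_mat, lie_constElt_mPar, zero_add, lie_constElt_mPerp,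
      sqrt_normalization hm, hUp]
    congr 2
    push_cast
    ring
  rw [CartanEquations, h1, h2, eX_eq_constElt, constElt_map, hPerp_map, sub_zero, sub_eq_zero]
  refine and_congr Iff.rfl ?_
  rw [← hPerp_sub]
  change _ ↔ F.ωT.map (Dx U).der + ⁅hPerp u, F.ωT⁆ = _
  rw [sub_add_eq_add_sub, sub_eq_iff_eq_add, neg_add_eq_sub]

theorem sqrt_eight_mul_ne_zero (hm : 1 ≤ m) : Real.sqrt (8 * m) ≠ 0 := by
  have : (1 : ℝ) ≤ m := by exact_mod_cast hm
  exact (Real.sqrt_pos.2 (by linarith)).ne'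

/-- Together with `sqrt_smul_smul` this shows that s = √ρ is the scale at which `opJ_iff` matches
the torsion equation: h^⊥ goes back to h_⊥, and the factor 8(n-1) = ρ turns 1/√ρ into √ρ. -/
theorem sqrt_smul_hUp (hm : 1 ≤ m) (h : Vec m (smoothFn U)) :
    (-((Real.sqrt (8 * m) : ℂ) * Complex.I)) • hUp h = h := by
  have : ((Real.sqrt (8 * m) : ℝ) : ℂ) ≠ 0 := by exact_mod_cast sqrt_eight_mul_ne_zero hm
  rw [hUp, smul_smul, neg_mul, mul_assoc, mul_div_left_comm, mul_div_assoc', Complex.I_mul_I]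
  field_simp
  simp

theorem sqrt_smul_smul (hm : 1 ≤ m) (y : Vec m (smoothFn U)) :
    (-(((1 / Real.sqrt (8 * m) : ℝ) : ℂ) * Complex.I)) • ((8 * (m : ℂ)) • y)
      = (-((Real.sqrt (8 * m) : ℂ) * Complex.I)) • y := by
  have h0 : ((Real.sqrt (8 * m) : ℝ) : ℂ) ≠ 0 := by exact_mod_cast sqrt_eight_mul_ne_zero hm
  have h1 : ((Real.sqrt (8 * m) : ℝ) : ℂ) * (Real.sqrt (8 * m) : ℝ) = 8 * m := by
    rw [← Complex.ofReal_mul, Real.mul_self_sqrt (by positivity)]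
    push_cast
    ring
  rw [smul_smul, ← h1]
  congr 1
  push_cast
  field_simp

theorem operatorFlow_of_cartan (hm : 1 ≤ m) {u : Vec m (smoothFn U)} {F : FrameData m U}
    (h : CartanEquations u F) : OperatorFlow u F.wPe (hUp F.hPe) := by
  rw [cartan_iff hm] at h
  have h8 : (8 * (m : ℂ)) ≠ 0 := by
    have : (m : ℂ) ≠ 0 := by exact_mod_cast (by omega : m ≠ 0)
    simpa using this
  refine ⟨⟨_, (opH_iff _ _ _ _).2 ⟨_, _, _, _, ⟨F.w₁_imag, F.W₁_skew, F.W₂_symm⟩, h.2⟩,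
    (sub_add_cancel _ _).symm⟩, (8 * (m : ℂ))⁻¹ • F.wPe,
    (opJ_iff _ (sqrt_eight_mul_ne_zero hm) _ _ _).2 ⟨_, _, ⟨F.H₁_skew, F.H₂_skew⟩, ?_⟩,
    (smul_inv_smul₀ h8 _).symm⟩
  rw [sqrt_smul_hUp hm, h.1, ← sqrt_smul_smul hm, smul_inv_smul₀ h8]

/-- The parallel components of the frame are read off from the antiderivatives that 𝓗 and 𝓙 use. -/
theorem cartan_of_operatorFlow (hm : 1 ≤ m) {u hPe wPe : Vec m (smoothFn U)}
    (h : OperatorFlow u wPe (hUp hPe)) :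
    ∃ F : FrameData m U, F.hPe = hPe ∧ F.wPe = wPe ∧ CartanEquations u F := by
  obtain ⟨⟨v, hv, huv⟩, y, hy, rfl⟩ := h
  obtain ⟨p, q, P, Q, ⟨hp, hP, hQ⟩, hH⟩ := (opH_iff _ _ _ _).1 hv
  obtain ⟨X, Y, ⟨hX, hY⟩, hJ⟩ := (opJ_iff _ (sqrt_eight_mul_ne_zero hm) _ _ _).1 hy
  refine ⟨⟨X, Y, hPe, p, q, P, Q, _, hX, hY, hp, hP, hQ⟩, rfl, rfl, (cartan_iff hm _ _).2 ⟨?_, ?_⟩⟩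
  · rw [sqrt_smul_smul hm, ← hJ, sqrt_smul_hUp hm]
  · rw [hH, huv, add_sub_cancel_right]

end Flow

/-! ### Agreement with the explicit 2 × 2 arrays. -/

section Arrays

variable {A : Type} [CommRing A] [StarRing A] [Algebra ℂ A] {m : ℕ} (I : A →+ A)

theorem map_add_hom {k l : Type} (X Y : Matrix k l A) : (X + Y).map I = X.map I + Y.map I := by
  ext; simp

theorem map_sub_hom {k l : Type} (X Y : Matrix k l A) : (X - Y).map I = X.map I - Y.map I := by
  ext; simp

theorem conjM_map_hom (hI : ∀ a, I (star a) = star (I a)) {k l : Type} (X : Matrix k l A) :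
    conjM (X.map I) = (conjM X).map I := by
  ext; simp [hI]

theorem map_map_right_inverse {D : RealDer A} (hD : ∀ a, D.der (I a) = a) {k l : Type}
    (X : Matrix k l A) : (X.map I).map D.der = X := by
  ext; simp [hD]

theorem star_innerC (x y : Fin m → A) : star (innerC x y) = -innerC x y := by
  simp [innerC, mul_comm]

theorem star_innerA (x y : Fin m → A) : star (innerA x y) = innerA x y := by
  simp only [innerA, star_sum]
  exact Finset.sum_congr rfl fun j _ => by simp; ring

theorem outerC_conjTranspose (x y : Fin m → A) : (outerC x y)ᴴ = -outerC x y := by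
  ext i j
  simp [outerC, mul_comm]

theorem outerA_transpose (x y : Fin m → A) : (outerA x y)ᵀ = -outerA x y := by
  ext i j
  simp [outerA, mul_comm]

theorem outerS_transpose (x y : Fin m → A) : (outerS x y)ᵀ = outerS x y := by
  ext i j
  simp [outerS, mul_comm, add_comm]

theorem conjTranspose_map_of_skew (hI : ∀ a, I (star a) = star (I a))
    {X : Matrix (Fin m) (Fin m) A} (h : Xᴴ = -X) : (X.map I)ᴴ = -X.map I := by
  ext i j
  have := star_skew_apply h j i
  simp [← hI, this]

/-- Additivity of `I` collects the terms with a common left factor under one antiderivative, and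
compatibility with conjugation makes that antiderivative of the same type. -/
theorem opH_blockH [StarModule ℂ A] (D : RealDer A) (hD : ∀ a, D.der (I a) = a)
    (hI : ∀ a, I (star a) = star (I a)) (u w : Vec m A) :
    opH m A D u w (applyBlock (blockH D.der I u) w) := by
  refine ⟨I (innerC (u 0) (w 0) + innerC (u 1) (w 1)), I (innerS (u 1) (w 0) - innerS (u 0) (w 1)),
    (outerC (u 0) (w 0) + conjM (outerC (u 1) (w 1))).map I,
    (conjM (outerS (u 0) (w 1)) - outerS (u 1) (w 0)).map I, ⟨?_, ?_, ?_⟩, hD _, hD _,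
    map_map_right_inverse I hD _, map_map_right_inverse I hD _, ?_, ?_⟩
  · rw [← hI, star_add, star_innerC, star_innerC, ← neg_add, map_neg]
  · refine conjTranspose_map_of_skew I hI ?_
    rw [conjTranspose_add, outerC_conjTranspose, conjTranspose_conjM, ← conjM_conjTranspose,
      outerC_conjTranspose, conjM_neg, neg_add]
  · rw [← transpose_map, transpose_sub, outerS_transpose, transpose_conjM, ← conjM_transpose,
      outerS_transpose]
  · simp only [applyBlock, blockH, Fin.sum_univ_two, cons_val_zero, cons_val_one, conjM_map_hom I hI,
      map_add_hom, map_sub_hom, conjM_sub, conjM_add, conjM_conjM, map_add, map_sub, vecMul_add,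
      vecMul_sub, add_smul, sub_smul, neg_smul]
    abel
  · simp only [applyBlock, blockH, Fin.sum_univ_two, cons_val_zero, cons_val_one, conjM_map_hom I hI,
      map_add_hom, map_sub_hom, conjM_sub, conjM_add, conjM_conjM, map_add, map_sub, vecMul_add,
      vecMul_sub, add_smul, sub_smul, neg_smul]
    abel

theorem opJ_blockJ [StarModule ℂ A] (D : RealDer A) (hD : ∀ a, D.der (I a) = a)
    (hI : ∀ a, I (star a) = star (I a)) (u h : Vec m A) :
    opJ m A D u h (applyBlock (blockJ D.der I u) h) := by
  refine ⟨I (innerA (u 0) (h 0) + innerA (u 1) (h 1)),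
    (outerC (iV (u 0)) (h 0) - conjM (outerC (iV (u 1)) (h 1))).map I,
    (outerA (iV (u 1)) (h 0) + conjM (outerA (iV (u 0)) (h 1))).map I, ⟨?_, ?_, ?_⟩, hD _,
    map_map_right_inverse I hD _, map_map_right_inverse I hD _, ?_, ?_⟩
  · rw [← hI, star_add, star_innerA, star_innerA]
  · refine conjTranspose_map_of_skew I hI ?_
    rw [conjTranspose_sub, outerC_conjTranspose, conjTranspose_conjM, ← conjM_conjTranspose,
      outerC_conjTranspose, conjM_neg, neg_sub, sub_neg_eq_add, neg_add_eq_sub]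
  · rw [← transpose_map, transpose_add, outerA_transpose, transpose_conjM, ← conjM_transpose,
      outerA_transpose, conjM_neg, ← neg_add]
    ext; simp
  · simp only [applyBlock, blockJ, Fin.sum_univ_two, cons_val_zero, cons_val_one, conjM_map_hom I hI,
      map_add_hom, map_sub_hom, conjM_sub, conjM_add, conjM_conjM, map_add, map_sub, vecMul_add,
      vecMul_sub, add_smul, sub_smul, neg_smul]
    abel
  · simp only [applyBlock, blockJ, Fin.sum_univ_two, cons_val_zero, cons_val_one, conjM_map_hom I hI,
      map_add_hom, map_sub_hom, conjM_sub, conjM_add, conjM_conjM, map_add, map_sub, vecMul_add,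
      vecMul_sub, add_smul, sub_smul, neg_smul]
    abel

end Arrays

/-! ### Invariance under Sp(1) × Sp(n-1). -/

section Invariance

variable {A : Type} [CommRing A] [StarRing A] [Algebra ℂ A] {m : ℕ}

theorem hMat_conjTranspose (X Y : Matrix (Idx m) (Idx m) A) : (hMat X Y)ᴴ = hMat Xᴴ (-Yᵀ) := by
  rw [hMat, fromBlocks_conjTranspose, hMat, conjM_neg, neg_neg, conjTranspose_neg,
    conjTranspose_conjM, conjTranspose_conjM, conjM_transpose, conjM_conjTranspose]

theorem mMat_conjTranspose (X Y : Matrix (Idx m) (Idx m) A) : (mMat X Y)ᴴ = mMat Xᴴ Yᵀ := by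
  rw [mMat, fromBlocks_conjTranspose, mMat, conjTranspose_neg,
    conjTranspose_conjM, conjTranspose_conjM, conjM_transpose, conjM_conjTranspose]

theorem blk_conjTranspose (c : A) (v w : Fin m → A) (X : Matrix (Fin m) (Fin m) A) :
    (blk c v w X)ᴴ = blk (star c) (star w) (star v) Xᴴ := by
  ext (i | i) (j | j) <;> rfl

theorem blk_transpose (c : A) (v w : Fin m → A) (X : Matrix (Fin m) (Fin m) A) :
    (blk c v w X)ᵀ = blk c w v Xᵀ := by
  ext (i | i) (j | j) <;> rfl

theorem blk_neg (c : A) (v w : Fin m → A) (X : Matrix (Fin m) (Fin m) A) :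
    -blk c v w X = blk (-c) (-v) (-w) (-X) := by
  ext (i | i) (j | j) <;> rfl

theorem hPar_conjTranspose (c d : A) (X Y : Matrix (Fin m) (Fin m) A) :
    (hPar c d X Y)ᴴ = hPar (star c) (-d) Xᴴ (-Yᵀ) := by
  rw [hPar_eq, hMat_conjTranspose, hPar_eq, blk_conjTranspose, blk_transpose, blk_neg]
  simp

theorem neg_hPar (c d : A) (X Y : Matrix (Fin m) (Fin m) A) :
    -hPar c d X Y = hPar (-c) (-d) (-X) (-Y) := by
  rw [neg_eq_iff_add_eq_zero, hPar_add]
  simp [hPar_zero]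

theorem hPar_inj {c d c' d' : A} {X Y X' Y' : Matrix (Fin m) (Fin m) A} :
    hPar c d X Y = hPar c' d' X' Y' ↔ c = c' ∧ d = d' ∧ X = X' ∧ Y = Y' := by
  have := hPar_add_hPerp_inj (c := c) (d := d) (c' := c') (d' := d') (X := X) (Y := Y) (X' := X')
    (Y' := Y') (v := 0) (v' := 0)
  simpa using this

theorem hPar_skew_iff {c d : A} {X Y : Matrix (Fin m) (Fin m) A} :
    (hPar c d X Y)ᴴ = -hPar c d X Y ↔ star c = -c ∧ Xᴴ = -X ∧ Yᵀ = Y := by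
  rw [hPar_conjTranspose, neg_hPar, hPar_inj]
  simp

theorem mPar_conjTranspose {X Y : Matrix (Fin m) (Fin m) A} (hX : Xᴴ = -X) (hY : Yᵀ = -Y) :
    (mPar X Y)ᴴ = -mPar X Y := by
  have ht : star X.trace = -X.trace := by rw [← trace_conjTranspose, hX, trace_neg]
  rw [mPar_eq, mMat_conjTranspose, blk_conjTranspose, blk_transpose, hX, hY, star_neg, ht,
    eq_neg_iff_add_eq_zero, mMat_add, blk_add, blk_add, ← mPar_zero, mPar_eq]
  simp

theorem trace_fromBlocks' {k l : Type} [Fintype k] [Fintype l] (P : Matrix k k A) (Q : Matrix k l A)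
    (R : Matrix l k A) (S : Matrix l l A) : (fromBlocks P Q R S).trace = P.trace + S.trace := by
  simp [Matrix.trace]

theorem mPar_trace {X : Matrix (Fin m) (Fin m) A} (Y : Matrix (Fin m) (Fin m) A) :
    (mPar X Y).trace = 0 := by
  simp [mPar_eq, mMat, Matrix.trace, blk]

variable (c d : A) (X Y : Matrix (Fin m) (Fin m) A)

theorem conj_hPar (p q : A) (P Q : Matrix (Fin m) (Fin m) A) :
    ∃ p' q' P' Q', hPar c d X Y * hPar p q P Q * (hPar c d X Y)ᴴ = hPar p' q' P' Q' := by
  rw [hPar_conjTranspose]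
  simp only [hPar_eq, hMat_mul, conjM_blk, blk_mul, blk_sub, blk_add]
  simp only [star_zero, zero_dotProduct, smul_zero, zero_vecMul, mulVec_zero, vecMulVec_zero, add_zero,
    sub_zero, zero_add]
  exact ⟨_, _, _, _, rfl⟩

/-- Block-diagonality survives conjugation by inspection. The remaining shape of 𝔪_∥ follows from
invariants: the result is skew-Hermitian and has trace zero because the original has these
properties and the conjugating matrix is unitary. -/
theorem conj_mPar (hG : (hPar c d X Y)ᴴ * hPar c d X Y = 1) {P Q : Matrix (Fin m) (Fin m) A}
    (hP : Pᴴ = -P) (hQ : Qᵀ = -Q) : ∃ P' Q', (P'ᴴ = -P' ∧ Q'ᵀ = -Q') ∧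
      hPar c d X Y * mPar P Q * (hPar c d X Y)ᴴ = mPar P' Q' := by
  have h1 : ∃ z y P' Q', hPar c d X Y * mPar P Q * (hPar c d X Y)ᴴ
      = mMat (blk z 0 0 P') (blk y 0 0 Q') := by
    rw [hPar_conjTranspose]
    simp only [hPar_eq, mPar_eq, hMat_mul_mMat, mMat_mul_hMat, conjM_blk, blk_mul, blk_sub, blk_add]
    simp only [star_zero, zero_dotProduct, smul_zero, zero_vecMul, mulVec_zero, vecMulVec_zero,
      add_zero, sub_zero, zero_add]
    exact ⟨_, _, _, _, rfl⟩
  obtain ⟨z, y, P', Q', h⟩ := h1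
  have h2 : (hPar c d X Y * mPar P Q * (hPar c d X Y)ᴴ).trace = 0 := by
    rw [trace_mul_comm, ← mul_assoc, hG, one_mul, mPar_trace]
  have h3 : (hPar c d X Y * mPar P Q * (hPar c d X Y)ᴴ)ᴴ
      = -(hPar c d X Y * mPar P Q * (hPar c d X Y)ᴴ) := by
    rw [conjTranspose_mul, conjTranspose_mul, conjTranspose_conjTranspose, mPar_conjTranspose hP hQ]
    noncomm_ring
  rw [h] at h2 h3
  rw [mMat_conjTranspose, eq_neg_iff_add_eq_zero, mMat_add, blk_conjTranspose, blk_transpose,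
    blk_add, blk_add, ← mPar_zero, mPar_eq] at h3
  obtain ⟨h4, h5⟩ := mMat_injective h3
  rw [blk_inj] at h4 h5
  have hP' : P'ᴴ = -P' := eq_neg_of_add_eq_zero_left h4.2.2.2
  have hQ' : Q'ᵀ = -Q' := eq_neg_of_add_eq_zero_left h5.2.2.2
  have hy : y = 0 := eq_zero_of_add_self h5.1
  have ht : star P'.trace = -P'.trace := by rw [← trace_conjTranspose, hP', trace_neg]
  have hz : z = -P'.trace := by
    have hz' : star z = -z := eq_neg_of_add_eq_zero_left (by simpa using h4.1)
    -- The two diagonal blocks have equal traces, since conjugation and the sign cancel on imaginary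
    -- quantities; so the full trace is twice z + tr P'.
    have : (z + P'.trace) + (z + P'.trace) = 0 := by
      rw [← h2, mMat, trace_fromBlocks']
      have e1 : (blk z 0 0 P').trace = z + P'.trace := by rw [blk, trace_fromBlocks']; simp [Matrix.trace]
      have e2 : (-conjM (blk z 0 0 P')).trace = z + P'.trace := by
        have : (conjM P').trace = star P'.trace := by simp [Matrix.trace]
        rw [conjM_blk, trace_neg, blk, trace_fromBlocks', this, ht, hz']
        simp [Matrix.trace, add_comm]
      rw [e1, e2]
    exact eq_neg_of_add_eq_zero_left (eq_zero_of_add_self this)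
  exact ⟨P', Q', ⟨hP', hQ'⟩, by rw [h, hz, hy, mPar_eq]⟩

end Invariance

section Act

variable {A : Type} [CommRing A] [StarRing A] [Algebra ℂ A] [StarModule ℂ A] {m : ℕ}

theorem mulVec_eq (X : Matrix (Fin m) (Fin m) A) (v : Fin m → A) : X *ᵥ v = v ᵥ* Xᵀ :=
  (vecMul_transpose X v).symm

theorem conj_hPerp (c d : ℂ) (X Y : Matrix (Fin m) (Fin m) ℂ) (v : Vec m A) :
    hPar (cst A c) (cst A d) (X.map (cst A)) (Y.map (cst A)) * hPerp v
      * (hPar (cst A c) (cst A d) (X.map (cst A)) (Y.map (cst A)))ᴴ = hPerp (spAct c d X Y v) := by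
  rw [hPar_conjTranspose]
  simp only [hPar_eq, hPerp_eq, hMat_mul, conjM_blk, blk_mul, blk_sub, blk_add]
  congr 1 <;> rw [blk_inj] <;> refine ⟨by simp, ?_, ?_, by simp⟩ <;>
    simp only [spAct, cons_val_zero, cons_val_one, smul_add, smul_neg, star_add, star_sub, star_neg,
      star_smul_vec, star_star, star_vecMul', mulVec_eq, conjM_conjTranspose, conjM_transpose,
      add_vecMul, sub_vecMul, neg_vecMul, smul_vecMul, conjM_neg, vecMul_neg, conjTranspose_conjTranspose,
      zero_smul, smul_zero, add_zero, zero_add, zero_vecMul, vecMul_zero, sub_zero, conjM_zero,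
      star_zero, zero_mulVec, transpose_transpose, neg_zero, smul_sub, neg_smul] <;> abel

theorem hPar_map_cst_unitary {c d : ℂ} {X Y : Matrix (Fin m) (Fin m) ℂ} (h : IsSpPair c d X Y) :
    (hPar (cst A c) (cst A d) (X.map (cst A)) (Y.map (cst A)))ᴴ
      * hPar (cst A c) (cst A d) (X.map (cst A)) (Y.map (cst A)) = 1 := by
  have h1 : (hPar c d X Y)ᴴ * hPar c d X Y = 1 := (mem_unitaryGroup_iff').1 h
  have h2 : hPar (cst A c) (cst A d) (X.map (cst A)) (Y.map (cst A))
      = (hPar c d X Y).map (algebraMap ℂ A) := by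
    ext ((i | i) | (i | i)) ((j | j) | (j | j)) <;>
      simp [hPar, hMat, cst, star_algebraMap, conjM]
  rw [h2, ← conjTranspose_map _ (fun z => (star_algebraMap z).symm), ← Matrix.map_mul, h1]
  simp

/-- A constant gauge transformation: conjugation by G commutes with D and is an automorphism of the
commutator, hence it only transforms the connection u. -/
theorem nabla_conj (D : RealDer A) {G : BigMat m A} (hG : Gᴴ * G = 1) (hD : G.map D.der = 0)
    {u u' : Vec m A} (hu : G * hPerp u * Gᴴ = hPerp u') (M : BigMat m A) :
    nabla D u' (G * M * Gᴴ) = G * nabla D u M * Gᴴ := by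
  have hD' : Gᴴ.map D.der = 0 := by
    have := congrArg conjTranspose hD
    rw [conjTranspose_zero] at this
    rw [← this]
    ext; simp [D.map_star]
  rw [nabla, nabla, mul_map_der, mul_map_der, hD, hD', ← hu, Ring.lie_def, Ring.lie_def]
  have e : ∀ M N : BigMat m A, G * M * Gᴴ * (G * N * Gᴴ) = G * (M * N) * Gᴴ := fun M N => by
    calc _ = G * M * (Gᴴ * G) * N * Gᴴ := by noncomm_ring
      _ = _ := by rw [hG]; noncomm_ring
  rw [e, e]
  noncomm_ring

theorem hPar_cst_map (D : RealDer A) (c d : ℂ) (X Y : Matrix (Fin m) (Fin m) ℂ) :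
    (hPar (cst A c) (cst A d) (X.map (cst A)) (Y.map (cst A))).map D.der = 0 := by
  have h : ∀ X : Matrix (Fin m) (Fin m) ℂ, (X.map (cst A)).map D.der = 0 := fun X => by
    ext; simp [cst]
  rw [hPar_eq, hMat_map, blk_map, blk_map, h, h, ← hPar_zero, hPar_eq]
  congr 2 <;> first | (ext; simp [mapV]) | simp [cst]

theorem opH_invariant : IsSpInvariant (opH m) := by
  intro c d X Y hG A _ _ _ _ D u w v h
  obtain ⟨p, q, P, Q, hs, h⟩ := (opH_iff D u w v).1 h
  obtain ⟨p', q', P', Q', e⟩ := conj_hPar (cst A c) (cst A d) (X.map (cst A)) (Y.map (cst A)) p q P Q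
  refine (opH_iff D _ _ _).2 ⟨p', q', P', Q', ?_, ?_⟩
  · rw [← hPar_skew_iff] at hs ⊢
    rw [← e, conjTranspose_mul, conjTranspose_mul, conjTranspose_conjTranspose, hs]
    noncomm_ring
  · rw [← e, ← conj_hPerp, ← conj_hPerp, ← h, ← nabla_conj D (hPar_map_cst_unitary hG)
      (hPar_cst_map D c d X Y) (conj_hPerp c d X Y u)]
    congr 1
    noncomm_ring

theorem lie_hPerp_unitElt (w : Vec m A) :
    ⁅hPerp w, constElt m A (1 / ((m : ℝ) + 1))⁆ = mPerp ((-(((1 : ℝ) : ℂ) * Complex.I)) • w) := by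
  rw [lie_hPerp_constElt, one_div_mul_cancel (by positivity)]

/-- No new block computation is needed: the 𝔪_⊥-matrix is the commutator of the 𝔥_⊥-matrix with a
constant element that the group centralises, so the action on 𝔥_⊥ determines the one on 𝔪_⊥. -/
theorem conj_mPerp {c d : ℂ} {X Y : Matrix (Fin m) (Fin m) ℂ} (hG : IsSpPair c d X Y) (v : Vec m A) :
    hPar (cst A c) (cst A d) (X.map (cst A)) (Y.map (cst A))
      * mPerp ((-(((1 : ℝ) : ℂ) * Complex.I)) • v)
      * (hPar (cst A c) (cst A d) (X.map (cst A)) (Y.map (cst A)))ᴴ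
      = mPerp ((-(((1 : ℝ) : ℂ) * Complex.I)) • spAct c d X Y v) := by
  rw [← lie_hPerp_unitElt, ← lie_hPerp_unitElt, ← conj_hPerp]
  have hu := hPar_map_cst_unitary (A := A) hG
  have hc := lie_hPar_constElt (cst A c) (cst A d) (X.map (cst A)) (Y.map (cst A))
    (1 / ((m : ℝ) + 1))
  set G := hPar (cst A c) (cst A d) (X.map (cst A)) (Y.map (cst A))
  set e := constElt m A (1 / ((m : ℝ) + 1))
  have hu' : G * Gᴴ = 1 := mul_eq_one_comm.1 hu
  rw [Ring.lie_def, sub_eq_zero] at hc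
  have hc' : e * Gᴴ = Gᴴ * e := by
    calc e * Gᴴ = Gᴴ * (G * e) * Gᴴ := by rw [← mul_assoc, hu, one_mul]
      _ = Gᴴ * e * (G * Gᴴ) := by rw [hc]; noncomm_ring
      _ = _ := by rw [hu', mul_one]
  rw [Ring.lie_def, Ring.lie_def]
  calc _ = G * hPerp v * (e * Gᴴ) - (G * e) * hPerp v * Gᴴ := by noncomm_ring
    _ = _ := by rw [hc, hc']; noncomm_ring

theorem opJ_invariant : IsSpInvariant (opJ m) := by
  intro c d X Y hG A _ _ _ _ D u w v h
  obtain ⟨P, Q, ⟨hP, hQ⟩, h⟩ := (opJ_iff D one_ne_zero u w v).1 h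
  obtain ⟨P', Q', hs, e⟩ := conj_mPar (cst A c) (cst A d) (X.map (cst A)) (Y.map (cst A))
    (hPar_map_cst_unitary hG) hP hQ
  refine (opJ_iff D one_ne_zero _ _ _).2 ⟨P', Q', hs, ?_⟩
  rw [← e, ← conj_mPerp hG, ← conj_mPerp hG, ← h, ← nabla_conj D (hPar_map_cst_unitary hG)
    (hPar_cst_map D c d X Y) (conj_hPerp c d X Y u)]
  congr 1
  noncomm_ring

end Act

/-! ### Functionals modulo total derivatives. -/

section Integral

variable {A : Type} [CommRing A] [StarRing A] [Algebra ℂ A] {D : RealDer A}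

theorem integralZero_zero : IntegralZero D 0 := ⟨0, by simp⟩

theorem integralZero_der (b : A) : IntegralZero D (D.der b) := ⟨b, rfl⟩

theorem IntegralZero.add {a b : A} : IntegralZero D a → IntegralZero D b → IntegralZero D (a + b) := by
  rintro ⟨a, rfl⟩ ⟨b, rfl⟩; exact ⟨a + b, by simp⟩

theorem IntegralZero.neg {a : A} : IntegralZero D a → IntegralZero D (-a) := by
  rintro ⟨a, rfl⟩; exact ⟨-a, by simp⟩

theorem IntegralZero.sub {a b : A} : IntegralZero D a → IntegralZero D b → IntegralZero D (a - b) := by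
  rintro ⟨a, rfl⟩ ⟨b, rfl⟩; exact ⟨a - b, by simp⟩

theorem IntegralZero.smul {a : A} (z : ℂ) : IntegralZero D a → IntegralZero D (z • a) := by
  rintro ⟨a, rfl⟩; exact ⟨z • a, by simp⟩

theorem IntegralZero.sum {ι : Type*} {s : Finset ι} {f : ι → A} (h : ∀ i ∈ s, IntegralZero D (f i)) :
    IntegralZero D (∑ i ∈ s, f i) :=
  Finset.sum_induction f (IntegralZero D) (fun _ _ => IntegralZero.add) integralZero_zero h

theorem integralZero_by_parts (k : ℕ) (a b : A) :
    IntegralZero D ((-1) ^ k * D.der^[k] a * b - a * D.der^[k] b) := by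
  induction k generalizing a with
  | zero => simpa using integralZero_zero
  | succ k ih =>
    have h := (ih (D.der a)).neg.sub (integralZero_der (D := D) (a * D.der^[k] b))
    convert h using 1
    rw [Function.iterate_succ_apply, Function.iterate_succ_apply', Derivation.leibniz]
    simp only [smul_eq_mul]
    ring

end Integral

/-! ### Partial, Wirtinger and total derivatives on the jet space. -/

section JetCalculus

variable {m : ℕ}

theorem partialD_apply (k : ℕ) (e : Vec m ℂ) (f : jetAlg m) {N : ℕ}
    {g : ℝ × (Fin N → Vec m ℂ) → ℂ} (hg : ContDiff ℝ ∞ g) (h : ∀ p, f.1 p = g (trunc N p))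
    (p : JetSpace m) :
    ((partialD k e).der f).1 p = fderiv ℝ g (trunc N p) (trunc N (0, Pi.single k e)) :=
  (IsLocal.hasDerivAt hg h p _).deriv

theorem totalD_apply (f : jetAlg m) {N : ℕ} {g : ℝ × (Fin N → Vec m ℂ) → ℂ}
    (hg : ContDiff ℝ ∞ g) (h : ∀ p, f.1 p = g (trunc N p)) (p : JetSpace m) :
    ((totalD m).der f).1 p = fderiv ℝ g (trunc N p) (trunc N (1, fun k => p.2 (k + 1))) :=
  (IsLocal.hasDerivAt hg h p _).deriv

theorem fderiv_fderiv_apply {F : Type} [NormedAddCommGroup F] [NormedSpace ℝ F] {g : F → ℂ}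
    (hg : ContDiff ℝ ∞ g) (q v w : F) :
    fderiv ℝ (fun q => fderiv ℝ g q v) q w = fderiv ℝ (fderiv ℝ g) q w v := by
  rw [fderiv_clm_apply ((hg.fderiv_right (m := ∞) (by simp)).differentiable (by simp) q)
    (differentiableAt_const _)]
  simp

theorem fderiv_fderiv_symm {F : Type} [NormedAddCommGroup F] [NormedSpace ℝ F] {g : F → ℂ}
    (hg : ContDiff ℝ ∞ g) (q v w : F) :
    fderiv ℝ (fderiv ℝ g) q v w = fderiv ℝ (fderiv ℝ g) q w v :=
  (hg.contDiffAt.isSymmSndFDerivAt (by simp; norm_cast)) v w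

theorem partialD_partialD (k k' : ℕ) (e e' : Vec m ℂ) (f : jetAlg m) :
    (partialD k e).der ((partialD k' e').der f) = (partialD k' e').der ((partialD k e).der f) := by
  obtain ⟨N, g, hg, h⟩ := f.2
  have key : ∀ (k k' : ℕ) (e e' : Vec m ℂ) (p : JetSpace m),
      ((partialD k e).der ((partialD k' e').der f)).1 p = fderiv ℝ (fderiv ℝ g) (trunc N p)
        (trunc N (0, Pi.single k e)) (trunc N (0, Pi.single k' e')) := by
    intro k k' e e' p
    have hg' : ContDiff ℝ ∞ fun q => fderiv ℝ g q (trunc N (0, Pi.single k' e')) :=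
      (hg.fderiv_right (m := ∞) (by simp)).clm_apply contDiff_const
    rw [partialD_apply k e _ hg' (fun p => partialD_apply k' e' f hg h p),
      fderiv_fderiv_apply hg]
  refine Subtype.ext <| funext fun p => ?_
  rw [key, key, fderiv_fderiv_symm hg]

/-- The commutator of the total derivative with a partial derivative. -/
theorem partialD_totalD_apply (k : ℕ) (e : Vec m ℂ) (f : jetAlg m) {N : ℕ}
    {g : ℝ × (Fin N → Vec m ℂ) → ℂ} (hg : ContDiff ℝ ∞ g) (h : ∀ p, f.1 p = g (trunc N p))
    (p : JetSpace m) :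
    ((partialD k e).der ((totalD m).der f)).1 p = ((totalD m).der ((partialD k e).der f)).1 p
      + fderiv ℝ g (trunc N p) (0, fun i => (Pi.single k e : ℕ → Vec m ℂ) (i + 1)) := by
  have hg' : ContDiff ℝ ∞ fun q => fderiv ℝ g q (trunc N (0, Pi.single k e)) :=
    (hg.fderiv_right (m := ∞) (by simp)).clm_apply contDiff_const
  -- In coordinates of order below N + 1 the total derivative of f is dg at ρq applied to the
  -- velocity c + τq, where ρ drops the top coordinate, τ shifts the jet and c is the unit vector in
  -- x.
  let ρ : (ℝ × (Fin (N + 1) → Vec m ℂ)) →L[ℝ] (ℝ × (Fin N → Vec m ℂ)) :=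
    (ContinuousLinearMap.fst ℝ _ _).prod
      (ContinuousLinearMap.pi fun i => (ContinuousLinearMap.proj i.castSucc).comp
        (ContinuousLinearMap.snd ℝ _ _))
  let τ : (ℝ × (Fin (N + 1) → Vec m ℂ)) →L[ℝ] (ℝ × (Fin N → Vec m ℂ)) :=
    (0 : (ℝ × (Fin (N + 1) → Vec m ℂ)) →L[ℝ] ℝ).prod
      (ContinuousLinearMap.pi fun i => (ContinuousLinearMap.proj i.succ).comp
        (ContinuousLinearMap.snd ℝ _ _))
  let c : ℝ × (Fin N → Vec m ℂ) := (1, 0)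
  have hF : ContDiff ℝ ∞ fun q => fderiv ℝ g (ρ q) (c + τ q) :=
    ((hg.fderiv_right (m := ∞) (by simp)).comp ρ.contDiff).clm_apply
      (contDiff_const.add τ.contDiff)
  have hrep : ∀ p, ((totalD m).der f).1 p
      = (fun q => fderiv ℝ g (ρ q) (c + τ q)) (trunc (N + 1) p) := by
    intro p
    rw [totalD_apply f hg h]
    change _ = fderiv ℝ g (trunc N p) _
    congr 1
    refine Prod.ext ?_ ?_
    · simp [c, τ, trunc]
    · funext i
      simp [c, τ, trunc]
  have hd : DifferentiableAt ℝ (fderiv ℝ g) (ρ (trunc (N + 1) p)) :=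
    (hg.fderiv_right (m := ∞) (by simp)).differentiable (by simp) _
  have H := (hd.hasFDerivAt.comp (trunc (N + 1) p) ρ.hasFDerivAt).clm_apply
    (τ.hasFDerivAt.const_add c)
  have hcτ : c + τ (trunc (N + 1) p) = trunc N (1, fun k => p.2 (k + 1)) := by
    refine Prod.ext ?_ ?_
    · simp [c, τ, trunc]
    · funext i
      simp [c, τ, trunc]
  have hfd : fderiv ℝ (fun q => fderiv ℝ g (ρ q) (c + τ q)) (trunc (N + 1) p) = _ := H.fderiv
  -- By the product rule one term differentiates dg and, by symmetry of second derivatives, is the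
  -- total derivative of the partial derivative. The other differentiates the velocity and is the
  -- commutator.
  rw [partialD_apply k e _ hF hrep, totalD_apply _ hg' (fun p => partialD_apply k e f hg h p),
    fderiv_fderiv_apply hg, fderiv_fderiv_symm hg, hfd, ← hcτ]
  exact add_comm _ _

theorem partialD_zero_totalD (e : Vec m ℂ) (f : jetAlg m) :
    (partialD 0 e).der ((totalD m).der f) = (totalD m).der ((partialD 0 e).der f) := by
  obtain ⟨N, g, hg, h⟩ := f.2
  refine Subtype.ext <| funext fun p => ?_
  rw [partialD_totalD_apply 0 e f hg h]
  have : (fun i : Fin N => (Pi.single 0 e : ℕ → Vec m ℂ) (i + 1)) = 0 := by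
    funext i; simp
  rw [this, Prod.mk_zero_zero, map_zero, add_zero]

theorem partialD_succ_totalD (k : ℕ) (e : Vec m ℂ) (f : jetAlg m) :
    (partialD (k + 1) e).der ((totalD m).der f)
      = (totalD m).der ((partialD (k + 1) e).der f) + (partialD k e).der f := by
  obtain ⟨N, g, hg, h⟩ := f.2
  refine Subtype.ext <| funext fun p => ?_
  rw [partialD_totalD_apply (k + 1) e f hg h]
  change _ = _ + ((partialD k e).der f).1 p
  rw [partialD_apply _ e f hg h]
  congr 2
  refine Prod.ext rfl ?_
  funext i
  simp [trunc, Pi.single_apply]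

theorem partialD_eq_zero (f : jetAlg m) : ∃ N, ∀ k ≥ N, ∀ e : Vec m ℂ, (partialD k e).der f = 0 := by
  obtain ⟨N, g, hg, h⟩ := f.2
  refine ⟨N, fun k hk e => Subtype.ext <| funext fun p => ?_⟩
  rw [partialD_apply _ e f hg h]
  have : trunc N ((0, Pi.single k e) : JetSpace m) = 0 := by
    refine Prod.ext rfl ?_
    funext i
    simp [trunc, Pi.single_apply, (i.2.trans_le hk).ne]
  rw [this, map_zero]
  rfl

/-- The Wirtinger derivatives `∂/∂u_{l,j}^{(k)}` (`b = false`) and `∂/∂ū_{l,j}^{(k)}`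
(`b = true`). -/
noncomputable def wirt (i : Fin 2 × Fin m × Bool) (k : ℕ) : Derivation ℂ (jetAlg m) (jetAlg m) :=
  (1 / 2 : ℂ) • ((partialD k (unitVec i.1 i.2.1 1)).der
    + (if i.2.2 then Complex.I else -Complex.I) • (partialD k (unitVec i.1 i.2.1 Complex.I)).der)

theorem wirt_apply (i : Fin 2 × Fin m × Bool) (k : ℕ) (f : jetAlg m) :
    wirt i k f = (1 / 2 : ℂ) • ((partialD k (unitVec i.1 i.2.1 1)).der f
    + (if i.2.2 then Complex.I else -Complex.I) • (partialD k (unitVec i.1 i.2.1 Complex.I)).der f) :=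
  rfl

theorem dU_eq (l : Fin 2) (j : Fin m) (k : ℕ) (f : jetAlg m) : dU l j k f = wirt (l, j, false) k f := by
  rw [wirt_apply, dU]
  simp [sub_eq_add_neg]

theorem dUbar_eq (l : Fin 2) (j : Fin m) (k : ℕ) (f : jetAlg m) :
    dUbar l j k f = wirt (l, j, true) k f := by
  rw [wirt_apply, dUbar]
  simp

theorem wirt_comm (i i' : Fin 2 × Fin m × Bool) (k k' : ℕ) (f : jetAlg m) :
    wirt i k (wirt i' k' f) = wirt i' k' (wirt i k f) := by
  simp only [wirt_apply, map_add, Derivation.map_smul, partialD_partialD k k', smul_add]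
  module

theorem wirt_zero_totalD (i : Fin 2 × Fin m × Bool) (f : jetAlg m) :
    wirt i 0 ((totalD m).der f) = (totalD m).der (wirt i 0 f) := by
  simp only [wirt_apply, map_add, Derivation.map_smul, partialD_zero_totalD]

theorem wirt_succ_totalD (i : Fin 2 × Fin m × Bool) (k : ℕ) (f : jetAlg m) :
    wirt i (k + 1) ((totalD m).der f) = (totalD m).der (wirt i (k + 1) f) + wirt i k f := by
  simp only [wirt_apply, map_add, Derivation.map_smul, partialD_succ_totalD]
  module

theorem star_wirt (l : Fin 2) (j : Fin m) (b : Bool) (k : ℕ) (f : jetAlg m) :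
    star (wirt (l, j, b) k f) = wirt (l, j, !b) k (star f) := by
  rw [wirt_apply, wirt_apply, RealDer.map_star, RealDer.map_star, star_smul, star_add, star_smul]
  cases b <;> simp

/-- `f` depends on derivatives of order less than `N` only. -/
def HasOrder (N : ℕ) (f : jetAlg m) : Prop := ∀ k ≥ N, ∀ i, wirt i k f = 0

theorem exists_hasOrder (f : jetAlg m) : ∃ N, HasOrder N f := by
  obtain ⟨N, h⟩ := partialD_eq_zero f
  exact ⟨N, fun k hk i => by simp [wirt_apply, h k hk]⟩

theorem HasOrder.mono {f : jetAlg m} {N M : ℕ} (h : HasOrder N f) (hNM : N ≤ M) : HasOrder M f :=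
  fun k hk => h k (hNM.trans hk)

theorem HasOrder.wirt {f : jetAlg m} {N : ℕ} (h : HasOrder N f) (i : Fin 2 × Fin m × Bool) (k : ℕ) :
    HasOrder N (wirt i k f) := fun k' hk' i' => by rw [wirt_comm, h k' hk', map_zero]

theorem HasOrder.totalD {f : jetAlg m} {N : ℕ} (h : HasOrder N f) :
    HasOrder (N + 1) ((totalD m).der f) := by
  intro k hk i
  obtain ⟨k, rfl⟩ : ∃ k', k = k' + 1 := ⟨k - 1, by omega⟩
  rw [wirt_succ_totalD, h _ (by omega), h _ (by omega), map_zero, add_zero]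

end JetCalculus

/-! ### Prolongation, variational derivatives and the symmetry of second variations. -/

section Prolongation

variable {m : ℕ} {A : Type} [CommRing A] [StarRing A] [Algebra ℂ A]

/-- The components of a vector field along `∂/∂u_{l,j}` and `∂/∂ū_{l,j}`. -/
def comp (h : Vec m A) (i : Fin 2 × Fin m × Bool) : A :=
  if i.2.2 then star (h i.1 i.2.1) else h i.1 i.2.1

theorem sum_index (F : Fin 2 × Fin m × Bool → A) :
    ∑ i, F i = ∑ l, ∑ j, (F (l, j, false) + F (l, j, true)) := by
  simp [Fintype.sum_prod_type, add_comm]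

theorem JetExtension.pr_eq (E : JetExtension m A) (h : Vec m A) {f : jetAlg m} {N : ℕ}
    (hf : HasOrder N f) :
    E.pr h f = ∑ k ∈ Finset.range N, ∑ i, E.incl (wirt i k f) * E.D.der^[k] (comp h i) := by
  rw [JetExtension.pr, finsum_eq_sum_of_support_subset (s := Finset.range N)]
  · refine Finset.sum_congr rfl fun k _ => ?_
    rw [sum_index]
    simp [dU_eq, dUbar_eq, comp]
  · intro k hk
    by_contra hk'
    simp only [Finset.coe_range, Set.mem_Iio, not_lt] at hk'
    refine hk ?_
    simp [dU_eq, dUbar_eq, hf k hk']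

theorem JetExtension.pr_add (E : JetExtension m A) (h : Vec m A) (f g : jetAlg m) :
    E.pr h (f + g) = E.pr h f + E.pr h g := by
  obtain ⟨N, hf⟩ := exists_hasOrder f
  obtain ⟨M, hg⟩ := exists_hasOrder g
  have hf' := hf.mono (le_max_left N M)
  have hg' := hg.mono (le_max_right N M)
  have hfg : HasOrder (max N M) (f + g) := fun k hk i => by
    rw [map_add, hf' k hk, hg' k hk, add_zero]
  rw [E.pr_eq h hf', E.pr_eq h hg', E.pr_eq h hfg, ← Finset.sum_add_distrib]
  refine Finset.sum_congr rfl fun k _ => ?_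
  rw [← Finset.sum_add_distrib]
  exact Finset.sum_congr rfl fun i _ => by rw [map_add, map_add, add_mul]

/-- The prolongation of a vector field as an additive map. -/
noncomputable def JetExtension.prHom (E : JetExtension m A) (h : Vec m A) : jetAlg m →+ A :=
  AddMonoidHom.mk' (E.pr h) (E.pr_add h)

theorem JetExtension.prHom_apply (E : JetExtension m A) (h : Vec m A) (f : jetAlg m) :
    E.prHom h f = E.pr h f := rfl

theorem RealDer.map_star_iterate (D : RealDer A) (k : ℕ) (a : A) :
    D.der^[k] (star a) = star (D.der^[k] a) := by
  induction k with
  | zero => rfl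
  | succ k ih => rw [Function.iterate_succ_apply', Function.iterate_succ_apply', ih, D.map_star]

theorem hasOrder_star {f : jetAlg m} {N : ℕ} (hf : HasOrder N f) : HasOrder N (star f) := by
  rintro k hk ⟨l, j, b⟩
  have := star_wirt l j (!b) k f
  rw [hf k hk, star_zero, Bool.not_not] at this
  exact this.symm

theorem JetExtension.star_pr (E : JetExtension m A) (h : Vec m A) (f : jetAlg m) :
    star (E.pr h f) = E.pr h (star f) := by
  obtain ⟨N, hf⟩ := exists_hasOrder f
  rw [E.pr_eq h hf, E.pr_eq h (hasOrder_star hf), star_sum]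
  refine Finset.sum_congr rfl fun k _ => ?_
  rw [sum_index, sum_index, star_sum]
  refine Finset.sum_congr rfl fun l _ => ?_
  rw [star_sum]
  refine Finset.sum_congr rfl fun j _ => ?_
  simp only [star_add, star_mul', ← map_star, star_wirt, ← E.D.map_star_iterate, comp]
  simp [add_comm]

/-- The extra term u^{(k)} in the commutator of ∂/∂u^{(k+1)} with D_x supplies exactly the part of
the Leibniz rule in which D falls on the derivatives of h. -/
theorem JetExtension.pr_totalD (E : JetExtension m A) (h : Vec m A) (f : jetAlg m) :
    E.pr h ((totalD m).der f) = E.D.der (E.pr h f) := by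
  obtain ⟨N, hf⟩ := exists_hasOrder f
  have h1 : E.pr h ((totalD m).der f)
      = ∑ k ∈ Finset.range (N + 1), ∑ i, E.D.der (E.incl (wirt i k f)) * E.D.der^[k] (comp h i)
        + ∑ k ∈ Finset.range N, ∑ i, E.incl (wirt i k f) * E.D.der^[k + 1] (comp h i) := by
    rw [E.pr_eq h hf.totalD, Finset.sum_range_succ', Finset.sum_range_succ', add_right_comm,
      ← Finset.sum_add_distrib]
    congr 1
    · refine Finset.sum_congr rfl fun k _ => ?_
      rw [← Finset.sum_add_distrib]
      exact Finset.sum_congr rfl fun i _ => by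
        rw [wirt_succ_totalD, map_add, E.incl_D, add_mul]
    · exact Finset.sum_congr rfl fun i _ => by rw [wirt_zero_totalD, E.incl_D]
  rw [h1, Finset.sum_range_succ, E.pr_eq h hf, map_sum]
  simp only [hf N le_rfl, map_zero, zero_mul, Finset.sum_const_zero, add_zero]
  rw [← Finset.sum_add_distrib]
  refine Finset.sum_congr rfl fun k _ => ?_
  rw [← Finset.sum_add_distrib, map_sum]
  refine Finset.sum_congr rfl fun i _ => ?_
  rw [Derivation.leibniz, Function.iterate_succ_apply', smul_eq_mul, smul_eq_mul]
  ring

theorem JetExtension.pr_totalD_iterate (E : JetExtension m A) (h : Vec m A) (k : ℕ) (f : jetAlg m) :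
    E.pr h ((totalD m).der^[k] f) = E.D.der^[k] (E.pr h f) := by
  induction k with
  | zero => rfl
  | succ k ih => rw [Function.iterate_succ_apply', Function.iterate_succ_apply', E.pr_totalD, ih]

/-- The variational derivatives of `∫ f dx` with respect to `u_{l,j}` and `ū_{l,j}`. -/
noncomputable def euler (N : ℕ) (i : Fin 2 × Fin m × Bool) (f : jetAlg m) : jetAlg m :=
  ∑ k ∈ Finset.range N, (-1) ^ k * (totalD m).der^[k] (wirt i k f)

theorem varDeriv_eq {f : jetAlg m} {N : ℕ} (hf : HasOrder N f) (l : Fin 2) (j : Fin m) :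
    varDeriv f l j = euler N (l, j, true) f := by
  rw [varDeriv, finsum_eq_sum_of_support_subset (s := Finset.range N)]
  · exact Finset.sum_congr rfl fun k _ => by rw [dUbar_eq]
  · intro k hk
    by_contra hk'
    simp only [Finset.coe_range, Set.mem_Iio, not_lt] at hk'
    refine hk ?_
    simp [dUbar_eq, hf k hk', iterate_map_zero]

theorem star_euler {f : jetAlg m} (hf : star f = f) (N : ℕ) (l : Fin 2) (j : Fin m) :
    star (euler N (l, j, true) f) = euler N (l, j, false) f := by
  rw [euler, euler, star_sum]
  refine Finset.sum_congr rfl fun k _ => ?_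
  rw [star_mul', ← RealDer.map_star_iterate, star_wirt, hf]
  simp

theorem JetExtension.pr_euler (E : JetExtension m A) (h : Vec m A) (N : ℕ)
    (i : Fin 2 × Fin m × Bool) (f : jetAlg m) :
    E.pr h (euler N i f) = ∑ k ∈ Finset.range N, (-1) ^ k * E.D.der^[k] (E.pr h (wirt i k f)) := by
  rw [← E.prHom_apply, euler, map_sum]
  refine Finset.sum_congr rfl fun k _ => ?_
  -- The prolongation is available here as an additive map only, so the sign (-1)^k is moved through
  -- it by parity.
  rcases Nat.even_or_odd k with hk | hk
  · have e : ∀ x : jetAlg m, (-1) ^ k * x = x := fun x => Subtype.ext <| funext fun p => by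
      change (-1 : ℂ) ^ k * x.1 p = x.1 p
      rw [hk.neg_one_pow, one_mul]
    rw [e, hk.neg_one_pow, one_mul, E.prHom_apply, E.pr_totalD_iterate]
  · have e : ∀ x : jetAlg m, (-1) ^ k * x = -x := fun x => Subtype.ext <| funext fun p => by
      change (-1 : ℂ) ^ k * x.1 p = -x.1 p
      rw [hk.neg_one_pow, neg_one_mul]
    rw [e, hk.neg_one_pow, neg_one_mul, map_neg, E.prHom_apply, E.pr_totalD_iterate]

/-- For real f the conjugate of the gradient in ū is the gradient in u, so the real pairing becomes
a sum over both families of variables on equal terms. -/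
theorem JetExtension.pair_pr_varDeriv (E : JetExtension m A) (h h' : Vec m A) {f : jetAlg m} {N : ℕ}
    (hf : HasOrder N f) (hr : star f = f) :
    pair (fun l a => E.pr h (varDeriv f l a)) h' = ∑ i, E.pr h (euler N i f) * comp h' i := by
  rw [sum_index, pair]
  refine Finset.sum_congr rfl fun l _ => ?_
  rw [innerA]
  refine Finset.sum_congr rfl fun j _ => ?_
  rw [E.star_pr, varDeriv_eq hf, star_euler hr]
  simp [comp]
  ring

/-- The second variation of `∫ f dx` is symmetric. -/
theorem JetExtension.second_variation_symm (E : JetExtension m A) (h h' : Vec m A) {f : jetAlg m}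
    {N : ℕ} (hf : HasOrder N f) :
    ∑ i, ∑ k ∈ Finset.range N, E.pr h (wirt i k f) * E.D.der^[k] (comp h' i)
      = ∑ i, ∑ k ∈ Finset.range N, E.pr h' (wirt i k f) * E.D.der^[k] (comp h i) := by
  have key : ∀ h h' : Vec m A,
      ∑ i, ∑ k ∈ Finset.range N, E.pr h (wirt i k f) * E.D.der^[k] (comp h' i)
      = ∑ i, ∑ k ∈ Finset.range N, ∑ i', ∑ k' ∈ Finset.range N, E.incl (wirt i' k' (wirt i k f))
        * E.D.der^[k'] (comp h i') * E.D.der^[k] (comp h' i) := by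
    intro h h'
    refine Finset.sum_congr rfl fun i _ => Finset.sum_congr rfl fun k _ => ?_
    rw [E.pr_eq h (hf.wirt i k), Finset.sum_comm, Finset.sum_mul]
    exact Finset.sum_congr rfl fun i' _ => Finset.sum_mul _ _ _
  rw [key h h', key h' h]
  have hs : ∀ T : Fin 2 × Fin m × Bool → ℕ → A, ∑ i, ∑ k ∈ Finset.range N, T i k
      = ∑ p ∈ Finset.univ ×ˢ Finset.range N, T p.1 p.2 := fun T => (Finset.sum_product' _ _ _).symm
  simp only [hs]
  -- After the exchange of the two index pairs the sums differ only by the order of two commuting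
  -- Wirtinger derivatives.
  rw [Finset.sum_comm]
  refine Finset.sum_congr rfl fun p _ => Finset.sum_congr rfl fun p' _ => ?_
  rw [wirt_comm]
  ring

/-- The linearisation of a variational derivative is formally self-adjoint. -/
theorem JetExtension.helmholtz (E : JetExtension m A) (h h' : Vec m A) {f : jetAlg m}
    (hr : star f = f) :
    IntegralZero E.D (pair (fun l a => E.pr h (varDeriv f l a)) h'
      - pair (fun l a => E.pr h' (varDeriv f l a)) h) := by
  obtain ⟨N, hf⟩ := exists_hasOrder f
  -- Integration by parts moves the powers of -D from the linearised gradient to h', leaving the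
  -- second variation, which is symmetric.
  have key : ∀ h h' : Vec m A, IntegralZero E.D (pair (fun l a => E.pr h (varDeriv f l a)) h'
      - ∑ i, ∑ k ∈ Finset.range N, E.pr h (wirt i k f) * E.D.der^[k] (comp h' i)) := by
    intro h h'
    rw [E.pair_pr_varDeriv h h' hf hr, ← Finset.sum_sub_distrib]
    refine IntegralZero.sum fun i _ => ?_
    rw [E.pr_euler, Finset.sum_mul, ← Finset.sum_sub_distrib]
    exact IntegralZero.sum fun k _ => integralZero_by_parts k _ _
  have := (key h h').sub (key h' h)
  rw [E.second_variation_symm h h' hf] at this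
  convert this using 1
  ring

end Prolongation

/-! ### The trace form and the invariant trilinear form. -/

section TraceForm

variable {A : Type} [CommRing A] [StarRing A] [Algebra ℂ A] {m : ℕ}

/-- The invariant alternating form `tr (X [Y, Z])`. -/
def triple (X Y Z : BigMat m A) : A := (X * ⁅Y, Z⁆).trace

theorem triple_eq (X Y Z : BigMat m A) :
    triple X Y Z = (X * Y * Z).trace - (X * Z * Y).trace := by
  rw [triple, Ring.lie_def, mul_sub, trace_sub, mul_assoc, mul_assoc]

theorem triple_cycle (X Y Z : BigMat m A) : triple X Y Z = triple Y Z X := by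
  rw [triple_eq, triple_eq, trace_mul_cycle Y Z X, trace_mul_cycle Y X Z, trace_mul_cycle Z Y X]

/-- By invariance of the trace e can be pulled out of each term; what multiplies it is the Jacobi
identity for a, b, c. -/
theorem triple_lie_lie (e a b c : BigMat m A) :
    (⁅e, a⁆ * ⁅b, c⁆).trace + (⁅e, b⁆ * ⁅c, a⁆).trace + (⁅e, c⁆ * ⁅a, b⁆).trace = 0 := by
  have h : ∀ x y : BigMat m A, (⁅e, x⁆ * y).trace = (e * ⁅x, y⁆).trace := fun x y => by
    rw [Ring.lie_def, Ring.lie_def, sub_mul, mul_sub, trace_sub, trace_sub, mul_assoc,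
      trace_mul_cycle x e y, trace_mul_comm _ e]
  rw [h, h, h, ← trace_add, ← trace_add, ← mul_add, ← mul_add]
  have : ⁅a, ⁅b, c⁆⁆ + ⁅b, ⁅c, a⁆⁆ + ⁅c, ⁅a, b⁆⁆ = 0 := by
    simp only [Ring.lie_def]
    noncomm_ring
  rw [this, mul_zero, trace_zero]

theorem trace_lie_mul (X Y Z : BigMat m A) : (⁅X, Y⁆ * Z).trace = (X * ⁅Y, Z⁆).trace := by
  change _ = triple X Y Z
  rw [triple_cycle, triple_cycle, triple, trace_mul_comm]

theorem der_trace (D : RealDer A) (M : BigMat m A) : D.der M.trace = (M.map D.der).trace := by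
  simp [Matrix.trace]

/-- The commutator parts cancel by invariance of the trace, so D may be replaced by ∇. This is the
integration by parts behind all the bracket computations. -/
theorem der_trace_mul (D : RealDer A) (u : Vec m A) (X Y : BigMat m A) :
    D.der (X * Y).trace = (nabla D u X * Y).trace + (X * nabla D u Y).trace := by
  rw [der_trace, mul_map_der, nabla, nabla, add_mul, mul_add, trace_add, trace_add, trace_add]
  have h : (⁅hPerp u, X⁆ * Y).trace = -(X * ⁅hPerp u, Y⁆).trace := by
    rw [← trace_lie_mul, ← trace_neg, ← neg_mul, Ring.lie_def, Ring.lie_def, neg_sub]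
  rw [h]
  ring

theorem nabla_lie (D : RealDer A) (u : Vec m A) (X Y : BigMat m A) :
    nabla D u ⁅X, Y⁆ = ⁅nabla D u X, Y⁆ + ⁅X, nabla D u Y⁆ := by
  have : (⁅X, Y⁆).map D.der = ⁅X.map D.der, Y⁆ + ⁅X, Y.map D.der⁆ := by
    have hs : ∀ M N : BigMat m A, (M - N).map D.der = M.map D.der - N.map D.der := fun M N => by
      ext; simp
    simp only [Ring.lie_def, hs, mul_map_der]
    noncomm_ring
  rw [nabla, nabla, nabla, this]
  simp only [Ring.lie_def]
  noncomm_ring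

theorem der_triple (D : RealDer A) (u : Vec m A) (X Y Z : BigMat m A) :
    D.der (triple X Y Z) = triple (nabla D u X) Y Z + triple X (nabla D u Y) Z
      + triple X Y (nabla D u Z) := by
  rw [triple, der_trace_mul D u, nabla_lie, mul_add, trace_add, add_assoc]
  rfl

theorem triple_linear (X P Q Z : BigMat m A) (a b : A) :
    triple X (a • P + b • Q) Z = a * triple X P Z + b * triple X Q Z := by
  simp only [triple_eq, mul_add, add_mul, trace_add, mul_smul_comm, smul_mul_assoc, trace_smul,
    smul_eq_mul]
  ring

theorem pair_eq (x y : Vec m A) : pair x y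
    = x 0 ⬝ᵥ star (y 0) + y 0 ⬝ᵥ star (x 0) + (x 1 ⬝ᵥ star (y 1) + y 1 ⬝ᵥ star (x 1)) := by
  simp [pair, Fin.sum_univ_two, innerA_eq]

theorem pair_comm (x y : Vec m A) : pair x y = pair y x := by
  rw [pair_eq, pair_eq]; ring

theorem pair_add (x y z : Vec m A) : pair x (y + z) = pair x y + pair x z := by
  simp [pair_eq]; ring

theorem hMat_trace (X Y : Matrix (Idx m) (Idx m) A) : (hMat X Y).trace = X.trace + (conjM X).trace :=
  trace_fromBlocks' _ _ _ _

theorem blk_trace (c : A) (v w : Fin m → A) (X : Matrix (Fin m) (Fin m) A) :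
    (blk c v w X).trace = c + X.trace := by
  rw [blk, trace_fromBlocks']
  simp [Matrix.trace]

theorem trace_hPerp_mul_hPerp (x y : Vec m A) :
    (hPerp x * hPerp y).trace = -(pair x y + pair x y) := by
  rw [hPerp_eq, hPerp_eq, hMat_mul, hMat_trace]
  simp only [conjM_blk, blk_mul, blk_sub, blk_trace, pair_eq]
  simp [conjM_vecMulVec, conjM_sub, conjM_neg, neg_vecMulVec, trace_vecMulVec, star_dotProduct_star',
    dotProduct_comm]
  ring

theorem trace_hPar_mul_hPerp (c d : A) (X Y : Matrix (Fin m) (Fin m) A) (x : Vec m A) :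
    (hPar c d X Y * hPerp x).trace = 0 := by
  rw [hPar_eq, hPerp_eq, hMat_mul, hMat_trace]
  simp [conjM_blk, blk_mul, blk_sub, blk_trace]

end TraceForm

/-! ### Lifts of operator values and of their variations over the dual numbers. -/

section Lifts

variable {A : Type} [CommRing A] [StarRing A] [Algebra ℂ A] [StarModule ℂ A] {m : ℕ}

/-- The constant element whose adjoint action is multiplication by `i`. -/
noncomputable def unitElt (m : ℕ) (A : Type) [CommRing A] [StarRing A] [Algebra ℂ A] : BigMat m A :=
  constElt m A (1 / ((m : ℝ) + 1))

theorem pair_smul (c : ℝ) (x y : Vec m A) : pair x ((c : ℂ) • y) = cst A c * pair x y := by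
  simp only [pair, innerA, Finset.mul_sum]
  refine Finset.sum_congr rfl fun l _ => Finset.sum_congr rfl fun j _ => ?_
  simp [cst, Algebra.smul_def, star_algebraMap]
  ring

theorem hPerp_smul (c : ℝ) (x : Vec m A) : hPerp ((c : ℂ) • x) = cst A c • hPerp x := by
  ext ((i | i) | (i | i)) ((j | j) | (j | j)) <;>
    simp [hPerp, hMat, cst, Algebra.smul_def, star_algebraMap]

theorem lie_hPerp_unitElt' (w : Vec m A) :
    ⁅hPerp w, unitElt m A⁆ = mPerp ((-(((1 : ℝ) : ℂ) * Complex.I)) • w) := lie_hPerp_unitElt w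

theorem lie_unitElt_mPerp (y : Vec m A) :
    ⁅unitElt m A, mPerp ((-(((1 : ℝ) : ℂ) * Complex.I)) • y)⁆ = hPerp y := by
  rw [unitElt, lie_constElt_mPerp, one_div_mul_cancel (by positivity), smul_smul]
  simp

theorem fst_dual_map {k : Type} (D : RealDer A) (M : Matrix k k (DualNumber A)) :
    (M.map D.dual.der).map TrivSqZeroExt.fst = (M.map TrivSqZeroExt.fst).map D.der := rfl

theorem snd_dual_map {k : Type} (D : RealDer A) (M : Matrix k k (DualNumber A)) :
    (M.map D.dual.der).map TrivSqZeroExt.snd = (M.map TrivSqZeroExt.snd).map D.der := rfl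

theorem fst_mul_map {k : Type} [Fintype k] (M N : Matrix k k (DualNumber A)) :
    (M * N).map TrivSqZeroExt.fst = M.map TrivSqZeroExt.fst * N.map TrivSqZeroExt.fst := by
  ext i j
  simp [Matrix.mul_apply, TrivSqZeroExt.fst_sum]

theorem snd_mul_map {k : Type} [Fintype k] (M N : Matrix k k (DualNumber A)) :
    (M * N).map TrivSqZeroExt.snd = M.map TrivSqZeroExt.fst * N.map TrivSqZeroExt.snd
      + M.map TrivSqZeroExt.snd * N.map TrivSqZeroExt.fst := by
  ext i j
  simp [Matrix.mul_apply, TrivSqZeroExt.snd_sum, Finset.sum_add_distrib, mul_comm]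

theorem fst_hPar (c d : DualNumber A) (X Y : Matrix (Fin m) (Fin m) (DualNumber A)) :
    (hPar c d X Y).map TrivSqZeroExt.fst
      = hPar c.fst d.fst (X.map TrivSqZeroExt.fst) (Y.map TrivSqZeroExt.fst) := by
  ext ((i | i) | (i | i)) ((j | j) | (j | j)) <;> simp [hPar, hMat] <;> rfl

theorem snd_hPar (c d : DualNumber A) (X Y : Matrix (Fin m) (Fin m) (DualNumber A)) :
    (hPar c d X Y).map TrivSqZeroExt.snd
      = hPar c.snd d.snd (X.map TrivSqZeroExt.snd) (Y.map TrivSqZeroExt.snd) := by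
  ext ((i | i) | (i | i)) ((j | j) | (j | j)) <;> simp [hPar, hMat] <;> rfl

theorem fst_mPar (X Y : Matrix (Fin m) (Fin m) (DualNumber A)) :
    (mPar X Y).map TrivSqZeroExt.fst
      = mPar (X.map TrivSqZeroExt.fst) (Y.map TrivSqZeroExt.fst) := by
  ext ((i | i) | (i | i)) ((j | j) | (j | j)) <;>
    simp [mPar, mMat, Matrix.trace, TrivSqZeroExt.fst_sum] <;> rfl

theorem snd_mPar (X Y : Matrix (Fin m) (Fin m) (DualNumber A)) :
    (mPar X Y).map TrivSqZeroExt.snd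
      = mPar (X.map TrivSqZeroExt.snd) (Y.map TrivSqZeroExt.snd) := by
  ext ((i | i) | (i | i)) ((j | j) | (j | j)) <;>
    simp [mPar, mMat, Matrix.trace, TrivSqZeroExt.snd_sum] <;> rfl

theorem fst_hPerp (v w : Vec m A) : (hPerp (dualVec v w)).map TrivSqZeroExt.fst = hPerp v := by
  ext ((i | i) | (i | i)) ((j | j) | (j | j)) <;> simp [hPerp, hMat, dualVec] <;>
    first | rfl | exact star_star _

theorem snd_hPerp (v w : Vec m A) : (hPerp (dualVec v w)).map TrivSqZeroExt.snd = hPerp w := by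
  ext ((i | i) | (i | i)) ((j | j) | (j | j)) <;> simp [hPerp, hMat, dualVec] <;>
    first | rfl | exact star_star _

theorem fst_mPerp (v w : Vec m A) : (mPerp (dualVec v w)).map TrivSqZeroExt.fst = mPerp v := by
  ext ((i | i) | (i | i)) ((j | j) | (j | j)) <;> simp [mPerp, mMat, dualVec] <;>
    first | rfl | exact star_star _ | exact star_neg _

theorem snd_mPerp (v w : Vec m A) : (mPerp (dualVec v w)).map TrivSqZeroExt.snd = mPerp w := by
  ext ((i | i) | (i | i)) ((j | j) | (j | j)) <;> simp [mPerp, mMat, dualVec] <;>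
    first | rfl | exact star_star _ | exact star_neg _

end Lifts

section Lifts

variable {A : Type} [CommRing A] [StarRing A] [Algebra ℂ A] [StarModule ℂ A] {m : ℕ}

/-- `W ∈ 𝔥` has the `𝔥_⊥`-part `w`. -/
structure HasPerp (w : Vec m A) (W : BigMat m A) : Prop where
  trace_mul : ∀ x, (W * hPerp x).trace = -(pair w x + pair w x)
  lie : ⁅W, unitElt m A⁆ = ⁅hPerp w, unitElt m A⁆

/-- The parallel part is invisible to both tests: it is trace-orthogonal to 𝔥_⊥ and centralises the
constant element. -/
theorem hasPerp_hPar_add (c d : A) (X Y : Matrix (Fin m) (Fin m) A) (w : Vec m A) :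
    HasPerp w (hPar c d X Y + hPerp w) where
  trace_mul x := by
    rw [add_mul, trace_add, trace_hPar_mul_hPerp, trace_hPerp_mul_hPerp, zero_add]
  lie := by
    rw [add_lie_mat, unitElt, lie_hPar_constElt, zero_add]

theorem lie_unitElt_m (X Y : Matrix (Fin m) (Fin m) A) (h : Vec m A) :
    ⁅unitElt m A, mPar X Y + mPerp ((-(((1 : ℝ) : ℂ) * Complex.I)) • h)⁆ = hPerp h := by
  rw [lie_add_mat, lie_unitElt_mPerp, unitElt, lie_constElt_mPar, zero_add]

theorem opH_lift {D : RealDer A} {u w v : Vec m A} (h : opH m A D u w v) :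
    ∃ W, HasPerp w W ∧ nabla D u W = hPerp v := by
  obtain ⟨p, q, P, Q, -, h⟩ := (opH_iff D u w v).1 h
  exact ⟨_, hasPerp_hPar_add p q P Q w, h⟩

theorem opJ_lift {D : RealDer A} {u h v : Vec m A} (hJ : opJ m A D u h v) :
    ∃ Y, ⁅unitElt m A, Y⁆ = hPerp h ∧ nabla D u Y = ⁅hPerp v, unitElt m A⁆ := by
  obtain ⟨X, Y, -, hJ⟩ := (opJ_iff D one_ne_zero u h v).1 hJ
  exact ⟨_, lie_unitElt_m X Y h, by rw [hJ, lie_hPerp_unitElt']⟩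

theorem fst_add_map {k : Type} (M N : Matrix k k (DualNumber A)) :
    (M + N).map TrivSqZeroExt.fst = M.map TrivSqZeroExt.fst + N.map TrivSqZeroExt.fst := by
  ext i j
  exact TrivSqZeroExt.fst_add _ _

theorem snd_add_map {k : Type} (M N : Matrix k k (DualNumber A)) :
    (M + N).map TrivSqZeroExt.snd = M.map TrivSqZeroExt.snd + N.map TrivSqZeroExt.snd := by
  ext i j
  exact TrivSqZeroExt.snd_add _ _

theorem fst_sub_map {k : Type} (M N : Matrix k k (DualNumber A)) :
    (M - N).map TrivSqZeroExt.fst = M.map TrivSqZeroExt.fst - N.map TrivSqZeroExt.fst := by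
  ext i j
  exact TrivSqZeroExt.fst_sub _ _

theorem snd_sub_map {k : Type} (M N : Matrix k k (DualNumber A)) :
    (M - N).map TrivSqZeroExt.snd = M.map TrivSqZeroExt.snd - N.map TrivSqZeroExt.snd := by
  ext i j
  exact TrivSqZeroExt.snd_sub _ _

theorem fst_nabla (D : RealDer A) (u k : Vec m A) (M : BigMat m (DualNumber A)) :
    (nabla D.dual (dualVec u k) M).map TrivSqZeroExt.fst = nabla D u (M.map TrivSqZeroExt.fst) := by
  rw [nabla, nabla, fst_add_map, fst_dual_map, Ring.lie_def, Ring.lie_def, fst_sub_map, fst_mul_map,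
    fst_mul_map, fst_hPerp]

/-- The commutator with hPerp k is the derivative of the connection in the direction k; through it
variations of the operators produce trilinear terms. -/
theorem snd_nabla (D : RealDer A) (u k : Vec m A) (M : BigMat m (DualNumber A)) :
    (nabla D.dual (dualVec u k) M).map TrivSqZeroExt.snd
      = nabla D u (M.map TrivSqZeroExt.snd) + ⁅hPerp k, M.map TrivSqZeroExt.fst⁆ := by
  rw [nabla, nabla, snd_add_map, snd_dual_map, Ring.lie_def, Ring.lie_def, Ring.lie_def, snd_sub_map,
    snd_mul_map, snd_mul_map, fst_hPerp, snd_hPerp]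
  abel

theorem opH_lift_dual {D : RealDer A} {u k w dw v dv : Vec m A}
    (h : opH m (DualNumber A) D.dual (dualVec u k) (dualVec w dw) (dualVec v dv)) :
    ∃ W W', HasPerp w W ∧ nabla D u W = hPerp v ∧ HasPerp dw W' ∧
      nabla D u W' + ⁅hPerp k, W⁆ = hPerp dv := by
  obtain ⟨p, q, P, Q, -, h⟩ := (opH_iff _ _ _ _).1 h
  have h0 := congrArg (fun M : BigMat m (DualNumber A) => M.map TrivSqZeroExt.fst) h
  have h1 := congrArg (fun M : BigMat m (DualNumber A) => M.map TrivSqZeroExt.snd) h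
  have e0 : (hPar p q P Q + hPerp (dualVec w dw)).map TrivSqZeroExt.fst = hPar p.fst q.fst
      (P.map TrivSqZeroExt.fst) (Q.map TrivSqZeroExt.fst) + hPerp w := by
    rw [fst_add_map, fst_hPar, fst_hPerp]
  have e1 : (hPar p q P Q + hPerp (dualVec w dw)).map TrivSqZeroExt.snd = hPar p.snd q.snd
      (P.map TrivSqZeroExt.snd) (Q.map TrivSqZeroExt.snd) + hPerp dw := by
    rw [snd_add_map, snd_hPar, snd_hPerp]
  simp only [fst_nabla, snd_nabla, fst_hPerp, snd_hPerp, e0, e1] at h0 h1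
  exact ⟨_, _, hasPerp_hPar_add _ _ _ _ w, h0, hasPerp_hPar_add _ _ _ _ dw, h1⟩

theorem smul_dualVec (z : ℂ) (a b : Vec m A) : z • dualVec a b = dualVec (z • a) (z • b) := by
  funext l j
  rfl

/-- The scale s = 1 is chosen, so that the factors of i are absorbed into commutators with
`unitElt`. The ε-part is the linearised lift equation. -/
theorem opJ_lift_dual {D : RealDer A} {u k h dh v dv : Vec m A}
    (hJ : opJ m (DualNumber A) D.dual (dualVec u k) (dualVec h dh) (dualVec v dv)) :
    ∃ Y Y', ⁅unitElt m A, Y⁆ = hPerp h ∧ nabla D u Y = ⁅hPerp v, unitElt m A⁆ ∧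
      ⁅unitElt m A, Y'⁆ = hPerp dh ∧ nabla D u Y' + ⁅hPerp k, Y⁆ = ⁅hPerp dv, unitElt m A⁆ := by
  obtain ⟨P, Q, -, hJ⟩ := (opJ_iff _ one_ne_zero _ _ _).1 hJ
  rw [smul_dualVec, smul_dualVec] at hJ
  have h0 := congrArg (fun M : BigMat m (DualNumber A) => M.map TrivSqZeroExt.fst) hJ
  have h1 := congrArg (fun M : BigMat m (DualNumber A) => M.map TrivSqZeroExt.snd) hJ
  have e0 : ∀ a b : Vec m A, (mPar P Q + mPerp (dualVec a b)).map TrivSqZeroExt.fst = mPar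
      (P.map TrivSqZeroExt.fst) (Q.map TrivSqZeroExt.fst) + mPerp a := fun a b => by
    rw [fst_add_map, fst_mPar, fst_mPerp]
  have e1 : ∀ a b : Vec m A, (mPar P Q + mPerp (dualVec a b)).map TrivSqZeroExt.snd = mPar
      (P.map TrivSqZeroExt.snd) (Q.map TrivSqZeroExt.snd) + mPerp b := fun a b => by
    rw [snd_add_map, snd_mPar, snd_mPerp]
  simp only [fst_nabla, snd_nabla, fst_mPerp, snd_mPerp, e0, e1] at h0 h1
  exact ⟨mPar (P.map TrivSqZeroExt.fst) (Q.map TrivSqZeroExt.fst)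
      + mPerp ((-(((1 : ℝ) : ℂ) * Complex.I)) • h),
    mPar (P.map TrivSqZeroExt.snd) (Q.map TrivSqZeroExt.snd)
      + mPerp ((-(((1 : ℝ) : ℂ) * Complex.I)) • dh),
    lie_unitElt_m _ _ h, h0.trans (lie_hPerp_unitElt' v).symm,
    lie_unitElt_m _ _ dh, h1.trans (lie_hPerp_unitElt' dv).symm⟩

end Lifts

/-! ### Skew-symmetry, variations and the cyclic identities. -/

section Brackets

variable {A : Type} [CommRing A] [StarRing A] [Algebra ℂ A] [StarModule ℂ A] {m : ℕ}
  {D : RealDer A} {u : Vec m A}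

theorem integralZero_of_double {a : A} (h : IntegralZero D (a + a)) : IntegralZero D a := by
  have := h.smul (2⁻¹ : ℂ)
  rwa [← two_smul ℂ a, inv_smul_smul₀ two_ne_zero] at this

/-- Integration by parts in D tr(Wi Wj'): the equation for ∇Wj' gives the pairing with dv and leaves
tr(Wi [k, Wj]). The factors 2 come from the trace form being -2 times the pairing. -/
theorem pair_variation_H {wi vi k dwj dv : Vec m A} {Wi Wj Wj' : BigMat m A}
    (hWi : HasPerp wi Wi) (ei : nabla D u Wi = hPerp vi)
    (hWj' : HasPerp dwj Wj') (ej : nabla D u Wj' + ⁅hPerp k, Wj⁆ = hPerp dv) :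
    IntegralZero D (pair wi dv + pair wi dv + (pair dwj vi + pair dwj vi)
      + triple Wi (hPerp k) Wj) := by
  have h1 := hWi.trace_mul dv
  have h2 := hWj'.trace_mul vi
  have h3 := der_trace_mul D u Wi Wj'
  rw [← ej, mul_add, trace_add] at h1
  rw [ei, trace_mul_comm (hPerp vi), h2] at h3
  refine ⟨-(Wi * Wj').trace, ?_⟩
  rw [map_neg, h3]
  change _ + triple Wi (hPerp k) Wj = _ at h1
  linear_combination h1

theorem pair_variation_J {hi vi k dhj dvj : Vec m A} {Yi Yj Yj' : BigMat m A}
    (hYi : ⁅unitElt m A, Yi⁆ = hPerp hi) (ei : nabla D u Yi = ⁅hPerp vi, unitElt m A⁆)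
    (hYj' : ⁅unitElt m A, Yj'⁆ = hPerp dhj)
    (ej : nabla D u Yj' + ⁅hPerp k, Yj⁆ = ⁅hPerp dvj, unitElt m A⁆) :
    IntegralZero D (pair vi dhj + pair vi dhj + (pair hi dvj + pair hi dvj)
      + triple Yi (hPerp k) Yj) := by
  have h1 : (Yi * ⁅hPerp dvj, unitElt m A⁆).trace = -(pair hi dvj + pair hi dvj) := by
    rw [← trace_hPerp_mul_hPerp, ← hYi, trace_lie_mul, trace_mul_comm, trace_lie_mul,
      trace_mul_comm, trace_lie_mul]
  have h2 : (nabla D u Yi * Yj').trace = -(pair vi dhj + pair vi dhj) := by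
    rw [ei, trace_lie_mul, hYj', trace_hPerp_mul_hPerp]
  have h3 := der_trace_mul D u Yi Yj'
  rw [← ej, mul_add, trace_add] at h1
  rw [h2] at h3
  refine ⟨-(Yi * Yj').trace, ?_⟩
  rw [map_neg, h3]
  change _ + triple Yi (hPerp k) Yj = _ at h1
  linear_combination h1

/-- Twice the density is minus the derivative of tr(W W') for lifts W and W', in which ∇W and ∇W'
have only perpendicular parts. -/
theorem opH_skew {w w' v v' : Vec m A} (h : opH m A D u w v) (h' : opH m A D u w' v') :
    IntegralZero D (pair w v' + pair w' v) := by
  obtain ⟨W, hW, e⟩ := opH_lift h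
  obtain ⟨W', hW', e'⟩ := opH_lift h'
  have h3 := der_trace_mul D u W W'
  rw [e, e', trace_mul_comm (hPerp v), hW.trace_mul, hW'.trace_mul] at h3
  refine integralZero_of_double ⟨-(W * W').trace, ?_⟩
  rw [map_neg, h3]
  ring

theorem opJ_skew {h h' v v' : Vec m A} (hJ : opJ m A D u h v) (hJ' : opJ m A D u h' v') :
    IntegralZero D (pair h v' + pair h' v) := by
  obtain ⟨Y, hY, e⟩ := opJ_lift hJ
  obtain ⟨Y', hY', e'⟩ := opJ_lift hJ'
  have h3 := der_trace_mul D u Y Y'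
  rw [e, e', trace_lie_mul, hY', trace_mul_comm Y ⁅_, _⁆, trace_lie_mul, hY, trace_hPerp_mul_hPerp,
    trace_hPerp_mul_hPerp] at h3
  refine integralZero_of_double ⟨-(Y * Y').trace, ?_⟩
  rw [map_neg, h3, pair_comm h, pair_comm h']
  ring

/-- Up to cyclic permutations of the trace, this is the Leibniz rule for ∇ on the invariant
trilinear form. -/
theorem cyclic_sum_H (D : RealDer A) (u : Vec m A) (W0 W1 W2 : BigMat m A) :
    IntegralZero D (triple W0 (nabla D u W2) W1 + triple W1 (nabla D u W0) W2
      + triple W2 (nabla D u W1) W0) := by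
  refine ⟨triple W0 W2 W1, ?_⟩
  rw [der_triple D u]
  linear_combination triple_cycle W1 (nabla D u W0) W2 + triple_cycle W2 (nabla D u W1) W0
    + triple_cycle (nabla D u W1) W0 W2

theorem triple_lie_mid (e a b c : BigMat m A) :
    triple a ⁅e, b⁆ c = (⁅e, b⁆ * ⁅c, a⁆).trace := by
  rw [triple_cycle, triple]

theorem cyclic_sum_J (e Y0 Y1 Y2 : BigMat m A) :
    triple Y0 ⁅e, Y2⁆ Y1 + triple Y1 ⁅e, Y0⁆ Y2 + triple Y2 ⁅e, Y1⁆ Y0 = 0 := by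
  simp only [triple_lie_mid]
  linear_combination triple_lie_lie e Y2 Y1 Y0

/-- Differentiating the terms tr(Y[W,Y]) gives the three terms with ∇W and six with ∇Y = [W,e].
These six and the three terms with [e,Y] differ by three instances of the Jacobi identity in the
form `triple_lie_lie`. -/
theorem cyclic_sum_mixed (D : RealDer A) (u : Vec m A) (e W0 W1 W2 Y0 Y1 Y2 : BigMat m A)
    (h0 : nabla D u Y0 = ⁅W0, e⁆) (h1 : nabla D u Y1 = ⁅W1, e⁆) (h2 : nabla D u Y2 = ⁅W2, e⁆) :
    IntegralZero D (triple W0 ⁅e, Y2⁆ W1 + triple W1 ⁅e, Y0⁆ W2 + triple W2 ⁅e, Y1⁆ W0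
      + (triple Y0 (nabla D u W2) Y1 + triple Y1 (nabla D u W0) Y2
      + triple Y2 (nabla D u W1) Y0)) := by
  have key : ∀ a b c : BigMat m A, triple ⁅b, e⁆ a c = -(⁅e, b⁆ * ⁅a, c⁆).trace := fun a b c => by
    rw [triple, ← trace_neg, ← neg_mul, Ring.lie_def b, Ring.lie_def e, neg_sub]
  have key' : ∀ a b c : BigMat m A, triple a c ⁅b, e⁆ = -(⁅e, b⁆ * ⁅a, c⁆).trace := fun a b c => by
    rw [← key, triple_cycle ⁅b, e⁆]
  refine ⟨triple Y0 W2 Y1 + triple Y1 W0 Y2 + triple Y2 W1 Y0, ?_⟩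
  rw [map_add, map_add, der_triple D u, der_triple D u, der_triple D u, h0, h1, h2]
  simp only [key, key', triple_lie_mid]
  linear_combination triple_lie_lie e Y0 W2 W1 + triple_lie_lie e Y1 W0 W2
    + triple_lie_lie e Y2 W1 W0

end Brackets

/-! ### The Hamiltonian, symplectic and compatibility properties. -/

section Jacobi

variable {A : Type} [CommRing A] [StarRing A] [Algebra ℂ A] [StarModule ℂ A] {m : ℕ}

theorem IntegralZero.cst_mul {D : RealDer A} {a : A} (c : ℂ) (h : IntegralZero D a) :
    IntegralZero D (cst A c * a) := by
  rw [cst, ← Algebra.smul_def]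
  exact h.smul c

/-- Symmetry of the second variation exchanges the two vector fields in the terms that differentiate
a gradient. The cyclic sum of brackets then regroups into the pairs that the variation identities
evaluate. -/
theorem jacobi_of_variation (E : JetExtension m A) {f : Fin 3 → jetAlg m}
    (hf : ∀ i, star (f i) = f i) (v : Fin 3 → Vec m A) (dv : Fin 3 → Fin 3 → Vec m A)
    (T : Fin 3 → Fin 3 → Fin 3 → A)
    (hT : ∀ i j k, (i, j, k) ∈ ({(0, 1, 2), (1, 2, 0), (2, 0, 1)} : Set (Fin 3 × Fin 3 × Fin 3)) →
      IntegralZero E.D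
      (pair (E.vec (varDeriv (f i))) (dv k j) + pair (E.vec (varDeriv (f i))) (dv k j)
        + (pair (fun l a => E.pr (v k) (varDeriv (f j) l a)) (v i)
          + pair (fun l a => E.pr (v k) (varDeriv (f j) l a)) (v i)) + T i j k))
    (hs : IntegralZero E.D (T 0 1 2 + T 1 2 0 + T 2 0 1)) :
    let bracket : Fin 3 → Fin 3 → Fin 3 → A := fun i j k =>
        pair (fun l a => E.pr (v k) (varDeriv (f i) l a)) (v j)
          + pair (E.vec (varDeriv (f i))) (dv k j)
    IntegralZero E.D (bracket 0 1 2 + bracket 1 2 0 + bracket 2 0 1) := by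
  intro bracket
  have hh : IntegralZero E.D _ := ((E.helmholtz (v 2) (v 1) (hf 0)).add
    (E.helmholtz (v 0) (v 2) (hf 1))).add (E.helmholtz (v 1) (v 0) (hf 2))
  have ht := (((hT 0 1 2 (by simp)).add (hT 1 2 0 (by simp))).add (hT 2 0 1 (by simp))).sub hs
  refine integralZero_of_double ?_
  convert (hh.add hh).add ht using 1
  simp only [bracket]
  ring

theorem isHamiltonian_opH (m : ℕ) : IsHamiltonian (opH m) := by
  intro A _ _ _ _ E f hf v hv
  refine ⟨fun i j => opH_skew (hv i) (hv j), fun dv hdv => ?_⟩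
  -- For the cyclic triples (i, j, k) the variation of the lift with index j is needed only in the
  -- direction v k, so three dual lifts suffice. Their ε-free parts fix one lift per functional,
  -- with the same constants of integration wherever it occurs.
  obtain ⟨W0, W0', a0, b0, c0, d0⟩ := opH_lift_dual (hdv 1 0)
  obtain ⟨W1, W1', a1, b1, c1, d1⟩ := opH_lift_dual (hdv 2 1)
  obtain ⟨W2, W2', a2, b2, c2, d2⟩ := opH_lift_dual (hdv 0 2)
  let W : Fin 3 → BigMat m A := ![W0, W1, W2]
  refine jacobi_of_variation E hf v dv (fun i j k => triple (W i) (hPerp (v k)) (W j)) ?_ ?_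
  · rintro i j k (h | h | h) <;> obtain ⟨rfl, rfl, rfl⟩ := h
    · exact pair_variation_H a0 b0 c1 d1
    · exact pair_variation_H a1 b1 c2 d2
    · exact pair_variation_H a2 b2 c0 d0
  · have := cyclic_sum_H E.D E.u W0 W1 W2
    rwa [b0, b1, b2] at this

theorem pair_zero (x : Vec m A) : pair x 0 = 0 := by
  simp [pair_eq]

theorem isSymplectic_opJ (m : ℕ) : IsSymplectic (opJ m) := by
  intro A _ _ _ _ E h v hv
  refine ⟨fun i j => opJ_skew (hv i) (hv j), fun dv hdv => ?_⟩
  obtain ⟨Y0, Y0', a0, b0, c0, d0⟩ := opJ_lift_dual (hdv 1 0)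
  obtain ⟨Y1, Y1', a1, b1, c1, d1⟩ := opJ_lift_dual (hdv 2 1)
  obtain ⟨Y2, Y2', a2, b2, c2, d2⟩ := opJ_lift_dual (hdv 0 2)
  have h01 := pair_variation_J a0 b0 c1 d1
  have h12 := pair_variation_J a1 b1 c2 d2
  have h20 := pair_variation_J a2 b2 c0 d0
  -- The field h k itself is [e, Y k], so the trilinear terms cancel identically and not merely
  -- modulo total derivatives.
  have hs := cyclic_sum_J (unitElt m A) Y0 Y1 Y2
  rw [a0, a1, a2] at hs
  refine integralZero_of_double ?_
  convert (h01.add h12).add h20 using 1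
  simp only [pair_zero]
  linear_combination -hs

theorem exists_dualVec (x : Vec m (DualNumber A)) : ∃ a b : Vec m A, x = dualVec a b :=
  ⟨fun l j => (x l j).fst, fun l j => (x l j).snd, rfl⟩

theorem dualVec_add (a b a' b' : Vec m A) :
    dualVec a b + dualVec a' b' = dualVec (a + a') (b + b') := by
  funext l j
  rfl

theorem dualVec_inj {a b a' b' : Vec m A} (h : dualVec a b = dualVec a' b') : a = a' ∧ b = b' :=
  ⟨funext fun l => funext fun j => congrArg TrivSqZeroExt.fst (congrFun (congrFun h l) j),
    funext fun l => funext fun j => congrArg TrivSqZeroExt.snd (congrFun (congrFun h l) j)⟩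

/-- Lifts, for `e = unitElt`, of a value `v = c₁ a + c₂ b` of `c₁ 𝓗 + c₂ 𝓙⁻¹` at `w` and of its
variation. -/
structure CombLift (D : RealDer A) (c₁ c₂ : ℝ) (u k w dw v dv : Vec m A) where
  (a a' b b' : Vec m A)
  (W W' Y Y' : BigMat m A)
  v_eq : v = (c₁ : ℂ) • a + (c₂ : ℂ) • b
  dv_eq : dv = (c₁ : ℂ) • a' + (c₂ : ℂ) • b'
  hW : HasPerp w W
  nabla_W : nabla D u W = hPerp a
  hW' : HasPerp dw W'
  nabla_W' : nabla D u W' + ⁅hPerp k, W⁆ = hPerp a'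
  lie_Y : ⁅unitElt m A, Y⁆ = hPerp b
  nabla_Y : nabla D u Y = ⁅hPerp w, unitElt m A⁆
  lie_Y' : ⁅unitElt m A, Y'⁆ = hPerp b'
  nabla_Y' : nabla D u Y' + ⁅hPerp k, Y⁆ = ⁅hPerp dw, unitElt m A⁆

theorem comb_lift_dual {D : RealDer A} {c₁ c₂ : ℝ} {u k w dw v dv : Vec m A}
    (h : NonlocalOp.comb c₁ c₂ (opH m) (opJ m).inv (DualNumber A) D.dual (dualVec u k)
      (dualVec w dw) (dualVec v dv)) : Nonempty (CombLift D c₁ c₂ u k w dw v dv) := by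
  obtain ⟨x, y, hx, hy, hv⟩ := h
  obtain ⟨a, a', rfl⟩ := exists_dualVec x
  obtain ⟨b, b', rfl⟩ := exists_dualVec y
  rw [smul_dualVec, smul_dualVec, dualVec_add] at hv
  obtain ⟨W, W', h1, h2, h3, h4⟩ := opH_lift_dual hx
  obtain ⟨Y, Y', h5, h6, h7, h8⟩ := opJ_lift_dual hy
  exact ⟨⟨a, a', b, b', W, W', Y, Y', (dualVec_inj hv).1, (dualVec_inj hv).2, h1, h2, h3, h4, h5, h6,
    h7, h8⟩⟩

theorem comb_skew {D : RealDer A} {c₁ c₂ : ℝ} {u w w' v v' : Vec m A}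
    (h : NonlocalOp.comb c₁ c₂ (opH m) (opJ m).inv A D u w v)
    (h' : NonlocalOp.comb c₁ c₂ (opH m) (opJ m).inv A D u w' v') :
    IntegralZero D (pair w v' + pair w' v) := by
  obtain ⟨a, b, ha, hb, rfl⟩ := h
  obtain ⟨a', b', ha', hb', rfl⟩ := h'
  convert ((opH_skew ha ha').cst_mul c₁).add ((opJ_skew hb hb').cst_mul c₂) using 1
  simp only [pair_add, pair_smul, pair_comm b, pair_comm b']
  ring

/-- Because 𝓙⁻¹ is used, the roles in `pair_variation_J` are exchanged: the covector w is the value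
of 𝓙, and b is its argument. -/
theorem CombLift.variation {D : RealDer A} {c₁ c₂ : ℝ} {u k k' wi dwi vi dvi wj dwj vj dvj : Vec m A}
    (Li : CombLift D c₁ c₂ u k' wi dwi vi dvi) (Lj : CombLift D c₁ c₂ u k wj dwj vj dvj) :
    IntegralZero D (pair wi dvj + pair wi dvj + (pair dwj vi + pair dwj vi)
      + (cst A c₁ * triple Li.W (hPerp k) Lj.W + cst A c₂ * triple Li.Y (hPerp k) Lj.Y)) := by
  convert ((pair_variation_H Li.hW Li.nabla_W Lj.hW' Lj.nabla_W').cst_mul c₁).add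
    ((pair_variation_J Li.lie_Y Li.nabla_Y Lj.lie_Y' Lj.nabla_Y').cst_mul c₂) using 1
  have hj := congrArg (pair wi) Lj.dv_eq
  have hi := congrArg (pair dwj) Li.v_eq
  simp only [pair_add, pair_smul] at hi hj
  rw [hi, hj, pair_comm Li.b]
  ring

theorem CombLift.hPerp_eq {D : RealDer A} {c₁ c₂ : ℝ} {u k w dw v dv : Vec m A}
    (L : CombLift D c₁ c₂ u k w dw v dv) :
    hPerp v = cst A c₁ • nabla D u L.W + cst A c₂ • ⁅unitElt m A, L.Y⁆ := by
  rw [L.nabla_W, L.lie_Y, ← hPerp_smul, ← hPerp_smul, hPerp_add, ← L.v_eq]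

theorem isCompatible_opH_opJ (m : ℕ) : IsCompatible (opH m) (opJ m) := by
  intro c₁ c₂ A _ _ _ _ E f hf v hv
  refine ⟨fun i j => comb_skew (hv i) (hv j), fun dv hdv => ?_⟩
  obtain ⟨L0⟩ := comb_lift_dual (hdv 1 0)
  obtain ⟨L1⟩ := comb_lift_dual (hdv 2 1)
  obtain ⟨L2⟩ := comb_lift_dual (hdv 0 2)
  let W : Fin 3 → BigMat m A := ![L0.W, L1.W, L2.W]
  let Y : Fin 3 → BigMat m A := ![L0.Y, L1.Y, L2.Y]
  refine jacobi_of_variation E hf v dv (fun i j k => cst A c₁ * triple (W i) (hPerp (v k)) (W j)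
    + cst A c₂ * triple (Y i) (hPerp (v k)) (Y j)) ?_ ?_
  · rintro i j k (h | h | h) <;> obtain ⟨rfl, rfl, rfl⟩ := h
    · exact L0.variation L1
    · exact L1.variation L2
    · exact L2.variation L0
  · have hH := (cyclic_sum_H E.D E.u L0.W L1.W L2.W).cst_mul c₁ |>.cst_mul c₁
    have hM := (cyclic_sum_mixed E.D E.u (unitElt m A) L0.W L1.W L2.W L0.Y L1.Y L2.Y
      (L0.nabla_Y.trans L0.hW.lie.symm) (L1.nabla_Y.trans L1.hW.lie.symm)
      (L2.nabla_Y.trans L2.hW.lie.symm)).cst_mul c₁ |>.cst_mul c₂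
    have hJ := cyclic_sum_J (unitElt m A) L0.Y L1.Y L2.Y
    convert hH.add hM using 1
    rw [L0.hPerp_eq, L1.hPerp_eq, L2.hPerp_eq]
    simp only [triple_linear, W, Y, Matrix.cons_val]
    linear_combination cst A c₂ * cst A c₂ * hJ

end Jacobi

end SymplecticFlow

theorem mainTheorem1 (n : ℕ) (hn : 2 ≤ n) :
    -- the structure equations hold for every framed flow, and amount to the operator form
    (∀ (U : TopologicalSpace.Opens (ℝ × ℝ))
        (g : SymplecticFlow.BigMat (n - 1) (SymplecticFlow.smoothFn U))
        (u : SymplecticFlow.Vec (n - 1) (SymplecticFlow.smoothFn U))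
        (F : SymplecticFlow.FrameData (n - 1) U),
        SymplecticFlow.IsParallelFraming g u F →
          SymplecticFlow.CartanEquations u F ∧
          SymplecticFlow.OperatorFlow u F.wPe (SymplecticFlow.hUp F.hPe)) ∧
    (∀ (U : TopologicalSpace.Opens (ℝ × ℝ))
        (u hPe wPe : SymplecticFlow.Vec (n - 1) (SymplecticFlow.smoothFn U)),
        (∃ F : SymplecticFlow.FrameData (n - 1) U,
          F.hPe = hPe ∧ F.wPe = wPe ∧ SymplecticFlow.CartanEquations u F) ↔
        SymplecticFlow.OperatorFlow u wPe (SymplecticFlow.hUp hPe)) ∧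
    -- the operators are given by the explicit arrays, for every genuine right inverse of `D_x`
    (∀ (A : Type) [CommRing A] [StarRing A] [Algebra ℂ A] [StarModule ℂ A]
        (D : SymplecticFlow.RealDer A) (I : A →+ A),
        (∀ a, D.der (I a) = a) → (∀ a, I (star a) = star (I a)) →
        ∀ u w : SymplecticFlow.Vec (n - 1) A,
          SymplecticFlow.opH (n - 1) A D u w
            (SymplecticFlow.applyBlock (SymplecticFlow.blockH D.der I u) w) ∧
          SymplecticFlow.opJ (n - 1) A D u w
            (SymplecticFlow.applyBlock (SymplecticFlow.blockJ D.der I u) w)) ∧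
    SymplecticFlow.IsHamiltonian (SymplecticFlow.opH (n - 1)) ∧
    SymplecticFlow.IsSymplectic (SymplecticFlow.opJ (n - 1)) ∧
    SymplecticFlow.IsCompatible (SymplecticFlow.opH (n - 1)) (SymplecticFlow.opJ (n - 1)) ∧
    SymplecticFlow.IsSpInvariant (SymplecticFlow.opH (n - 1)) ∧
    SymplecticFlow.IsSpInvariant (SymplecticFlow.opJ (n - 1)) := by
  have hm : 1 ≤ n - 1 := by omega
  refine ⟨fun U g u F h => ?_, fun U u hPe wPe => ⟨?_, ?_⟩, fun A _ _ _ _ D I hD hI u w => ?_,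
    SymplecticFlow.isHamiltonian_opH _, SymplecticFlow.isSymplectic_opJ _,
    SymplecticFlow.isCompatible_opH_opJ _, SymplecticFlow.opH_invariant,
    SymplecticFlow.opJ_invariant⟩
  · have hC := SymplecticFlow.cartan_of_framing h
    exact ⟨hC, SymplecticFlow.operatorFlow_of_cartan hm hC⟩
  · rintro ⟨F, rfl, rfl, h⟩
    exact SymplecticFlow.operatorFlow_of_cartan hm h
  · exact SymplecticFlow.cartan_of_operatorFlow hm
  · exact ⟨SymplecticFlow.opH_blockH I D hD hI u w, SymplecticFlow.opJ_blockJ I D hD hI u w⟩
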